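/- **Setting.** Let $n\ge 2$, $c>0$, $\alpha\in(0,1]$. Let $V^l,V^s\in C^2(\mathbb R^n,\mathbb R)$ and let $B^l,B^s$ be $C^1$ maps from $\mathbb R^n$ to the real antisymmetric $n\times n$ matrices, such that $B=B^l+B^s$ satisfies $\partial_iB_{k,m}+\partial_mB_{i,k}+\partial_kB_{m,i}=0$ for all $i,k,m$. Assume that for positive constants $\beta^l_0,\beta^l_1,\beta^l_2,\beta^s_1,\beta^s_2,\beta^s_3$, all $x\in\mathbb R^n$, all $i,k$ and all multi-indices $|j_1|\le 2$, $|j_2|\le 1$, $$|\partial^{j_1}V^l(x)|\le\beta^l_{|j_1|}(1+|x|)^{-(\alpha+|j_1|)},\quad |\partial^{j_2}B^l_{i,k}(x)|\le\beta^l_{|j_2|+1}(1+|x|)^{-(\alpha+|j_2|+1)},$$ $$|\partial^{j_1}V^s(x)|\le\beta^s_{|j_1|+1}(1+|x|)^{-(\alpha+1+|j_1|)},\quad |\partial^{j_2}B^s_{i,k}(x)|\le\beta^s_{|j_2|+2}(1+|x|)^{-(\alpha+|j_2|+2)}.$$ Put $F^l(x,v)=-\nabla V^l(x)+\frac1cB^l(x)v$,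 $F^s(x,v)=-\nabla V^s(x)+\frac1cB^s(x)v$, $F=F^l+F^s$, and write $H(f)(\tau)=H(f(\tau),\dot f(\tau))$ for $H=F,F^l,F^s$ and a curve $f$. Consider the relativistic Newton equation $\dot p=F(x,\dot x)$, $p=\dot x/\sqrt{1-|\dot x|^2/c^2}$, for $C^2$ curves with $|\dot x|<c$. Let $g(p)=p/\sqrt{1+|p|^2/c^2}$ and $g^{-1}(v)=v/\sqrt{1-|v|^2/c^2}$ for $|v|<c$. Put $\beta_2=\max(\beta^l_2,\beta^s_2)$, $\beta=\max(\beta^l_1,\beta_2,\beta^s_3)$, $\mu(\sigma)=\sqrt{2\sigma/(\sigma/c^2+\sqrt{\sigma^2/c^4+4})}$ and $\mu^l=\mu(2^8\alpha^{-1}n^2\max(\beta^l_1,\beta^l_2))$. For $\mu^l\le|v|<c$ let $z_\pm(v,\cdot)$ be the unique solution of $\dot p=F^l(z,\dot z)$ on $\mathbb R$ with $z(0)=0$, $\dot z(t)\to v$ as $t\to\pm\infty$ and $$\sup_{\mathbb R}|\dot z-v|\le\frac{2^{9/2}n^{3/2}\beta^l_1\sqrt{1-|v|^2/c^2}}{\alpha|v|}.$$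 Let $\mu^l\le|v_-|<c$, $x_-\in\mathbb R^n$, $v_-\cdot x_-=0$, $0<r<\min(|v_-|/2^{3/2},1)$, and put $s=\sqrt{1-|v_-|^2/c^2}$, $\kappa=\frac{|v_-|}{2\sqrt2}-r$. Define $A(f)(t)=\int_{-\infty}^t\dot A(f)(\sigma)\,d\sigma$ with $$\dot A(f)(t)=g\Big(g^{-1}(v_-)+\int_{-\infty}^tF(z_-(v_-,\cdot)+x_-+f)(\tau)d\tau\Big)-g\Big(g^{-1}(v_-)+\int_{-\infty}^tF^l(z_-(v_-,\cdot))(\tau)d\tau\Big).$$ Let $M_{r,v_-}$ be the set of $f\in C^1(\mathbb R,\mathbb R^n)$ with $\sup_{\mathbb R}|\dot z_-(v_-,\cdot)+\dot f|\le c$, $\sup_{t<0}\max(1,1-r+\kappa|t|)|\dot f(t)|\le r$, $\sup_{t>0}|\dot f(t)|\le r$ and $\sup_{t<0}|f(t)|\le r$. Let $y_-\in M_{r,v_-}$ be a fixed point of $A$, and put $x=z_-(v_-,\cdot)+x_-+y_-$, $$a=g\Big(g^{-1}(v_-)+\int_{\mathbb R}F(x)(\tau)d\tau\Big),\qquad b=x_-+A(y_-)(0)-y_+(0),$$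 $$y_+(t)=-\int_t^{+\infty}\Big(g\Big(g^{-1}(a)-\int_\sigma^{+\infty}F(x)(\tau)d\tau\Big)-g\Big(g^{-1}(a)-\int_\sigma^{+\infty}F^l(z_+(a,\cdot))(\tau)d\tau\Big)\Big)d\sigma,$$ $a_{sc}=a-v_-$, $b_{sc}=b-x_-$, and $$W=\int_{-\infty}^0\Big(g\Big(g^{-1}(v_-)+\int_{-\infty}^\sigma F^l(z_-(v_-,\cdot)+x_-)d\tau\Big)-g\Big(g^{-1}(v_-)+\int_{-\infty}^\sigma F^l(z_-(v_-,\cdot))d\tau\Big)\Big)d\sigma$$ $$\qquad+\int_0^{+\infty}\Big(g\Big(g^{-1}(a)-\int_\sigma^{+\infty} F^l(z_+(a,\cdot)+x_-)d\tau\Big)-g\Big(g^{-1}(a)-\int_\sigma^{+\infty} F^l(z_+(a,\cdot))d\tau\Big)\Big)d\sigma.$$ **Theorem.** Assume in addition that $$\frac{24n^2s\max(\beta^l_1,\beta_2)(1+\frac1c)(1+\frac1\kappa)}{\alpha\kappa(1-r)^{\alpha+1}}\le1.$$ Then $z_-(v_-,\cdot)$ and $z_+(a,\cdot)$ exist and are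 unique, all the integrals above (with $f=y_-$) and below converge absolutely, $x$ is a solution of the relativistic Newton equation, $\mu^l\le|a|<c$, $x(t)=z_+(a,t)+b+y_+(t)$ for $t\ge0$, and $|y_\mp(t)|+|\dot y_\mp(t)|\to0$ as $t\to\mp\infty$; that is, $(a,b)$ are the scattering data of $x$. Moreover the following estimates hold: $$|\dot y_-(t)|\le\frac{2n^{3/2}s\big(\frac{r\beta^l_1}c+2\beta_2(n^{1/2}(|x_-|+r)+1)\big)}{(\alpha+1)\kappa(1-r-\kappa t)^{\alpha+1}}\qquad(t\le0),$$ $$|a_{sc}|\le\frac{8n^{3/2}s}{\kappa(1+\frac{|x_-|}{\sqrt2}-r)^\alpha}\Big(\frac{\beta^l_1}\alpha+\frac{\beta_2}{(\alpha+1)(1+\frac{|x_-|}{\sqrt2}-r)}\Big),$$ $$|b_{sc}|\le\frac{4n^{3/2}s\big(\frac{r\beta^l_1}c+\beta_2(n^{1/2}(4|x_-|+r)+4)\big)}{\alpha(\alpha+1)\kappa^2(1-r)^\alpha},$$ $$|\dot y_+(t)|\le\frac{2n^{3/2}s\big(\frac{r\beta^l_1}c+2\beta_2(n^{1/2}(3|x_-|+r)+3)\big)}{(\alpha+1)\kappa(1-r+\kappa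 t)^{\alpha+1}}\qquad(t\ge0),$$ $$\Big|a_{sc}-s\int_{\mathbb R}F(\tau v_-+x_-,v_-)d\tau\Big|\le\frac{520n^4\beta^2s^2(\frac rc+|x_-|+1)(\frac1c+1)(1+\frac1\kappa)^2}{\alpha^2\kappa^2(1-r)^{2\alpha+3}},$$ $$\Big|b_{sc}-W-s\Big(\int_{-\infty}^0\int_{-\infty}^\sigma F^s(\tau v_-+x_-,v_-)d\tau d\sigma-\int_0^{+\infty}\int_\sigma^{+\infty}F^s(\tau v_-+x_-,v_-)d\tau d\sigma+\int_{\mathbb R}V^s(\sigma v_-+x_-)d\sigma\,\frac{v_-}{c^2}\Big)\Big|$$ $$\le\frac{468n^4\beta^2s^2(\frac rc+|x_-|+1)(\frac1c+1)(1+\frac1\kappa)^2}{\alpha^2(\alpha+1)\kappa^3(1-r)^{2\alpha+2}}.$$ -/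

import Mathlib

open Real Set Filter Topology MeasureTheory

noncomputable section

namespace RelScat

/-- Euclidean space of dimension `n`. -/
abbrev E (n : ℕ) := EuclideanSpace ℝ (Fin n)

/-- The `i`-th partial derivative of a real function. -/
def pd {n : ℕ} (i : Fin n) (f : E n → ℝ) (x : E n) : ℝ :=
  fderiv ℝ f x (EuclideanSpace.single i 1)

/-- All partial derivatives of `f` of order `m ≤ 1` are bounded by `bₘ (1 + |x|)^{-(γ + m)}`. -/
structure DecayOne {n : ℕ} (f : E n → ℝ) (γ b₀ b₁ : ℝ) : Prop where
  zero : ∀ x, |f x| ≤ b₀ * (1 + ‖x‖) ^ (-γ)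
  one : ∀ i x, |pd i f x| ≤ b₁ * (1 + ‖x‖) ^ (-(γ + 1))

/-- All partial derivatives of `f` of order `m ≤ 2` are bounded by `bₘ (1 + |x|)^{-(γ + m)}`. -/
structure DecayTwo {n : ℕ} (f : E n → ℝ) (γ b₀ b₁ b₂ : ℝ) : Prop where
  zero : ∀ x, |f x| ≤ b₀ * (1 + ‖x‖) ^ (-γ)
  one : ∀ i x, |pd i f x| ≤ b₁ * (1 + ‖x‖) ^ (-(γ + 1))
  two : ∀ i j x, |pd i (pd j f) x| ≤ b₂ * (1 + ‖x‖) ^ (-(γ + 2))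

/-- The force `-∇V(x) + c⁻¹ B(x) v`. -/
def emForce {n : ℕ} (c : ℝ) (V : E n → ℝ) (B : E n → Matrix (Fin n) (Fin n) ℝ) (x v : E n) : E n :=
  -gradient V x + (1 / c) • Matrix.toEuclideanLin (B x) v

/-- The standing data: speed of light `c`, decay exponent `α`, long range and short range
potentials and magnetic fields, and the constants of their decay estimates. -/
structure Setting (n : ℕ) where
  c : ℝ
  α : ℝ
  /-- long range potential -/
  Vl : E n → ℝ
  /-- short range potential -/
  Vs : E n → ℝ
  /-- long range magnetic field -/
  Bl : E n → Matrix (Fin n) (Fin n) ℝ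
  /-- short range magnetic field -/
  Bs : E n → Matrix (Fin n) (Fin n) ℝ
  βl0 : ℝ
  βl1 : ℝ
  βl2 : ℝ
  βs1 : ℝ
  βs2 : ℝ
  βs3 : ℝ
  c_pos : 0 < c
  α_pos : 0 < α
  α_le_one : α ≤ 1
  βl0_pos : 0 < βl0
  βl1_pos : 0 < βl1
  βl2_pos : 0 < βl2
  βs1_pos : 0 < βs1
  βs2_pos : 0 < βs2
  βs3_pos : 0 < βs3
  Vl_smooth : ContDiff ℝ 2 Vl
  Vs_smooth : ContDiff ℝ 2 Vs
  Bl_smooth : ∀ i k, ContDiff ℝ 1 (fun x => Bl x i k)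
  Bs_smooth : ∀ i k, ContDiff ℝ 1 (fun x => Bs x i k)
  Bl_antisymm : ∀ x, (Bl x).transpose = -Bl x
  Bs_antisymm : ∀ x, (Bs x).transpose = -Bs x
  /-- the closure condition on the total magnetic field `B = Bl + Bs` -/
  closure_condition : ∀ i k m x,
    pd i (fun y => Bl y k m + Bs y k m) x + pd m (fun y => Bl y i k + Bs y i k) x
      + pd k (fun y => Bl y m i + Bs y m i) x = 0
  Vl_decay : DecayTwo Vl α βl0 βl1 βl2
  Bl_decay : ∀ i k, DecayOne (fun x => Bl x i k) (α + 1) βl1 βl2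
  Vs_decay : DecayTwo Vs (α + 1) βs1 βs2 βs3
  Bs_decay : ∀ i k, DecayOne (fun x => Bs x i k) (α + 2) βs2 βs3

/-- `g(p) = p / √(1 + |p|²/c²)`. -/
def g {n : ℕ} (c : ℝ) (p : E n) : E n := (1 / √(1 + ‖p‖ ^ 2 / c ^ 2)) • p

/-- `g⁻¹(v) = v / √(1 - |v|²/c²)`, for `|v| < c`. -/
def gInv {n : ℕ} (c : ℝ) (v : E n) : E n := (1 / √(1 - ‖v‖ ^ 2 / c ^ 2)) • v

/-- `H(f)(τ) = H(f(τ), f'(τ))`. -/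
def along {n : ℕ} (H : E n → E n → E n) (f : ℝ → E n) (τ : ℝ) : E n := H (f τ) (deriv f τ)

/-- `x` is a `C²` solution on the whole line of the relativistic Newton equation with force `H`:
`p' = H(x, x')`, where `p = x' / √(1 - |x'|²/c²)` and `|x'| < c`. -/
structure IsSolution {n : ℕ} (c : ℝ) (H : E n → E n → E n) (x : ℝ → E n) : Prop where
  smooth : ContDiff ℝ 2 x
  speed_lt : ∀ t, ‖deriv x t‖ < c
  newton : ∀ t, HasDerivAt (fun s => gInv c (deriv x s)) (along H x t) t

/-- `μ(σ) = √(2σ / (σ/c² + √(σ²/c⁴ + 4)))`. -/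
def mu (c σ : ℝ) : ℝ := √(2 * σ / (σ / c ^ 2 + √(σ ^ 2 / c ^ 4 + 4)))

/-- `g(g⁻¹(v) + ∫_{-∞}^σ H(f)(τ) dτ)`. -/
def velIn {n : ℕ} (c : ℝ) (v : E n) (H : E n → E n → E n) (f : ℝ → E n) (σ : ℝ) : E n :=
  g c (gInv c v + ∫ τ in Iic σ, along H f τ)

/-- `g(g⁻¹(v) - ∫_σ^{+∞} H(f)(τ) dτ)`. -/
def velOut {n : ℕ} (c : ℝ) (v : E n) (H : E n → E n → E n) (f : ℝ → E n) (σ : ℝ) : E n :=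
  g c (gInv c v - ∫ τ in Ioi σ, along H f τ)

namespace Setting

variable {n : ℕ} (S : Setting n)

/-- The long range force. -/
def Fl : E n → E n → E n := emForce S.c S.Vl S.Bl

/-- The short range force. -/
def Fs : E n → E n → E n := emForce S.c S.Vs S.Bs

/-- The total force `F = F^l + F^s`. -/
def F : E n → E n → E n := fun x v => S.Fl x v + S.Fs x v

/-- `√(1 - |v|²/c²)`. -/
def s (v : E n) : ℝ := √(1 - ‖v‖ ^ 2 / S.c ^ 2)

/-- `β₂ = max(β₂^l, β₂^s)`. -/
def β2 : ℝ := max S.βl2 S.βs2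

/-- `β = max(β₁^l, β₂, β₃^s)`. -/
def β : ℝ := max (max S.βl1 S.β2) S.βs3

/-- The threshold speed `μ^l = μ(2⁸ α⁻¹ n² max(β₁^l, β₂^l))`. -/
def muL : ℝ := mu S.c (2 ^ 8 * S.α⁻¹ * (n : ℝ) ^ 2 * max S.βl1 S.βl2)

/-- `z` solves the equation with force `F^l`, starts at the origin, has velocity `v` at the end
`l` of the time line (`l = atBot` or `l = atTop`), and stays close to the free motion `tv`. -/
structure IsFree (l : Filter ℝ) (v : E n) (z : ℝ → E n) : Prop where
  solution : IsSolution S.c S.Fl z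
  asymptotic : Tendsto (deriv z) l (𝓝 v)
  origin : z 0 = 0
  close : ∀ t, ‖deriv z t - v‖ ≤
    (2 : ℝ) ^ (9 / 2 : ℝ) * (n : ℝ) ^ (3 / 2 : ℝ) * S.βl1 * S.s v / (S.α * ‖v‖)

/-- The solution `z_-(v, ·)`: the (unique, when `μ^l ≤ |v| < c`) function with `IsFree atBot v`. -/
def zMinus (v : E n) : ℝ → E n := Classical.epsilon (S.IsFree atBot v)

/-- The solution `z_+(v, ·)`: the (unique, when `μ^l ≤ |v| < c`) function with `IsFree atTop v`. -/
def zPlus (v : E n) : ℝ → E n := Classical.epsilon (S.IsFree atTop v)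

/-- The trajectory `z_-(v_-, ·) + x_- + f`. -/
def traj (v x : E n) (f : ℝ → E n) (t : ℝ) : E n := S.zMinus v t + x + f t

/-- The function `Ȧ(f)` for the data `(v_-, x_-) = (v, x)`. -/
def Adot (v x : E n) (f : ℝ → E n) (t : ℝ) : E n :=
  velIn S.c v S.F (S.traj v x f) t - velIn S.c v S.Fl (S.zMinus v) t

/-- The integral operator `A` for the data `(v_-, x_-) = (v, x)`. -/
def A (v x : E n) (f : ℝ → E n) (t : ℝ) : E n := ∫ σ in Iic t, S.Adot v x f σ

/-- The set `M_{r,v}`: `f ∈ C¹`, `sup |ż_-(v,·) + ḟ| ≤ c` and `‖f‖ ≤ r`, where `‖f‖` is the maximum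
of `sup_{t<0} max(1, 1 - r + (|v|/(2√2) - r)|t|) |ḟ(t)|`, `sup_{t>0} |ḟ|` and `sup_{t<0} |f|`. -/
structure MemM (r : ℝ) (v : E n) (f : ℝ → E n) : Prop where
  smooth : ContDiff ℝ 1 f
  speed_le : ∀ t, ‖deriv (S.zMinus v) t + deriv f t‖ ≤ S.c
  deriv_neg : ∀ t < 0,
    max 1 (1 - r + (‖v‖ / (2 * √2) - r) * |t|) * ‖deriv f t‖ ≤ r
  deriv_pos : ∀ t > 0, ‖deriv f t‖ ≤ r
  neg : ∀ t < 0, ‖f t‖ ≤ r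

/-- The outgoing velocity `a(v_-, x_-)` of the trajectory with deflection `y = y_-`. -/
def a (v x : E n) (y : ℝ → E n) : E n :=
  g S.c (gInv S.c v + ∫ τ, along S.F (S.traj v x y) τ)

/-- The integrand of `y_+`. -/
def yPlusIntegrand (v x : E n) (y : ℝ → E n) (σ : ℝ) : E n :=
  velOut S.c (S.a v x y) S.F (S.traj v x y) σ
    - velOut S.c (S.a v x y) S.Fl (S.zPlus (S.a v x y)) σ

/-- The outgoing deflection `y_+`. -/
def yPlus (v x : E n) (y : ℝ → E n) (t : ℝ) : E n :=
  -∫ σ in Ioi t, S.yPlusIntegrand v x y σ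

/-- The outgoing position `b(v_-, x_-)` of the trajectory with deflection `y = y_-`. -/
def b (v x : E n) (y : ℝ → E n) : E n := x + S.A v x y 0 - S.yPlus v x y 0

/-- `a_sc = a - v_-`. -/
def asc (v x : E n) (y : ℝ → E n) : E n := S.a v x y - v

/-- `b_sc = b - x_-`. -/
def bsc (v x : E n) (y : ℝ → E n) : E n := S.b v x y - x

/-- The integrand of the incoming part of `W`. -/
def WInIntegrand (v x : E n) (σ : ℝ) : E n :=
  velIn S.c v S.Fl (fun τ => S.zMinus v τ + x) σ - velIn S.c v S.Fl (S.zMinus v) σ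

/-- The integrand of the outgoing part of `W`, where `w` stands for `a(v, x)`. -/
def WOutIntegrand (w x : E n) (σ : ℝ) : E n :=
  velOut S.c w S.Fl (fun τ => S.zPlus w τ + x) σ - velOut S.c w S.Fl (S.zPlus w) σ

/-- The vector `W(v, x)`. -/
def W (v x : E n) (y : ℝ → E n) : E n :=
  (∫ σ in Iic (0 : ℝ), S.WInIntegrand v x σ)
    + ∫ σ in Ioi (0 : ℝ), S.WOutIntegrand (S.a v x y) x σ

/-- `x` is a solution of the equation with force `F`, asymptotic to `z_-(v_-, ·) + x_-` at `-∞` and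
to `z_+(v_+, ·) + x_+` at `+∞`, positions and velocities; `|v_±|` are admissible speeds. -/
structure IsScatteringSolution (vm xm vp xp : E n) (x : ℝ → E n) : Prop where
  solution : IsSolution S.c S.F x
  speed_in : S.muL ≤ ‖vm‖ ∧ ‖vm‖ < S.c
  speed_out : S.muL ≤ ‖vp‖ ∧ ‖vp‖ < S.c
  incoming : Tendsto (fun t => x t - (S.zMinus vm t + xm)) atBot (𝓝 0)
  incoming_vel : Tendsto (fun t => deriv x t - deriv (S.zMinus vm) t) atBot (𝓝 0)
  outgoing : Tendsto (fun t => x t - (S.zPlus vp t + xp)) atTop (𝓝 0)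
  outgoing_vel : Tendsto (fun t => deriv x t - deriv (S.zPlus vp) t) atTop (𝓝 0)

/-- The integrals that define `A(y)`, `a`, `b`, `y_+` and `W`, and those along the straight line
`τ ↦ τv + x`, converge absolutely. -/
structure IntegralsConverge (v x : E n) (y : ℝ → E n) : Prop where
  force : Integrable (along S.F (S.traj v x y))
  force_in : Integrable (along S.Fl (S.zMinus v))
  force_in_shift : Integrable (along S.Fl (fun τ => S.zMinus v τ + x))
  force_out : IntegrableOn (along S.Fl (S.zPlus (S.a v x y))) (Ioi 0)
  force_out_shift : IntegrableOn (along S.Fl (fun τ => S.zPlus (S.a v x y) τ + x)) (Ioi 0)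
  deflection_in : IntegrableOn (S.Adot v x y) (Iic 0)
  deflection_out : IntegrableOn (S.yPlusIntegrand v x y) (Ioi 0)
  W_in : IntegrableOn (S.WInIntegrand v x) (Iic 0)
  W_out : IntegrableOn (S.WOutIntegrand (S.a v x y) x) (Ioi 0)
  line_force : Integrable (fun τ : ℝ => S.F (τ • v + x) v)
  line_short : Integrable (fun τ : ℝ => S.Fs (τ • v + x) v)
  line_short_in : IntegrableOn (fun σ : ℝ => ∫ τ in Iic σ, S.Fs (τ • v + x) v) (Iic 0)
  line_short_out : IntegrableOn (fun σ : ℝ => ∫ τ in Ioi σ, S.Fs (τ • v + x) v) (Ioi 0)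
  line_potential : Integrable (fun σ : ℝ => S.Vs (σ • v + x))

end Setting

end RelScat

end

/-!
The momentum `p = g⁻¹(ẋ)` of a trajectory satisfies `ṗ = F(x, ẋ)`, so every velocity in the problem
is `g` of a momentum at infinity plus an integral of the force along a curve. The map `g` is
Lipschitz with a constant that can be read off at either one of the two momenta
(`norm_g_sub_g_le`), namely `2/γ`, and `1/γ = s` at a momentum with velocity `v`. Everything thus
reduces to integrals of force differences.

All curves that occur (the trajectory, the free solutions, their translates by `x_-`, and the
line `tv + x_-`) run in a convex neighbourhood of the line, `tube`, in which `1 + |q|` is at least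
`ρ(t) = 1 - r + κ|t|` (`rho_le_of_mem_tube`). Because the neighbourhood is convex, the mean value
inequality turns the decay assumptions into powers of `ρ` also for force differences, and these
are integrated explicitly.

Free solutions. The map that sends a velocity deviation to the one given by the momentum equation
is a contraction when the speed is at least `μ^l` (`existsUnique_isFreeOut`). Solutions prescribed
at `-∞` are solutions prescribed at `+∞` for the reversed force `H(x, -v)`; the same time reversal
later reduces every incoming estimate to the outgoing one.

Scattering data. A fixed point of the integral operator gives a solution, and the total energy
`c² γ + V` is constant along it. The potential vanishes at both ends, so the Lorentz factors there
agree (`FixedPoint.gam_out_eq`): `|a| = |v_-|`, and `a - v_- = s ∫ F(x)` holds exactly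
(`FixedPoint.asc_eq`). In particular `z_+(a, ·)` exists.

Decay of the deflections. The velocity of a deflection `u` from a free solution is bounded by the
integral of a force difference, which is bounded by `u` and its velocity. Feeding in the bound
`θ + C ρ^{-(α+1)}` returns `θ/2 + C ρ^{-(α+1)}`, and `θ` can be any bound of the velocity to begin
with (`norm_deriv_le_of_integral_bound`). This gives `y_-` and `y_+` at once.

Comparison with the line. For `a_sc` the force along the trajectory is compared with the force
along the line (`FixedPoint.norm_asc_sub_le_shortDiff`). For `b_sc` the long range motion is
already subtracted in `W`, and what remains is the velocity difference between the trajectory and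
the shifted free solution. Expanding `g` to second order (`norm_g_sub_g_sub_le`), its first order
part is `-s (I - ⟨v, I⟩ v / c²)`, where `I` is the short range momentum transfer along a half-line;
the magnetic force does no work, so `⟨v, I⟩` is the value of `V^s` at the end point
(`Forces.inner_integral_line`). This is the origin of the term with `∫ V^s`.
The smallness hypothesis enters through `smallness`: it makes the coefficients of the iteration
small and turns a square of a first order quantity into a multiple of the second order error.
-/

namespace RelScat

variable {n : ℕ} {c : ℝ}

/-! ### The relativistic velocity map -/

/-- The Lorentz factor `√(1 + |p|²/c²)` as a function of the momentum. -/
noncomputable def gam (c : ℝ) (p : E n) : ℝ := √(1 + ‖p‖ ^ 2 / c ^ 2)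

lemma g_eq (p : E n) : g c p = (1 / gam c p) • p := rfl

lemma gam_sq (p : E n) : gam c p ^ 2 = 1 + ‖p‖ ^ 2 / c ^ 2 :=
  Real.sq_sqrt (by positivity)

lemma gam_pos (p : E n) : 0 < gam c p := Real.sqrt_pos.2 (by positivity)

lemma norm_div_lt_gam (p : E n) : ‖p‖ / c < gam c p := by
  refine lt_of_pow_lt_pow_left₀ 2 (gam_pos p).le ?_
  rw [gam_sq, div_pow]; linarith

lemma norm_g_lt (hc : 0 < c) (p : E n) : ‖g c p‖ < c := by
  have h := norm_div_lt_gam (c := c) p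
  rw [g_eq, norm_smul, Real.norm_of_nonneg (by have := gam_pos (c := c) p; positivity),
    one_div, inv_mul_lt_iff₀ (gam_pos p)]
  rwa [div_lt_iff₀ hc] at h

lemma gam_smul_g (p : E n) : gam c p • g c p = p := by
  rw [g_eq, smul_smul, mul_one_div, div_self (gam_pos p).ne', one_smul]

lemma norm_add_div_le (hc : 0 < c) (p q : E n) : ‖p + q‖ ≤ c * (gam c p + gam c q) := by
  have h1 := norm_div_lt_gam (c := c) p
  have h2 := norm_div_lt_gam (c := c) q
  rw [div_lt_iff₀ hc] at h1 h2
  linarith [norm_add_le p q]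

lemma gam_sub_gam (p q : E n) :
    gam c p - gam c q = inner ℝ ((1 / (gam c p + gam c q)) • (p + q)) (p - q) / c ^ 2 := by
  have h1 := gam_sq (c := c) p
  have h2 := gam_sq (c := c) q
  have h3 : inner ℝ (p + q) (p - q) = ‖p‖ ^ 2 - ‖q‖ ^ 2 := by
    rw [inner_add_left, inner_sub_right, inner_sub_right, real_inner_comm p q,
      real_inner_self_eq_norm_sq, real_inner_self_eq_norm_sq]; ring
  rw [inner_smul_left, h3]
  have h4 : 0 < gam c p + gam c q := add_pos (gam_pos p) (gam_pos q)
  have h5 : (gam c p - gam c q) * (gam c p + gam c q) = (‖p‖ ^ 2 - ‖q‖ ^ 2) / c ^ 2 := by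
    rw [sub_div]; linear_combination h1 - h2
  simp only [conj_trivial]
  field_simp
  linarith [h5]

/-- The mean velocity `(p + q) / (γ(p) + γ(q))` is at most the speed of light. -/
lemma norm_mean_le (hc : 0 < c) (p q : E n) :
    ‖(1 / (gam c p + gam c q)) • (p + q)‖ ≤ c := by
  have h4 : 0 < gam c p + gam c q := add_pos (gam_pos p) (gam_pos q)
  rw [norm_smul, Real.norm_of_nonneg (by positivity), one_div, inv_mul_le_iff₀ h4, mul_comm]
  exact norm_add_div_le hc p q

lemma abs_gam_sub_gam_le (hc : 0 < c) (p q : E n) : |gam c p - gam c q| ≤ ‖p - q‖ / c := by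
  rw [gam_sub_gam, abs_div, abs_of_pos (pow_pos hc 2), div_le_div_iff₀ (pow_pos hc 2) hc]
  have := abs_real_inner_le_norm ((1 / (gam c p + gam c q)) • (p + q)) (p - q)
  have h2 := norm_mean_le hc p q
  nlinarith [norm_nonneg (p - q), mul_le_mul_of_nonneg_right h2 (norm_nonneg (p - q)),
    mul_le_mul_of_nonneg_right (this.trans (mul_le_mul_of_nonneg_right h2 (norm_nonneg (p - q))))
      hc.le]

/-- An exact finite-difference formula for `g`, from `γ(p)² - γ(q)² = (|p|² - |q|²) / c²`. -/
lemma g_sub_g (p q : E n) :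
    g c p - g c q = (1 / gam c p) • ((p - q)
      - (inner ℝ ((1 / (gam c p + gam c q)) • (p + q)) (p - q) / c ^ 2) • g c q) := by
  rw [← gam_sub_gam, sub_smul, gam_smul_g]
  have : p - q - (gam c p • g c q - q) = p - gam c p • g c q := by abel
  rw [this, smul_sub, smul_smul, one_div_mul_cancel (gam_pos p).ne', one_smul, ← g_eq]

/-- The operators `D ↦ D - ⟨u, D⟩ w / c²` that occur in the differences and in the differential of
`g` have norm at most `2`. -/
lemma norm_sub_smul_le (hc : 0 < c) (D u w : E n) (hu : ‖u‖ ≤ c) (hw : ‖w‖ ≤ c) :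
    ‖D - (inner ℝ u D / c ^ 2) • w‖ ≤ 2 * ‖D‖ := by
  have h1 : ‖(inner ℝ u D / c ^ 2) • w‖ ≤ ‖D‖ := by
    rw [norm_smul, Real.norm_eq_abs, abs_div, abs_of_pos (pow_pos hc 2), div_mul_eq_mul_div,
      div_le_iff₀ (pow_pos hc 2)]
    have h2 : |inner ℝ u D| ≤ c * ‖D‖ :=
      (abs_real_inner_le_norm u D).trans (mul_le_mul_of_nonneg_right hu (norm_nonneg _))
    calc |inner ℝ u D| * ‖w‖ ≤ (c * ‖D‖) * c :=
          mul_le_mul h2 hw (norm_nonneg _) (by positivity)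
      _ = _ := by ring
  linarith [norm_sub_le D ((inner ℝ u D / c ^ 2) • w)]

/-- The velocity map is Lipschitz, with the constant read off at one of the two momenta only. -/
lemma norm_g_sub_g_le (hc : 0 < c) (p q : E n) :
    ‖g c p - g c q‖ ≤ 2 / gam c p * ‖p - q‖ := by
  have hp := gam_pos (c := c) p
  rw [g_sub_g, norm_smul, Real.norm_of_nonneg (by positivity)]
  calc 1 / gam c p * _ ≤ 1 / gam c p * (2 * ‖p - q‖) :=
        mul_le_mul_of_nonneg_left (norm_sub_smul_le hc _ _ _ (norm_mean_le hc p q)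
          (norm_g_lt hc q).le) (by positivity)
    _ = _ := by ring

/-- Second order expansion of `g` around `p`: the difference `g p₁ - g p₂` is the differential of
`g` at `p` applied to `p₁ - p₂`, up to an error controlled by the distance of `p₁`, `p₂` to `p`. -/
lemma norm_g_sub_g_sub_le (hc : 0 < c) (p p₁ p₂ : E n) (Q : ℝ) (h1 : ‖p₁ - p‖ ≤ Q)
    (h2 : ‖p₂ - p‖ ≤ Q) (h3 : 1 / gam c p₁ ≤ 2 / gam c p) :
    ‖g c p₁ - g c p₂ - (1 / gam c p) • ((p₁ - p₂)
      - (inner ℝ (g c p) (p₁ - p₂) / c ^ 2) • g c p)‖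
      ≤ 8 * (1 / gam c p) ^ 2 / c * Q * ‖p₁ - p₂‖ := by
  have hγ := gam_pos (c := c) p
  have hγ1 := gam_pos (c := c) p₁
  have hγ2 := gam_pos (c := c) p₂
  have hQ : 0 ≤ Q := (norm_nonneg _).trans h1
  set D := p₁ - p₂ with hD
  set σ := 1 / gam c p with hσ
  set σ1 := 1 / gam c p₁ with hσ1
  set u := g c p with hu
  set m := (1 / (gam c p₁ + gam c p₂)) • (p₁ + p₂) with hm
  have hσ0 : 0 < σ := by positivity
  have e1 : ‖g c p₁ - u‖ ≤ 2 * σ * Q := by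
    rw [norm_sub_rev]
    refine (norm_g_sub_g_le hc p p₁).trans ?_
    rw [norm_sub_rev, hσ, mul_one_div]
    gcongr
  have e2 : ‖g c p₂ - u‖ ≤ 2 * σ * Q := by
    rw [norm_sub_rev]
    refine (norm_g_sub_g_le hc p p₂).trans ?_
    rw [norm_sub_rev, hσ, mul_one_div]
    gcongr
  have e3 : ‖m - u‖ ≤ 2 * σ * Q := by
    have hs : 0 < gam c p₁ + gam c p₂ := by positivity
    have : m - u = (1 / (gam c p₁ + gam c p₂)) •
        (gam c p₁ • (g c p₁ - u) + gam c p₂ • (g c p₂ - u)) := by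
      rw [hm, smul_sub, smul_sub, gam_smul_g, gam_smul_g]
      have : p₁ - gam c p₁ • u + (p₂ - gam c p₂ • u)
          = (p₁ + p₂) - (gam c p₁ + gam c p₂) • u := by rw [add_smul]; abel
      rw [this, smul_sub, smul_smul, one_div_mul_cancel hs.ne', one_smul]
    rw [this, norm_smul, Real.norm_of_nonneg (by positivity), one_div, inv_mul_le_iff₀ hs]
    refine (norm_add_le _ _).trans ?_
    rw [norm_smul, norm_smul, Real.norm_of_nonneg hγ1.le, Real.norm_of_nonneg hγ2.le, add_mul]
    gcongr
  have e4 : |σ1 - σ| ≤ 2 * σ ^ 2 * (Q / c) := by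
    have h : σ1 - σ = (gam c p - gam c p₁) * (σ * σ1) := by
      rw [hσ, hσ1]; field_simp
    have h5 : |gam c p - gam c p₁| ≤ Q / c :=
      (abs_gam_sub_gam_le hc p p₁).trans (by rw [norm_sub_rev]; gcongr)
    have hσ10 : 0 < σ1 := by positivity
    rw [h, abs_mul, abs_of_pos (mul_pos hσ0 hσ10)]
    have h6 : σ1 ≤ 2 * σ := by rw [hσ, mul_one_div]; exact h3
    calc |gam c p - gam c p₁| * (σ * σ1) ≤ Q / c * (σ * (2 * σ)) := by gcongr
      _ = _ := by ring
  have key : g c p₁ - g c p₂ - σ • (D - (inner ℝ u D / c ^ 2) • u)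
      = (σ1 - σ) • (D - (inner ℝ m D / c ^ 2) • g c p₂)
        - (σ / c ^ 2) • ((inner ℝ (m - u) D) • g c p₂ + (inner ℝ u D) • (g c p₂ - u)) := by
    rw [g_sub_g p₁ p₂, inner_sub_left]
    module
  rw [key]
  have hm' : ‖m‖ ≤ c := norm_mean_le hc p₁ p₂
  have t1 : ‖(σ1 - σ) • (D - (inner ℝ m D / c ^ 2) • g c p₂)‖
      ≤ 2 * σ ^ 2 * (Q / c) * (2 * ‖D‖) := by
    rw [norm_smul, Real.norm_eq_abs]
    exact mul_le_mul e4 (norm_sub_smul_le hc _ _ _ hm' (norm_g_lt hc _).le) (norm_nonneg _)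
      (by positivity)
  have t2 : ‖(inner ℝ (m - u) D) • g c p₂ + (inner ℝ u D) • (g c p₂ - u)‖
      ≤ 4 * σ * Q * ‖D‖ * c := by
    refine (norm_add_le _ _).trans ?_
    rw [norm_smul, norm_smul, Real.norm_eq_abs, Real.norm_eq_abs]
    have i1 : |inner ℝ (m - u) D| ≤ 2 * σ * Q * ‖D‖ :=
      (abs_real_inner_le_norm _ _).trans (by gcongr)
    have i2 : |inner ℝ u D| ≤ c * ‖D‖ :=
      (abs_real_inner_le_norm _ _).trans (by gcongr; exact (norm_g_lt hc _).le)
    calc _ ≤ (2 * σ * Q * ‖D‖) * c + (c * ‖D‖) * (2 * σ * Q) := by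
          gcongr; exact (norm_g_lt hc _).le
      _ = _ := by ring
  refine (norm_sub_le _ _).trans ?_
  rw [norm_smul (σ / c ^ 2), Real.norm_of_nonneg (by positivity)]
  calc _ ≤ 2 * σ ^ 2 * (Q / c) * (2 * ‖D‖) + σ / c ^ 2 * (4 * σ * Q * ‖D‖ * c) := by gcongr
    _ = 8 * σ ^ 2 / c * Q * ‖D‖ := by field_simp; ring

lemma one_sub_sq_pos (hc : 0 < c) {v : E n} (hv : ‖v‖ < c) : 0 < 1 - ‖v‖ ^ 2 / c ^ 2 := by
  rw [sub_pos, div_lt_one (pow_pos hc 2)]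
  exact pow_lt_pow_left₀ hv (norm_nonneg _) two_ne_zero

lemma norm_gInv (v : E n) : ‖gInv c v‖ = ‖v‖ / √(1 - ‖v‖ ^ 2 / c ^ 2) := by
  rw [gInv, norm_smul, Real.norm_of_nonneg (by positivity)]; ring

lemma gam_gInv (hc : 0 < c) {v : E n} (hv : ‖v‖ < c) :
    gam c (gInv c v) = 1 / √(1 - ‖v‖ ^ 2 / c ^ 2) := by
  have h := one_sub_sq_pos hc hv
  rw [gam, norm_gInv, div_pow, Real.sq_sqrt h.le, one_div, ← Real.sqrt_inv]
  congr 1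
  have := h.ne'
  have hc2 : c ^ 2 - ‖v‖ ^ 2 ≠ 0 := by
    intro h0
    apply this
    field_simp
    rw [h0, mul_zero]
  field_simp
  ring

lemma g_gInv (hc : 0 < c) {v : E n} (hv : ‖v‖ < c) : g c (gInv c v) = v := by
  have h := Real.sqrt_pos.2 (one_sub_sq_pos hc hv)
  rw [g_eq, gam_gInv hc hv, gInv, smul_smul, one_div_one_div, mul_one_div, div_self h.ne',
    one_smul]

lemma norm_g (p : E n) : ‖g c p‖ = ‖p‖ / gam c p := by
  rw [g_eq, norm_smul, Real.norm_of_nonneg (by have := gam_pos (c := c) p; positivity)]; ring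

lemma sqrt_one_sub_norm_g (hc : 0 < c) (p : E n) :
    √(1 - ‖g c p‖ ^ 2 / c ^ 2) = 1 / gam c p := by
  have h := gam_pos (c := c) p
  have h2 := gam_sq (c := c) p
  rw [Real.sqrt_eq_iff_eq_sq (one_sub_sq_pos hc (norm_g_lt hc p)).le (by positivity), norm_g]
  field_simp
  field_simp at h2
  linarith

lemma gInv_g (hc : 0 < c) (p : E n) : gInv c (g c p) = p := by
  rw [gInv, sqrt_one_sub_norm_g hc, one_div_one_div, gam_smul_g]

lemma g_neg (p : E n) : g c (-p) = -g c p := by simp [g]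

lemma gInv_neg (p : E n) : gInv c (-p) = -gInv c p := by simp [gInv]

lemma contDiff_g {k : WithTop ℕ∞} : ContDiff ℝ k (g c : E n → E n) := by
  unfold g
  refine ContDiff.smul (ContDiff.div contDiff_const (ContDiff.sqrt ?_ ?_) ?_) contDiff_id
  · exact contDiff_const.add (ContDiff.div_const (contDiff_id.norm_sq ℝ) _)
  · intro x; positivity
  · intro x; exact (gam_pos x).ne'

lemma continuousAt_gInv (hc : 0 < c) {v : E n} (hv : ‖v‖ < c) :
    ContinuousAt (gInv c : E n → E n) v := by
  have h1 : Continuous fun y : E n => √(1 - ‖y‖ ^ 2 / c ^ 2) := by fun_prop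
  have h2 : ContinuousAt (fun y : E n => 1 / √(1 - ‖y‖ ^ 2 / c ^ 2)) v :=
    continuousAt_const.div h1.continuousAt (Real.sqrt_pos.2 (one_sub_sq_pos hc hv)).ne'
  exact h2.smul continuousAt_id

/-- A momentum change that is small compared with `c γ(p)` barely changes the Lorentz factor. -/
lemma inv_gam_le {p q : E n} (hc : 0 < c) (h : ‖q - p‖ ≤ c / 16 * gam c p) :
    1 / gam c q ≤ 16 / 15 * (1 / gam c p) := by
  have hp := gam_pos (c := c) p
  have hq := gam_pos (c := c) q
  have h1 := (abs_le.1 (abs_gam_sub_gam_le hc q p)).1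
  have h2 : ‖q - p‖ / c ≤ gam c p / 16 := by
    rw [div_le_iff₀ hc]; linarith
  have h3 : 15 / 16 * gam c p ≤ gam c q := by linarith
  calc 1 / gam c q ≤ 1 / (15 / 16 * gam c p) := by gcongr
    _ = _ := by field_simp

end RelScat

namespace RelScat

variable {n : ℕ} {c : ℝ}

/-! ### Electromagnetic forces with power decay -/

/-- The properties of a force `H(x, w)` that the scattering argument uses: continuity, decay of
order `p` with constant `K₀`, a Lipschitz estimate along segments that stay away from the
origin, and the fact that its power is the derivative of `-V`. Velocities are at most `c`. -/
structure IsForce (c : ℝ) (V : E n → ℝ) (p K₀ K₁ K₂ : ℝ) (H : E n → E n → E n) : Prop where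
  cont : Continuous fun q : E n × E n => H q.1 q.2
  bound : ∀ x w, ‖w‖ ≤ c → ‖H x w‖ ≤ K₀ * (1 + ‖x‖) ^ (-p)
  lip : ∀ x x' w w' ρ, 0 < ρ → ‖w‖ ≤ c → ‖w'‖ ≤ c → (∀ q ∈ segment ℝ x x', ρ ≤ 1 + ‖q‖) →
    ‖H x w - H x' w'‖ ≤ K₁ * ρ ^ (-(p + 1)) * ‖x - x'‖ + K₂ * ρ ^ (-p) * ‖w - w'‖
  work : ∀ x w, inner ℝ w (H x w) = -fderiv ℝ V x w

/-- The force that governs the time-reversed motion. -/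
def revForce (H : E n → E n → E n) : E n → E n → E n := fun x w => H x (-w)

lemma IsForce.rev {V : E n → ℝ} {p K₀ K₁ K₂ : ℝ} {H : E n → E n → E n}
    (h : IsForce c V p K₀ K₁ K₂ H) : IsForce c V p K₀ K₁ K₂ (revForce H) where
  cont := h.cont.comp (continuous_fst.prodMk continuous_snd.neg)
  bound x w hw := h.bound x (-w) (by rwa [norm_neg])
  lip x x' w w' ρ hρ hw hw' hs := by
    have := h.lip x x' (-w) (-w') ρ hρ (by rwa [norm_neg]) (by rwa [norm_neg]) hs
    rwa [neg_sub_neg, norm_sub_rev w' w] at this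
  work x w := by
    have := h.work x (-w)
    rw [inner_neg_left, map_neg] at this
    simp only [revForce]
    linarith

lemma norm_le_sqrt_mul {w : E n} {b : ℝ} (hb : 0 ≤ b) (h : ∀ i, |w i| ≤ b) :
    ‖w‖ ≤ √(n : ℝ) * b := by
  rw [EuclideanSpace.norm_eq]
  calc √(∑ i, ‖w i‖ ^ 2) ≤ √(∑ _i : Fin n, b ^ 2) := by
        gcongr with i
        exact h i
    _ = √(n : ℝ) * b := by
        rw [Finset.sum_const, Finset.card_univ, Fintype.card_fin, nsmul_eq_mul,
          Real.sqrt_mul (Nat.cast_nonneg n), Real.sqrt_sq hb]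

lemma norm_toEuclideanLin_le {M : Matrix (Fin n) (Fin n) ℝ} {b : ℝ}
    (h : ∀ i k, |M i k| ≤ b) (w : E n) : ‖Matrix.toEuclideanLin M w‖ ≤ n * b * ‖w‖ := by
  rcases Nat.eq_zero_or_pos n with hn | hn
  · subst hn
    have : Matrix.toEuclideanLin M w = 0 := Subsingleton.elim _ _
    simp [this]
  have hb : 0 ≤ b := (abs_nonneg _).trans (h ⟨0, hn⟩ ⟨0, hn⟩)
  have key : ∀ i, |Matrix.toEuclideanLin M w i| ≤ √(n : ℝ) * b * ‖w‖ := by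
    intro i
    have e : Matrix.toEuclideanLin M w i = inner ℝ (WithLp.toLp 2 (M i) : E n) w := by
      simp [Matrix.toEuclideanLin, Matrix.mulVec, dotProduct, PiLp.inner_apply, mul_comm]
    rw [e]
    refine (abs_real_inner_le_norm _ _).trans ?_
    gcongr
    exact norm_le_sqrt_mul hb (fun k => h i k)
  refine (norm_le_sqrt_mul (by positivity) key).trans (le_of_eq ?_)
  have : √(n : ℝ) * √(n : ℝ) = n := Real.mul_self_sqrt (Nat.cast_nonneg n)
  linear_combination b * ‖w‖ * this

lemma fderiv_apply_single (f : E n → ℝ) (x : E n) (i : Fin n) :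
    fderiv ℝ f x (EuclideanSpace.single i 1) = gradient f x i := by
  have : fderiv ℝ f x (EuclideanSpace.single i 1)
      = inner ℝ (gradient f x) (EuclideanSpace.single i (1 : ℝ)) := by
    rw [gradient, InnerProductSpace.toDual_symm_apply]
  rw [this, EuclideanSpace.inner_single_right]; simp

lemma norm_fderiv_le {f : E n → ℝ} {x : E n} {b : ℝ} (hb : 0 ≤ b) (h : ∀ i, |pd i f x| ≤ b) :
    ‖fderiv ℝ f x‖ ≤ √(n : ℝ) * b := by
  have e : ‖fderiv ℝ f x‖ = ‖gradient f x‖ := by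
    rw [gradient, LinearIsometryEquiv.norm_map]
  rw [e]
  refine norm_le_sqrt_mul hb fun i => ?_
  rw [← fderiv_apply_single]; exact h i

/-- Mean value inequality for a function whose partial derivatives decay, along a segment that
stays away from the origin. -/
lemma abs_sub_le_of_pd_decay {f : E n → ℝ} (hf : Differentiable ℝ f) {b p : ℝ} (hb : 0 ≤ b)
    (hp : 0 ≤ p) (h : ∀ i x, |pd i f x| ≤ b * (1 + ‖x‖) ^ (-p)) {x x' : E n} {ρ : ℝ} (hρ : 0 < ρ)
    (hs : ∀ q ∈ segment ℝ x x', ρ ≤ 1 + ‖q‖) :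
    |f x - f x'| ≤ √(n : ℝ) * (b * ρ ^ (-p)) * ‖x - x'‖ := by
  have := Convex.norm_image_sub_le_of_norm_fderiv_le (𝕜 := ℝ) (f := f) (s := segment ℝ x x')
    (C := √(n : ℝ) * (b * ρ ^ (-p))) (fun q _ => hf q)
    (fun q hq => norm_fderiv_le (by positivity) fun i => (h i q).trans ?_)
    (convex_segment x x') (right_mem_segment ℝ x x') (left_mem_segment ℝ x x')
  · exact this
  · exact mul_le_mul_of_nonneg_left
      (Real.rpow_le_rpow_of_nonpos hρ (hs q hq) (by linarith)) hb

lemma inner_toEuclideanLin_self {M : Matrix (Fin n) (Fin n) ℝ} (hM : M.transpose = -M) (w : E n) :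
    inner ℝ w (Matrix.toEuclideanLin M w) = 0 := by
  have h1 : inner ℝ w (Matrix.toEuclideanLin M w) = ∑ i, ∑ k, M i k * w k * w i := by
    simp [Matrix.toEuclideanLin, Matrix.mulVec, dotProduct, PiLp.inner_apply, Finset.sum_mul]
  have h2 : ∑ i, ∑ k, M i k * w k * w i = -∑ i, ∑ k, M i k * w k * w i := by
    conv_lhs => rw [Finset.sum_comm]
    rw [← Finset.sum_neg_distrib]
    refine Finset.sum_congr rfl fun i _ => ?_
    rw [← Finset.sum_neg_distrib]
    refine Finset.sum_congr rfl fun k _ => ?_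
    have := congrFun (congrFun hM i) k
    simp only [Matrix.transpose_apply, Matrix.neg_apply] at this
    rw [this]; ring
  rw [h1]; linarith

lemma continuous_gradient {V : E n → ℝ} (hV : ContDiff ℝ 2 V) : Continuous (gradient V) := by
  unfold gradient
  exact (LinearIsometryEquiv.continuous _).comp (hV.continuous_fderiv (by norm_num))

lemma differentiable_pd {V : E n → ℝ} (hV : ContDiff ℝ 2 V) (i : Fin n) :
    Differentiable ℝ (pd i V) := by
  have : ContDiff ℝ 1 (fderiv ℝ V) := hV.fderiv_right (by norm_num)
  have h2 := this.differentiable (by norm_num)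
  unfold pd
  fun_prop

/-- The decay assumptions on the potential and the magnetic field give the force estimates. -/
lemma isForce_emForce (hn : 2 ≤ n) (hc : 0 < c) {V : E n → ℝ} {B : E n → Matrix (Fin n) (Fin n) ℝ}
    {γ b₀ b₁ b₂ : ℝ} (hγ : 0 < γ) (hb1 : 0 ≤ b₁) (hb2 : 0 ≤ b₂) (hV : ContDiff ℝ 2 V)
    (hB : ∀ i k, ContDiff ℝ 1 fun x => B x i k) (hBa : ∀ x, (B x).transpose = -B x)
    (hVd : DecayTwo V γ b₀ b₁ b₂) (hBd : ∀ i k, DecayOne (fun x => B x i k) (γ + 1) b₁ b₂) :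
    IsForce c V (γ + 1) (2 * n * b₁) (2 * (n * √(n : ℝ)) * b₂) (n * b₁ / c) (emForce c V B) := by
  have hn' : (2 : ℝ) ≤ n := by exact_mod_cast hn
  have hN : √(n : ℝ) * √(n : ℝ) = n := Real.mul_self_sqrt (by positivity)
  have hN1 : 1 ≤ √(n : ℝ) := by rw [Real.one_le_sqrt]; linarith
  have hNn : √(n : ℝ) ≤ n := by nlinarith
  refine ⟨?_, ?_, ?_, ?_⟩
  · unfold emForce
    have : (fun q : E n × E n => Matrix.toEuclideanLin (B q.1) q.2)
        = fun q => WithLp.toLp 2 (fun i => ∑ k, B q.1 i k * q.2 k) := by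
      funext q; ext i
      simp [Matrix.toEuclideanLin, Matrix.mulVec, dotProduct]
    have hBc : ∀ i k, Continuous fun x => B x i k := fun i k => (hB i k).continuous
    have hBw : Continuous fun q : E n × E n => Matrix.toEuclideanLin (B q.1) q.2 := by
      rw [this]
      refine (PiLp.continuous_toLp 2 _).comp (continuous_pi fun i => ?_)
      refine continuous_finsetSum _ fun k _ => ?_
      exact ((hBc i k).comp continuous_fst).mul (by fun_prop)
    exact ((continuous_gradient hV).comp continuous_fst).neg.add (hBw.const_smul (1 / c))
  · intro x w hw
    set R := (1 + ‖x‖) ^ (-(γ + 1)) with hR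
    have hR0 : 0 ≤ R := by positivity
    have h1 : ‖gradient V x‖ ≤ √(n : ℝ) * (b₁ * R) :=
      norm_le_sqrt_mul (by positivity) fun i => by
        rw [← fderiv_apply_single]; exact hVd.one i x
    have h2 : ‖(1 / c) • Matrix.toEuclideanLin (B x) w‖ ≤ n * (b₁ * R) := by
      rw [norm_smul, Real.norm_of_nonneg (by positivity), one_div, inv_mul_le_iff₀ hc]
      refine (norm_toEuclideanLin_le (fun i k => (hBd i k).zero x) w).trans ?_
      calc n * (b₁ * R) * ‖w‖ ≤ n * (b₁ * R) * c := by gcongr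
        _ = _ := by ring
    refine (norm_add_le _ _).trans ?_
    rw [norm_neg]
    have : √(n : ℝ) * (b₁ * R) ≤ n * (b₁ * R) := by gcongr
    linarith
  · intro x x' w w' ρ hρ hw hw' hs
    have hx : ρ ≤ 1 + ‖x‖ := hs x (left_mem_segment ℝ x x')
    set R2 := ρ ^ (-(γ + 1 + 1)) with hR2
    set R1 := ρ ^ (-(γ + 1)) with hR1
    have hR20 : 0 ≤ R2 := by positivity
    have hR10 : 0 ≤ R1 := by positivity
    have h1 : ‖gradient V x - gradient V x'‖ ≤ n * b₂ * R2 * ‖x - x'‖ := by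
      have : ∀ i, |(gradient V x - gradient V x') i| ≤ √(n : ℝ) * (b₂ * R2) * ‖x - x'‖ := by
        intro i
        rw [PiLp.sub_apply, ← fderiv_apply_single, ← fderiv_apply_single]
        refine abs_sub_le_of_pd_decay (differentiable_pd hV i) hb2 (by linarith)
          (fun j q => ?_) hρ hs
        have := hVd.two j i q
        rwa [show γ + 2 = γ + 1 + 1 by ring] at this
      refine (norm_le_sqrt_mul (by positivity) this).trans (le_of_eq ?_)
      linear_combination b₂ * R2 * ‖x - x'‖ * hN
    have h2 : ‖Matrix.toEuclideanLin (B x - B x') w'‖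
        ≤ n * (√(n : ℝ) * (b₂ * R2) * ‖x - x'‖) * ‖w'‖ :=
      norm_toEuclideanLin_le (fun i k =>
        abs_sub_le_of_pd_decay ((hB i k).differentiable (by norm_num)) hb2 (by linarith)
          (fun j q => (hBd i k).one j q) hρ hs) w'
    have h3 : ‖Matrix.toEuclideanLin (B x) (w - w')‖ ≤ n * (b₁ * R1) * ‖w - w'‖ :=
      norm_toEuclideanLin_le (fun i k => ((hBd i k).zero x).trans
        (mul_le_mul_of_nonneg_left (Real.rpow_le_rpow_of_nonpos hρ hx (by linarith)) hb1)) _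
    have key : emForce c V B x w - emForce c V B x' w' = -(gradient V x - gradient V x')
        + ((1 / c) • Matrix.toEuclideanLin (B x - B x') w'
          + (1 / c) • Matrix.toEuclideanLin (B x) (w - w')) := by
      simp only [emForce, map_sub, LinearMap.sub_apply, smul_sub]
      abel
    rw [key]
    refine (norm_add_le _ _).trans ?_
    rw [norm_neg]
    have h4 := norm_add_le ((1 / c) • Matrix.toEuclideanLin (B x - B x') w')
      ((1 / c) • Matrix.toEuclideanLin (B x) (w - w'))
    rw [norm_smul, norm_smul, Real.norm_of_nonneg (by positivity : 0 ≤ 1 / c)] at h4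
    have h5 : 1 / c * ‖Matrix.toEuclideanLin (B x - B x') w'‖
        ≤ n * √(n : ℝ) * b₂ * R2 * ‖x - x'‖ := by
      rw [one_div, inv_mul_le_iff₀ hc]
      refine h2.trans ?_
      calc _ ≤ n * (√(n : ℝ) * (b₂ * R2) * ‖x - x'‖) * c := by gcongr
        _ = _ := by ring
    have h6 : 1 / c * ‖Matrix.toEuclideanLin (B x) (w - w')‖ ≤ n * b₁ / c * R1 * ‖w - w'‖ := by
      rw [one_div, inv_mul_le_iff₀ hc]
      refine h3.trans (le_of_eq ?_)
      field_simp
    have h7 : n * b₂ * R2 * ‖x - x'‖ ≤ n * √(n : ℝ) * b₂ * R2 * ‖x - x'‖ := by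
      gcongr
      nlinarith
    linarith
  · intro x w
    rw [emForce, inner_add_right, inner_neg_right, inner_smul_right,
      inner_toEuclideanLin_self (hBa x), real_inner_comm, gradient,
      InnerProductSpace.toDual_symm_apply]
    ring

end RelScat

namespace RelScat

/-! ### Power majorants in time -/

/-- The time weight `a + k |t|`, a lower bound of `1 + |x(t)|` along the curves below. -/
def rho (a k t : ℝ) : ℝ := a + k * |t|

section Majorant

set_option linter.unusedSectionVars false

variable {a k p : ℝ}

lemma rho_neg (t : ℝ) : rho a k (-t) = rho a k t := by simp [rho]

lemma rho_pos (ha : 0 < a) (hk : 0 < k) (t : ℝ) : 0 < rho a k t := by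
  unfold rho; positivity

lemma le_rho (hk : 0 < k) (t : ℝ) : a ≤ rho a k t := by
  unfold rho; nlinarith [abs_nonneg t]

lemma rho_zero : rho a k 0 = a := by simp [rho]

lemma continuous_rho_rpow (ha : 0 < a) (hk : 0 < k) (p : ℝ) :
    Continuous fun t => rho a k t ^ p := by
  have h : Continuous (rho a k) := by unfold rho; fun_prop
  exact h.rpow_const fun t => Or.inl (rho_pos ha hk t).ne'

lemma integrableOn_comp_neg_Iic {F : Type*} [NormedAddCommGroup F] {f : ℝ → F} {σ : ℝ} :
    IntegrableOn (fun t => f (-t)) (Iic (-σ)) ↔ IntegrableOn f (Ioi σ) := by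
  have h := (Measure.measurePreserving_neg (volume : Measure ℝ)).integrableOn_comp_preimage
    (Homeomorph.neg ℝ).measurableEmbedding (f := f) (s := Ici σ)
  have e : (Neg.neg : ℝ → ℝ) ⁻¹' Ici σ = Iic (-σ) := by
    ext t; simp
  rw [e, integrableOn_Ici_iff_integrableOn_Ioi] at h
  exact h

lemma hasDerivAt_majorant (ha : 0 < a) (hk : 0 < k) (hp : 0 < p) {t : ℝ} (ht : 0 ≤ t) :
    HasDerivAt (fun t => -((a + k * t) ^ (-p) / (p * k))) ((a + k * t) ^ (-(p + 1))) t := by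
  have h0 : 0 < a + k * t := by positivity
  have h1 : HasDerivAt (fun t => a + k * t) k t := by
    simpa using ((hasDerivAt_id t).const_mul k).const_add a
  have h2 := ((h1.rpow_const (p := -p) (Or.inl h0.ne')).div_const (p * k)).neg
  refine h2.congr_deriv ?_
  rw [show -p - 1 = -(p + 1) by ring]
  field_simp

lemma tendsto_majorant (hk : 0 < k) (hp : 0 < p) :
    Tendsto (fun t => -((a + k * t) ^ (-p) / (p * k))) atTop (𝓝 0) := by
  have h1 : Tendsto (fun t => a + k * t) atTop atTop :=
    tendsto_atTop_add_const_left _ _ (tendsto_id.const_mul_atTop hk)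
  have := (((tendsto_rpow_neg_atTop hp).comp h1).div_const (p * k)).neg
  simpa using this

lemma integrableOn_rho_Ioi (ha : 0 < a) (hk : 0 < k) (hp : 0 < p) :
    IntegrableOn (fun t => rho a k t ^ (-(p + 1))) (Ioi 0) := by
  have h : IntegrableOn (fun t => (a + k * t) ^ (-(p + 1))) (Ioi 0) :=
    integrableOn_Ioi_deriv_of_nonneg' (fun t ht => hasDerivAt_majorant ha hk hp ht)
      (fun t ht => by have : 0 < t := ht; positivity) (tendsto_majorant hk hp)
  refine h.congr_fun (fun t ht => ?_) measurableSet_Ioi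
  simp only [rho, abs_of_pos (show 0 < t from ht)]

lemma integrable_rho (ha : 0 < a) (hk : 0 < k) (hp : 0 < p) :
    Integrable fun t => rho a k t ^ (-(p + 1)) := by
  have h1 := integrableOn_rho_Ioi ha hk hp
  have h2 : IntegrableOn (fun t => rho a k t ^ (-(p + 1))) (Iic 0) := by
    have := integrableOn_comp_neg_Iic.2 h1
    simpa [rho_neg] using this
  rw [← integrableOn_univ, ← Iic_union_Ioi (a := (0 : ℝ))]
  exact h2.union h1

lemma integral_Ioi_rho (ha : 0 < a) (hk : 0 < k) (hp : 0 < p) {σ : ℝ} (hσ : 0 ≤ σ) :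
    ∫ t in Ioi σ, rho a k t ^ (-(p + 1)) = rho a k σ ^ (-p) / (p * k) := by
  have e : ∫ t in Ioi σ, rho a k t ^ (-(p + 1)) = ∫ t in Ioi σ, (a + k * t) ^ (-(p + 1)) := by
    refine setIntegral_congr_fun measurableSet_Ioi fun t ht => ?_
    simp only [rho, abs_of_pos (hσ.trans_lt ht)]
  rw [e, integral_Ioi_of_hasDerivAt_of_nonneg'
    (fun t ht => hasDerivAt_majorant ha hk hp (hσ.trans ht))
    (fun t ht => by have : 0 < t := hσ.trans_lt ht; positivity) (tendsto_majorant hk hp)]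
  simp [rho, abs_of_nonneg hσ]

lemma integral_Iic_eq_Ioi_neg {F : Type*} [NormedAddCommGroup F] [NormedSpace ℝ F] (f : ℝ → F)
    (σ : ℝ) : ∫ t in Iic σ, f t = ∫ t in Ioi (-σ), f (-t) := by
  rw [integral_comp_neg_Ioi, neg_neg]

lemma integral_rho (ha : 0 < a) (hk : 0 < k) (hp : 0 < p) :
    ∫ t, rho a k t ^ (-(p + 1)) = 2 * (a ^ (-p) / (p * k)) := by
  have h := integrable_rho ha hk hp
  rw [← intervalIntegral.integral_Iic_add_Ioi (b := 0) h.integrableOn h.integrableOn,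
    integral_Iic_eq_Ioi_neg]
  simp only [rho_neg, neg_zero]
  rw [integral_Ioi_rho ha hk hp le_rfl, rho_zero]; ring

variable {F : Type*} [NormedAddCommGroup F] [NormedSpace ℝ F] {h : ℝ → F} {C C' p' : ℝ}

lemma norm_integral_Ioi_le_rho (ha : 0 < a) (hk : 0 < k) (hp : 0 < p) (hp' : 0 < p') {σ : ℝ}
    (hσ : 0 ≤ σ)
    (hb : ∀ t > σ, ‖h t‖ ≤ C * rho a k t ^ (-(p + 1)) + C' * rho a k t ^ (-(p' + 1))) :
    ‖∫ t in Ioi σ, h t‖ ≤ C * (rho a k σ ^ (-p) / (p * k))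
      + C' * (rho a k σ ^ (-p') / (p' * k)) := by
  rw [← integral_Ioi_rho ha hk hp hσ, ← integral_Ioi_rho ha hk hp' hσ,
    ← integral_const_mul, ← integral_const_mul, ← integral_add]
  · refine norm_integral_le_of_norm_le ?_ ((ae_restrict_iff' measurableSet_Ioi).2
      (Eventually.of_forall hb))
    exact ((integrable_rho ha hk hp).integrableOn.const_mul C).add
      ((integrable_rho ha hk hp').integrableOn.const_mul C')
  · exact (integrable_rho ha hk hp).integrableOn.const_mul C
  · exact (integrable_rho ha hk hp').integrableOn.const_mul C'

lemma norm_integral_Ioi_le_rho' (ha : 0 < a) (hk : 0 < k) (hp : 0 < p) {σ : ℝ}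
    (hσ : 0 ≤ σ) (hb : ∀ t > σ, ‖h t‖ ≤ C * rho a k t ^ (-(p + 1))) :
    ‖∫ t in Ioi σ, h t‖ ≤ C * (rho a k σ ^ (-p) / (p * k)) := by
  have := norm_integral_Ioi_le_rho (C' := 0) ha hk hp hp hσ (h := h) (C := C)
    (fun t ht => by simpa using hb t ht)
  simpa using this

lemma norm_integral_Iic_le_rho' (ha : 0 < a) (hk : 0 < k) (hp : 0 < p) {σ : ℝ}
    (hσ : σ ≤ 0) (hb : ∀ t < σ, ‖h t‖ ≤ C * rho a k t ^ (-(p + 1))) :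
    ‖∫ t in Iic σ, h t‖ ≤ C * (rho a k σ ^ (-p) / (p * k)) := by
  rw [integral_Iic_eq_Ioi_neg, ← rho_neg]
  refine norm_integral_Ioi_le_rho' ha hk hp (by linarith) fun t ht => ?_
  rw [← rho_neg]
  exact hb (-t) (by linarith)

lemma norm_setIntegral_le_rho (ha : 0 < a) (hk : 0 < k) (hp : 0 < p)
    (hb : ∀ t, ‖h t‖ ≤ C * rho a k t ^ (-(p + 1))) (s : Set ℝ) :
    ‖∫ t in s, h t‖ ≤ C * (2 * (a ^ (-p) / (p * k))) := by
  rw [← integral_rho ha hk hp, ← integral_const_mul]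
  have hi := (integrable_rho ha hk hp).const_mul C
  refine (norm_integral_le_of_norm_le hi.integrableOn (Eventually.of_forall hb)).trans ?_
  exact setIntegral_le_integral hi (Eventually.of_forall fun t => (norm_nonneg _).trans (hb t))

lemma norm_integral_le_rho (ha : 0 < a) (hk : 0 < k) (hp : 0 < p)
    (hb : ∀ t, ‖h t‖ ≤ C * rho a k t ^ (-(p + 1))) :
    ‖∫ t, h t‖ ≤ C * (2 * (a ^ (-p) / (p * k))) := by
  simpa using norm_setIntegral_le_rho ha hk hp hb univ

lemma integrable_of_le_rho (ha : 0 < a) (hk : 0 < k) (hp : 0 < p) (hc : Continuous h)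
    (hb : ∀ t, ‖h t‖ ≤ C * rho a k t ^ (-(p + 1))) : Integrable h :=
  ((integrable_rho ha hk hp).const_mul C).mono' hc.aestronglyMeasurable (Eventually.of_forall hb)

lemma integrableOn_Ioi_of_le_rho (ha : 0 < a) (hk : 0 < k) (hp : 0 < p) (hc : Continuous h)
    (hb : ∀ t > 0, ‖h t‖ ≤ C * rho a k t ^ (-(p + 1))) : IntegrableOn h (Ioi 0) :=
  ((integrable_rho ha hk hp).integrableOn.const_mul C).mono' hc.aestronglyMeasurable
    ((ae_restrict_iff' measurableSet_Ioi).2 (Eventually.of_forall hb))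

lemma integrableOn_Iic_of_le_rho (ha : 0 < a) (hk : 0 < k) (hp : 0 < p) (hc : Continuous h)
    (hb : ∀ t ≤ 0, ‖h t‖ ≤ C * rho a k t ^ (-(p + 1))) : IntegrableOn h (Iic 0) :=
  ((integrable_rho ha hk hp).integrableOn.const_mul C).mono' hc.aestronglyMeasurable
    ((ae_restrict_iff' measurableSet_Iic).2 (Eventually.of_forall hb))

end Majorant

/-! ### Integrals over half-lines as functions of the end point -/

section HalfLine

set_option linter.unusedSectionVars false

variable {F : Type*} [NormedAddCommGroup F] [NormedSpace ℝ F] [CompleteSpace F] {h : ℝ → F}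

lemma integrableOn_Ioi_of_zero (hc : Continuous h) (hi : IntegrableOn h (Ioi 0)) (t : ℝ) :
    IntegrableOn h (Ioi t) := by
  have h1 : IntegrableOn h (Icc t 0) := hc.continuousOn.integrableOn_Icc
  refine (h1.union hi).mono_set fun u hu => ?_
  rcases le_or_gt u 0 with h0 | h0
  · exact Or.inl ⟨(show t < u from hu).le, h0⟩
  · exact Or.inr h0

lemma hasDerivAt_integral_Ioi (hc : Continuous h) (hi : IntegrableOn h (Ioi 0)) (t : ℝ) :
    HasDerivAt (fun t => ∫ τ in Ioi t, h τ) (-h t) t := by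
  have e : (fun t => ∫ τ in Ioi t, h τ) = fun t => (∫ τ in Ioi 0, h τ) - ∫ τ in (0 : ℝ)..t, h τ := by
    funext t
    rw [← intervalIntegral.integral_interval_add_Ioi hi (integrableOn_Ioi_of_zero hc hi t)]
    abel
  rw [e]
  exact (intervalIntegral.integral_hasDerivAt_right (hc.intervalIntegrable _ _)
    (hc.stronglyMeasurableAtFilter _ _) hc.continuousAt).const_sub _

lemma tendsto_integral_Ioi (hi : IntegrableOn h (Ioi 0)) :
    Tendsto (fun t => ∫ τ in Ioi t, h τ) atTop (𝓝 0) := by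
  have h1 := intervalIntegral_tendsto_integral_Ioi (0 : ℝ) hi tendsto_id
  have h2 := (tendsto_const_nhds (x := ∫ τ in Ioi 0, h τ)).sub h1
  rw [sub_self] at h2
  refine h2.congr' ?_
  filter_upwards [eventually_ge_atTop 0] with t ht
  rw [← intervalIntegral.integral_interval_add_Ioi hi (hi.mono_set (Ioi_subset_Ioi ht))]
  simp

lemma integral_Iic_eq_sub (hi : Integrable h) (t : ℝ) :
    ∫ τ in Iic t, h τ = (∫ τ, h τ) - ∫ τ in Ioi t, h τ := by
  rw [← intervalIntegral.integral_Iic_add_Ioi (b := t) hi.integrableOn hi.integrableOn]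
  abel

lemma hasDerivAt_integral_Iic (hc : Continuous h) (hi : IntegrableOn h (Iic 0)) (t : ℝ) :
    HasDerivAt (fun t => ∫ τ in Iic t, h τ) (h t) t := by
  have hi' : IntegrableOn (fun t => h (-t)) (Ioi 0) := by
    rw [← integrableOn_comp_neg_Iic]; simpa using hi
  have := (hasDerivAt_integral_Ioi (hc.comp continuous_neg) hi' (-t)).scomp t (hasDerivAt_neg t)
  simp only [Function.comp_def, neg_neg, neg_smul, one_smul] at this
  refine this.congr_of_eventuallyEq (Eventually.of_forall fun u => ?_)
  exact integral_Iic_eq_Ioi_neg h u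

lemma tendsto_integral_Iic (hi : IntegrableOn h (Iic 0)) :
    Tendsto (fun t => ∫ τ in Iic t, h τ) atBot (𝓝 0) := by
  have hi' : IntegrableOn (fun t => h (-t)) (Ioi 0) := by
    rw [← integrableOn_comp_neg_Iic]; simpa using hi
  refine ((tendsto_integral_Ioi hi').comp tendsto_neg_atBot_atTop).congr fun u => ?_
  exact (integral_Iic_eq_Ioi_neg h u).symm

end HalfLine

end RelScat

namespace RelScat

variable {n : ℕ} {c : ℝ} {H : E n → E n → E n} {V : E n → ℝ} {p K₀ K₁ K₂ : ℝ}

/-! ### Solutions of the relativistic Newton equation -/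

lemma IsForce.continuous_along (h : IsForce c V p K₀ K₁ K₂ H) {f : ℝ → E n} (hf : Continuous f)
    (hf' : Continuous (deriv f)) : Continuous (along H f) :=
  h.cont.comp (hf.prodMk hf')

/-- A curve whose velocity is `g P`, with the momentum `P` driven by the force, is a solution. -/
lemma isSolution_of_momentum (hc : 0 < c) {z P : ℝ → E n} (hz : ∀ t, HasDerivAt z (g c (P t)) t)
    (hP : ∀ t, HasDerivAt P (along H z t) t) (hcont : Continuous (along H z)) :
    IsSolution c H z := by
  have hd : deriv z = fun t => g c (P t) := funext fun t => (hz t).deriv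
  have hP1 : ContDiff ℝ 1 P := by
    rw [contDiff_one_iff_deriv]
    refine ⟨fun t => (hP t).differentiableAt, ?_⟩
    rw [show deriv P = along H z from funext fun t => (hP t).deriv]
    exact hcont
  refine ⟨?_, ?_, ?_⟩
  · rw [show (2 : WithTop ℕ∞) = 1 + 1 by norm_num, contDiff_succ_iff_deriv]
    refine ⟨fun t => (hz t).differentiableAt, by simp, ?_⟩
    rw [hd]
    exact contDiff_g.comp hP1
  · intro t; rw [hd]; exact norm_g_lt hc _
  · intro t
    have : (fun s => gInv c (deriv z s)) = P := by
      funext s; rw [hd]; exact gInv_g hc _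
    rw [this]; exact hP t

lemma IsSolution.continuous {z : ℝ → E n} (hz : IsSolution c H z) : Continuous z :=
  hz.smooth.continuous

lemma IsSolution.continuous_deriv {z : ℝ → E n} (hz : IsSolution c H z) : Continuous (deriv z) :=
  hz.smooth.continuous_deriv (by norm_num)

lemma IsSolution.hasDerivAt {z : ℝ → E n} (hz : IsSolution c H z) (t : ℝ) :
    HasDerivAt z (deriv z t) t :=
  (hz.smooth.differentiable (by norm_num) t).hasDerivAt

lemma deriv_comp_neg' (z : ℝ → E n) (t : ℝ) : deriv (fun t => z (-t)) t = -deriv z (-t) :=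
  deriv_comp_neg z t

lemma revForce_revForce : revForce (revForce H) = H := by
  funext x w; simp [revForce]

lemma along_rev (z : ℝ → E n) (t : ℝ) :
    along (revForce H) (fun t => z (-t)) t = along H z (-t) := by
  simp only [along, revForce, deriv_comp_neg', neg_neg]

lemma IsSolution.rev {z : ℝ → E n} (hz : IsSolution c H z) :
    IsSolution c (revForce H) (fun t => z (-t)) := by
  refine ⟨hz.smooth.comp contDiff_neg, ?_, ?_⟩
  · intro t; rw [deriv_comp_neg', norm_neg]; exact hz.speed_lt _
  · intro t
    rw [along_rev]
    simp only [deriv_comp_neg', gInv_neg]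
    have := ((hz.newton (-t)).scomp t (hasDerivAt_neg t)).neg
    rw [neg_smul, one_smul, neg_neg] at this
    exact this

/-- The momentum of a solution with asymptotic velocity `w` at `+∞`. -/
lemma IsSolution.gInv_deriv_eq (hc : 0 < c) {z : ℝ → E n} (hz : IsSolution c H z) {w : E n}
    (hw : ‖w‖ < c) (hcont : Continuous (along H z)) (hint : IntegrableOn (along H z) (Ioi 0))
    (hlim : Tendsto (deriv z) atTop (𝓝 w)) (t : ℝ) :
    gInv c (deriv z t) = gInv c w - ∫ τ in Ioi t, along H z τ := by
  set f : ℝ → E n := fun t => gInv c (deriv z t) + ∫ τ in Ioi t, along H z τ with hf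
  have hd : ∀ t, HasDerivAt f 0 t := fun t => by
    have := (hz.newton t).add (hasDerivAt_integral_Ioi hcont hint t)
    rwa [add_neg_cancel] at this
  have hconst : ∀ u, f u = f t := fun u =>
    is_const_of_deriv_eq_zero (fun t => (hd t).differentiableAt) (fun t => (hd t).deriv) u t
  have hl : Tendsto f atTop (𝓝 (gInv c w + 0)) :=
    ((continuousAt_gInv hc hw).tendsto.comp hlim).add (tendsto_integral_Ioi hint)
  have hl2 : Tendsto f atTop (𝓝 (f t)) := by
    rw [show f = fun _ => f t from funext hconst]; exact tendsto_const_nhds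
  have := tendsto_nhds_unique hl hl2
  rw [add_zero] at this
  rw [this]; simp only [hf]; abel

lemma IsSolution.deriv_eq_velOut (hc : 0 < c) {z : ℝ → E n} (hz : IsSolution c H z) {w : E n}
    (hw : ‖w‖ < c) (hcont : Continuous (along H z)) (hint : IntegrableOn (along H z) (Ioi 0))
    (hlim : Tendsto (deriv z) atTop (𝓝 w)) (t : ℝ) :
    deriv z t = velOut c w H z t := by
  rw [velOut, ← hz.gInv_deriv_eq hc hw hcont hint hlim, g_gInv hc (hz.speed_lt t)]

/-- Time reversal exchanges incoming and outgoing velocities. -/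
lemma velIn_eq_neg_velOut (v : E n) (f : ℝ → E n) (t : ℝ) :
    velIn c v H f t = -velOut c (-v) (revForce H) (fun t => f (-t)) (-t) := by
  rw [velIn, velOut, ← g_neg, gInv_neg]
  congr 1
  rw [integral_Iic_eq_Ioi_neg]
  simp only [along_rev]
  abel

/-! ### Free solutions -/

/-- The curve `z` solves the equation with force `H`, starts at the origin, has velocity `v` at
`+∞` and velocity within `R` of `v` at all times. -/
structure IsFreeOut (c : ℝ) (H : E n → E n → E n) (v : E n) (R : ℝ) (z : ℝ → E n) : Prop where
  solution : IsSolution c H z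
  asymptotic : Tendsto (deriv z) atTop (𝓝 v)
  origin : z 0 = 0
  close : ∀ t, ‖deriv z t - v‖ ≤ R

/-- Position bound from a velocity bound, for curves through a given point at time `0`. -/
lemma norm_sub_le_of_deriv {z : ℝ → E n} (hz : Differentiable ℝ z) {w : E n} {R : ℝ}
    (h : ∀ t, ‖deriv z t - w‖ ≤ R) (t : ℝ) : ‖z t - z 0 - t • w‖ ≤ R * |t| := by
  have hd : ∀ t, HasDerivAt (fun t => z t - t • w) (deriv z t - w) t := fun t => by
    have h2 := (hz t).hasDerivAt.sub ((hasDerivAt_id t).smul_const w)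
    rwa [one_smul] at h2
  have := Convex.norm_image_sub_le_of_norm_hasDerivWithin_le (s := univ) (C := R)
    (fun t _ => (hd t).hasDerivWithinAt) (fun t _ => h t) convex_univ (mem_univ 0) (mem_univ t)
  simp only [zero_smul, sub_zero, Real.norm_eq_abs] at this
  rwa [show z t - z 0 - t • w = z t - t • w - z 0 by abel]

lemma rho_le_one_add_norm {v q : E n} {t R : ℝ} (hR : R ≤ ‖v‖ / 2) (h : ‖q - t • v‖ ≤ R * |t|) :
    rho 1 (‖v‖ / 2) t ≤ 1 + ‖q‖ := by
  have h1 : ‖t • v‖ ≤ ‖q‖ + ‖q - t • v‖ := by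
    have := norm_sub_le q (q - t • v)
    rwa [sub_sub_cancel] at this
  rw [norm_smul, Real.norm_eq_abs] at h1
  have h2 : R * |t| ≤ ‖v‖ / 2 * |t| := by gcongr
  unfold rho
  linarith

section Existence

variable {α R : ℝ} {v : E n}

/-- Velocity deviations for the fixed point argument. -/
def devSet (c R : ℝ) (v : E n) : Set (BoundedContinuousFunction ℝ (E n)) :=
  {h | ∀ t, ‖h t‖ ≤ R ∧ ‖v + h t‖ ≤ c}

lemma isClosed_devSet : IsClosed (devSet c R v) := by
  have : devSet c R v = ⋂ t : ℝ, {h | ‖h t‖ ≤ R ∧ ‖v + h t‖ ≤ c} := by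
    ext h; simp [devSet]
  rw [this]
  refine isClosed_iInter fun t => ?_
  have hc : Continuous fun h : BoundedContinuousFunction ℝ (E n) => h t :=
    (BoundedContinuousFunction.lipschitz_eval_const t).continuous
  exact (isClosed_le hc.norm continuous_const).inter
    (isClosed_le (continuous_const.add hc).norm continuous_const)

/-- The curve through the origin with velocity `v + h`. -/
noncomputable def devCurve (v : E n) (h : ℝ → E n) (t : ℝ) : E n := ∫ τ in (0 : ℝ)..t, (v + h τ)

lemma hasDerivAt_devCurve {h : ℝ → E n} (hh : Continuous h) (t : ℝ) :
    HasDerivAt (devCurve v h) (v + h t) t := by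
  have hc : Continuous fun τ => v + h τ := continuous_const.add hh
  exact intervalIntegral.integral_hasDerivAt_right (hc.intervalIntegrable _ _)
    (hc.stronglyMeasurableAtFilter _ _) hc.continuousAt

lemma deriv_devCurve {h : ℝ → E n} (hh : Continuous h) : deriv (devCurve v h) = fun t => v + h t :=
  funext fun t => (hasDerivAt_devCurve hh t).deriv

lemma devCurve_eq {z : ℝ → E n} (hz : Differentiable ℝ z) (hz' : Continuous (deriv z))
    (h0 : z 0 = 0) : devCurve v (fun t => deriv z t - v) = z := by
  funext t
  have : ∀ τ, v + (deriv z τ - v) = deriv z τ := fun τ => by abel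
  simp only [devCurve, this]
  rw [intervalIntegral.integral_deriv_eq_sub (fun τ _ => hz τ) (hz'.intervalIntegrable _ _), h0,
    sub_zero]

lemma norm_devCurve_sub_le {h : ℝ → E n} (hh : Continuous h) (hR : ∀ t, ‖h t‖ ≤ R) (t : ℝ) :
    ‖devCurve v h t - t • v‖ ≤ R * |t| := by
  have := norm_sub_le_of_deriv (z := devCurve v h)
    (fun t => (hasDerivAt_devCurve hh t).differentiableAt) (w := v) (R := R)
    (fun t => by rw [deriv_devCurve hh]; simpa using hR t) t
  simpa [devCurve] using this

lemma norm_along_le_rho (hH : IsForce c V (α + 1) K₀ K₁ K₂ H) (hα : 0 < α) (hv : 0 < ‖v‖)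
    (hK₀ : 0 ≤ K₀) (hR : R ≤ ‖v‖ / 2) {z : ℝ → E n} (h : ∀ t, ‖z t - t • v‖ ≤ R * |t|)
    (hzc : ∀ t, ‖deriv z t‖ ≤ c) (t : ℝ) :
    ‖along H z t‖ ≤ K₀ * rho 1 (‖v‖ / 2) t ^ (-(α + 1)) := by
  refine (hH.bound _ _ (hzc t)).trans (mul_le_mul_of_nonneg_left ?_ hK₀)
  exact Real.rpow_le_rpow_of_nonpos (rho_pos one_pos (by positivity) t)
    (rho_le_one_add_norm hR (h t)) (by linarith)

lemma norm_along_sub_le_rho (hH : IsForce c V (α + 1) K₀ K₁ K₂ H) (hv : 0 < ‖v‖)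
    (hK₁ : 0 ≤ K₁) (hK₂ : 0 ≤ K₂) (hR : R ≤ ‖v‖ / 2) {z z' : ℝ → E n} {δ : ℝ}
    (h : ∀ t, ‖z t - t • v‖ ≤ R * |t|) (h' : ∀ t, ‖z' t - t • v‖ ≤ R * |t|)
    (hzc : ∀ t, ‖deriv z t‖ ≤ c) (hzc' : ∀ t, ‖deriv z' t‖ ≤ c)
    (hd : ∀ t, ‖deriv z t - deriv z' t‖ ≤ δ) (hz : ∀ t, ‖z t - z' t‖ ≤ δ * |t|) (t : ℝ) :
    ‖along H z t - along H z' t‖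
      ≤ (K₁ / (‖v‖ / 2) + K₂) * δ * rho 1 (‖v‖ / 2) t ^ (-(α + 1)) := by
  have hk : 0 < ‖v‖ / 2 := by positivity
  have hρ := rho_pos one_pos hk t
  have hδ : 0 ≤ δ := (norm_nonneg _).trans (hd 0)
  have hconv : Convex ℝ {q : E n | ‖q - t • v‖ ≤ R * |t|} := by
    have : {q : E n | ‖q - t • v‖ ≤ R * |t|} = Metric.closedBall (t • v) (R * |t|) := by
      ext q; simp [dist_eq_norm]
    rw [this]; exact convex_closedBall _ _
  have := hH.lip (z t) (z' t) (deriv z t) (deriv z' t) (rho 1 (‖v‖ / 2) t) hρ (hzc t) (hzc' t)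
    (fun q hq => rho_le_one_add_norm hR (hconv.segment_subset (h t) (h' t) hq))
  refine this.trans ?_
  have e1 : rho 1 (‖v‖ / 2) t ^ (-(α + 1 + 1)) * rho 1 (‖v‖ / 2) t
      = rho 1 (‖v‖ / 2) t ^ (-(α + 1)) := by
    rw [← Real.rpow_add_one hρ.ne']; congr 1; ring
  have e2 : |t| ≤ rho 1 (‖v‖ / 2) t / (‖v‖ / 2) := by
    rw [le_div_iff₀ hk]; unfold rho; linarith
  set ρ := rho 1 (‖v‖ / 2) t
  have hp : 0 ≤ ρ ^ (-(α + 1 + 1)) := by positivity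
  calc K₁ * ρ ^ (-(α + 1 + 1)) * ‖z t - z' t‖ + K₂ * ρ ^ (-(α + 1)) * ‖deriv z t - deriv z' t‖
      ≤ K₁ * ρ ^ (-(α + 1 + 1)) * (δ * (ρ / (‖v‖ / 2))) + K₂ * ρ ^ (-(α + 1)) * δ := by
        gcongr
        · exact (hz t).trans (by gcongr)
        · exact hd t
    _ = K₁ / (‖v‖ / 2) * δ * (ρ ^ (-(α + 1 + 1)) * ρ) + K₂ * ρ ^ (-(α + 1)) * δ := by ring
    _ = _ := by rw [e1]; ring

/-- The momenta of two curves near the free motion with asymptotic velocity `v` produce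
velocities that differ by at most half of `δ`: this is the contraction estimate. -/
lemma norm_velOut_sub_le (hc : 0 < c) (hH : IsForce c V (α + 1) K₀ K₁ K₂ H) (hα : 0 < α)
    (hv : 0 < ‖v‖) (hvc : ‖v‖ < c) (hK₀ : 0 ≤ K₀) (hK₁ : 0 ≤ K₁) (hK₂ : 0 ≤ K₂)
    (hR : R ≤ ‖v‖ / 16)
    (hA : 2 * √(1 - ‖v‖ ^ 2 / c ^ 2) * (K₀ * (2 * (1 / (α * (‖v‖ / 2))))) ≤ R)
    (hC : 32 / 15 * √(1 - ‖v‖ ^ 2 / c ^ 2) *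
      ((K₁ / (‖v‖ / 2) + K₂) * (2 * (1 / (α * (‖v‖ / 2))))) ≤ 1 / 2)
    {z z' : ℝ → E n} {δ : ℝ} (hcz : Continuous (along H z)) (hcz' : Continuous (along H z'))
    (h : ∀ t, ‖z t - t • v‖ ≤ R * |t|) (h' : ∀ t, ‖z' t - t • v‖ ≤ R * |t|)
    (hzc : ∀ t, ‖deriv z t‖ ≤ c) (hzc' : ∀ t, ‖deriv z' t‖ ≤ c)
    (hd : ∀ t, ‖deriv z t - deriv z' t‖ ≤ δ) (hz : ∀ t, ‖z t - z' t‖ ≤ δ * |t|) (t : ℝ) :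
    ‖velOut c v H z t - velOut c v H z' t‖ ≤ 1 / 2 * δ := by
  have hk : 0 < ‖v‖ / 2 := by positivity
  have hδ : 0 ≤ δ := (norm_nonneg _).trans (hd 0)
  have hs : 0 < √(1 - ‖v‖ ^ 2 / c ^ 2) := Real.sqrt_pos.2 (one_sub_sq_pos hc hvc)
  have hR2 : R ≤ ‖v‖ / 2 := by linarith
  set s := √(1 - ‖v‖ ^ 2 / c ^ 2) with hsdef
  have b1 := norm_setIntegral_le_rho one_pos hk hα
    (norm_along_le_rho hH hα hv hK₀ hR2 h hzc) (Ioi t)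
  rw [Real.one_rpow] at b1
  have b2 := norm_setIntegral_le_rho one_pos hk hα
    (norm_along_sub_le_rho hH hv hK₁ hK₂ hR2 h h' hzc hzc' hd hz) (Ioi t)
  rw [Real.one_rpow, integral_sub
    (integrable_of_le_rho one_pos hk hα hcz
      (norm_along_le_rho hH hα hv hK₀ hR2 h hzc)).integrableOn
    (integrable_of_le_rho one_pos hk hα hcz'
      (norm_along_le_rho hH hα hv hK₀ hR2 h' hzc')).integrableOn] at b2
  refine (norm_g_sub_g_le hc _ _).trans ?_
  set P := ∫ τ in Ioi t, along H z τ
  set P' := ∫ τ in Ioi t, along H z' τ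
  have hg : gam c (gInv c v) = 1 / s := gam_gInv hc hvc
  have b3 : 1 / gam c (gInv c v - P) ≤ 16 / 15 * s := by
    have := inv_gam_le (p := gInv c v) (q := gInv c v - P) hc ?_
    · rwa [hg, one_div_one_div] at this
    · rw [hg, show gInv c v - P - gInv c v = -P by abel, norm_neg, mul_one_div, le_div_iff₀ hs]
      nlinarith
  have b4 : ‖gInv c v - P - (gInv c v - P')‖ = ‖P - P'‖ := by
    rw [sub_sub_sub_cancel_left, norm_sub_rev]
  rw [b4]
  calc 2 / gam c (gInv c v - P) * ‖P - P'‖ = 2 * (1 / gam c (gInv c v - P)) * ‖P - P'‖ := by ring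
    _ ≤ 2 * (16 / 15 * s) * ((K₁ / (‖v‖ / 2) + K₂) * δ * (2 * (1 / (α * (‖v‖ / 2))))) := by
        gcongr
    _ = 32 / 15 * s * ((K₁ / (‖v‖ / 2) + K₂) * (2 * (1 / (α * (‖v‖ / 2))))) * δ := by ring
    _ ≤ 1 / 2 * δ := by gcongr

lemma norm_velOut_sub_self_le (hc : 0 < c) (hvc : ‖v‖ < c) {B : ℝ} {z : ℝ → E n} {t : ℝ}
    (hB : ‖∫ τ in Ioi t, along H z τ‖ ≤ B) :
    ‖velOut c v H z t - v‖ ≤ 2 * √(1 - ‖v‖ ^ 2 / c ^ 2) * B := by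
  have h1 := norm_g_sub_g_le hc (gInv c v) (gInv c v - ∫ τ in Ioi t, along H z τ)
  rw [g_gInv hc hvc, gam_gInv hc hvc, sub_sub_cancel, div_div_eq_mul_div, div_one] at h1
  rw [norm_sub_rev]
  exact h1.trans (by gcongr)

/-- Existence and uniqueness of the free solution, by contraction of the map that sends a
velocity deviation to the one produced by the momentum equation. -/
theorem existsUnique_isFreeOut (hc : 0 < c) (hH : IsForce c V (α + 1) K₀ K₁ K₂ H) (hα : 0 < α)
    (hv : 0 < ‖v‖) (hvc : ‖v‖ < c) (hK₀ : 0 ≤ K₀) (hK₁ : 0 ≤ K₁) (hK₂ : 0 ≤ K₂)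
    (hR : R ≤ ‖v‖ / 16)
    (hA : 2 * √(1 - ‖v‖ ^ 2 / c ^ 2) * (K₀ * (2 * (1 / (α * (‖v‖ / 2))))) ≤ R)
    (hC : 32 / 15 * √(1 - ‖v‖ ^ 2 / c ^ 2) *
      ((K₁ / (‖v‖ / 2) + K₂) * (2 * (1 / (α * (‖v‖ / 2))))) ≤ 1 / 2) :
    ∃! z, IsFreeOut c H v R z := by
  have hk : 0 < ‖v‖ / 2 := by positivity
  have hR2 : R ≤ ‖v‖ / 2 := by linarith
  have hR0 : 0 ≤ R := le_trans (by positivity) hA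
  -- facts about the curve of a deviation
  have hcurve : ∀ h ∈ devSet c R v, Continuous (along H (devCurve v h)) ∧
      (∀ t, ‖devCurve v h t - t • v‖ ≤ R * |t|) ∧ ∀ t, ‖deriv (devCurve v h) t‖ ≤ c := by
    intro h hh
    have hcont : Continuous (deriv (devCurve v h)) := by
      rw [deriv_devCurve h.continuous]; exact continuous_const.add h.continuous
    refine ⟨hH.continuous_along (continuous_iff_continuousAt.2 fun t =>
      (hasDerivAt_devCurve h.continuous t).continuousAt) hcont,
      norm_devCurve_sub_le h.continuous fun t => (hh t).1, fun t => ?_⟩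
    rw [deriv_devCurve h.continuous]; exact (hh t).2
  have hint : ∀ h ∈ devSet c R v, IntegrableOn (along H (devCurve v h)) (Ioi 0) := fun h hh =>
    (integrable_of_le_rho one_pos hk hα (hcurve h hh).1 (norm_along_le_rho hH hα hv hK₀ hR2
      (hcurve h hh).2.1 (hcurve h hh).2.2)).integrableOn
  have hvel : ∀ h ∈ devSet c R v, ∀ t, ‖velOut c v H (devCurve v h) t - v‖ ≤ R := by
    intro h hh t
    have b := norm_setIntegral_le_rho one_pos hk hα (norm_along_le_rho hH hα hv hK₀ hR2
      (hcurve h hh).2.1 (hcurve h hh).2.2) (Ioi t)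
    rw [Real.one_rpow] at b
    exact (norm_velOut_sub_self_le hc hvc b).trans hA
  have hvc' : ∀ h ∈ devSet c R v, Continuous (velOut c v H (devCurve v h)) := fun h hh =>
    contDiff_g (k := 0) |>.continuous.comp (continuous_const.sub (continuous_iff_continuousAt.2
      fun t => (hasDerivAt_integral_Ioi (hcurve h hh).1 (hint h hh) t).continuousAt))
  let T : devSet c R v → devSet c R v := fun h =>
    ⟨BoundedContinuousFunction.ofNormedAddCommGroup
      (fun t => velOut c v H (devCurve v h.1) t - v) ((hvc' h.1 h.2).sub continuous_const) R
      (hvel h.1 h.2), fun t => ⟨hvel h.1 h.2 t, by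
        change ‖v + (velOut c v H (devCurve v h.1) t - v)‖ ≤ c
        rw [add_sub_cancel]; exact (norm_g_lt hc _).le⟩⟩
  have hT : ContractingWith (1 / 2) T := by
    refine ⟨by norm_num, LipschitzWith.of_dist_le_mul fun h h' => ?_⟩
    rw [Subtype.dist_eq, BoundedContinuousFunction.dist_le (by positivity)]
    intro t
    change dist (velOut c v H (devCurve v h.1) t - v) (velOut c v H (devCurve v h'.1) t - v) ≤ _
    rw [dist_sub_right, dist_eq_norm]
    have hdist : ∀ t, ‖h.1 t - h'.1 t‖ ≤ dist h h' := fun t => by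
      rw [← dist_eq_norm]; exact BoundedContinuousFunction.dist_coe_le_dist t
    have hdd : ∀ t, ‖deriv (devCurve v h.1) t - deriv (devCurve v h'.1) t‖ ≤ dist h h' := by
      intro t
      rw [deriv_devCurve h.1.continuous, deriv_devCurve h'.1.continuous]
      simpa using hdist t
    have := norm_velOut_sub_le hc hH hα hv hvc hK₀ hK₁ hK₂ hR hA hC (hcurve h.1 h.2).1
      (hcurve h'.1 h'.2).1 (hcurve h.1 h.2).2.1 (hcurve h'.1 h'.2).2.1 (hcurve h.1 h.2).2.2
      (hcurve h'.1 h'.2).2.2 hdd (fun t => ?_) t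
    · simpa using this
    · have h0 := norm_sub_le_of_deriv (z := fun t => devCurve v h.1 t - devCurve v h'.1 t)
        (fun t => ((hasDerivAt_devCurve h.1.continuous t).sub
          (hasDerivAt_devCurve h'.1.continuous t)).differentiableAt) (w := 0) (R := dist h h')
        (fun t => ?_) t
      · simpa [devCurve] using h0
      · have hd : HasDerivAt (fun t => devCurve v h.1 t - devCurve v h'.1 t)
            ((v + h.1 t) - (v + h'.1 t)) t :=
          (hasDerivAt_devCurve h.1.continuous t).sub (hasDerivAt_devCurve h'.1.continuous t)
        rw [hd.deriv]
        simpa using hdist t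
  have : Nonempty (devSet c R v) := ⟨⟨0, fun t => by simpa using ⟨hR0, hvc.le⟩⟩⟩
  have : CompleteSpace (devSet c R v) := isClosed_devSet.completeSpace_coe
  -- a fixed point yields a solution
  obtain ⟨h, hfix⟩ : ∃ h, T h = h := ⟨_, hT.fixedPoint_isFixedPt⟩
  have hval : ∀ t, v + h.1 t = velOut c v H (devCurve v h.1) t := fun t => by
    have : (T h).1 t = h.1 t := by rw [hfix]
    rw [← this]
    exact add_sub_cancel v _
  have hder : ∀ t, HasDerivAt (devCurve v h.1) (velOut c v H (devCurve v h.1) t) t := fun t => by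
    rw [← hval]; exact hasDerivAt_devCurve h.1.continuous t
  refine ⟨devCurve v h.1, ⟨?_, ?_, by simp [devCurve], ?_⟩, ?_⟩
  · refine isSolution_of_momentum hc hder (fun t => ?_) (hcurve h.1 h.2).1
    simpa using (hasDerivAt_integral_Ioi (hcurve h.1 h.2).1 (hint h.1 h.2) t).const_sub
      (gInv c v)
  · rw [show deriv (devCurve v h.1) = velOut c v H (devCurve v h.1) from
      funext fun t => (hder t).deriv]
    have h0 := (tendsto_integral_Ioi (hint h.1 h.2)).const_sub (gInv c v)
    have h1 := (contDiff_g (c := c) (n := n) (k := 0)).continuous.continuousAt.tendsto.comp h0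
    rw [sub_zero, g_gInv hc hvc] at h1
    exact h1
  · intro t
    rw [deriv_devCurve h.1.continuous]; simpa using (h.2 t).1
  -- every solution yields a fixed point
  · intro z hz
    have hzc := hz.solution.continuous_deriv
    let hz' : devSet c R v := ⟨BoundedContinuousFunction.ofNormedAddCommGroup
      (fun t => deriv z t - v) (hzc.sub continuous_const) R hz.close, fun t => ⟨hz.close t, by
        change ‖v + (deriv z t - v)‖ ≤ c
        rw [add_sub_cancel]; exact (hz.solution.speed_lt t).le⟩⟩
    have hdev : devCurve v hz'.1 = z :=
      devCurve_eq (fun t => (hz.solution.hasDerivAt t).differentiableAt) hzc hz.origin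
    have hfz : T hz' = hz' := by
      apply Subtype.ext
      ext1 t
      change velOut c v H (devCurve v hz'.1) t - v = deriv z t - v
      rw [hz.solution.deriv_eq_velOut hc hvc (hdev ▸ (hcurve hz'.1 hz'.2).1)
        (hdev ▸ hint hz'.1 hz'.2) hz.asymptotic, hdev]
    have : hz' = h := hT.fixedPoint_unique' hfz hfix
    rw [← hdev, this]

end Existence

end RelScat

namespace RelScat

variable {n : ℕ}

/-! ### The free solutions of the long range problem -/

lemma rpow_three_halves {y : ℝ} (hy : 0 ≤ y) : y ^ (3 / 2 : ℝ) = y * √y := by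
  rw [show (3 / 2 : ℝ) = 1 + 1 / 2 by norm_num, Real.rpow_add' hy (by norm_num), Real.rpow_one,
    Real.sqrt_eq_rpow]

lemma two_rpow_nine_halves : (2 : ℝ) ^ (9 / 2 : ℝ) = 16 * √2 := by
  rw [show (9 / 2 : ℝ) = 4 + 1 / 2 by norm_num, Real.rpow_add two_pos, ← Real.sqrt_eq_rpow]
  norm_num

/-- The threshold speed `μ(σ)` is where `|v|² / √(1 - |v|²/c²)` reaches `σ`. -/
lemma mul_sqrt_le_of_mu_le {c σ : ℝ} (hc : 0 < c) (hσ : 0 ≤ σ) {v : E n} (hvc : ‖v‖ < c)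
    (h : mu c σ ≤ ‖v‖) : σ * √(1 - ‖v‖ ^ 2 / c ^ 2) ≤ ‖v‖ ^ 2 := by
  have hs := one_sub_sq_pos hc hvc
  set D := √(σ ^ 2 / c ^ 4 + 4) with hD
  have hD2 : D ^ 2 = σ ^ 2 / c ^ 4 + 4 := Real.sq_sqrt (by positivity)
  have hDp : 0 < D := Real.sqrt_pos.2 (by positivity)
  have h1 : 2 * σ / (σ / c ^ 2 + D) ≤ ‖v‖ ^ 2 := by
    have := (Real.sqrt_le_left (norm_nonneg v)).1 h
    exact this
  set u := ‖v‖ ^ 2 with hu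
  have hu0 : 0 ≤ u := by positivity
  rw [div_le_iff₀ (by positivity)] at h1
  have h2 : σ * (2 - u / c ^ 2) ≤ u * D := by
    have : u * (σ / c ^ 2 + D) = σ * (u / c ^ 2) + u * D := by ring
    linarith
  have h3 : 0 ≤ σ * (2 - u / c ^ 2) := mul_nonneg hσ (by linarith)
  have h4 : (σ * (2 - u / c ^ 2)) ^ 2 ≤ (u * D) ^ 2 := pow_le_pow_left₀ h3 h2 2
  rw [mul_pow u D, hD2] at h4
  refine le_of_sq_le_sq ?_ hu0
  rw [mul_pow, Real.sq_sqrt hs.le]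
  have e1 : u ^ 2 * (σ ^ 2 / c ^ 4 + 4) = σ ^ 2 * (u / c ^ 2) ^ 2 + 4 * u ^ 2 := by
    field_simp
  nlinarith

namespace Setting

variable (S : Setting n)

lemma isForce_Fl (hn : 2 ≤ n) : IsForce S.c S.Vl (S.α + 1) (2 * n * S.βl1)
    (2 * (n * √(n : ℝ)) * S.βl2) (n * S.βl1 / S.c) S.Fl :=
  isForce_emForce hn S.c_pos S.α_pos S.βl1_pos.le S.βl2_pos.le S.Vl_smooth S.Bl_smooth
    S.Bl_antisymm S.Vl_decay S.Bl_decay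

lemma isForce_Fs (hn : 2 ≤ n) : IsForce S.c S.Vs (S.α + 1 + 1) (2 * n * S.βs2)
    (2 * (n * √(n : ℝ)) * S.βs3) (n * S.βs2 / S.c) S.Fs :=
  isForce_emForce hn S.c_pos (by linarith [S.α_pos]) S.βs2_pos.le S.βs3_pos.le S.Vs_smooth
    S.Bs_smooth S.Bs_antisymm S.Vs_decay
    (by have := S.Bs_decay; rwa [show S.α + 2 = S.α + 1 + 1 by ring] at this)

/-- The bound on the velocity deviation of the free solutions. -/
noncomputable def devBound (v : E n) : ℝ :=
  (2 : ℝ) ^ (9 / 2 : ℝ) * (n : ℝ) ^ (3 / 2 : ℝ) * S.βl1 * S.s v / (S.α * ‖v‖)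

variable {S} {v : E n}

lemma s_pos (hvc : ‖v‖ < S.c) : 0 < S.s v := Real.sqrt_pos.2 (one_sub_sq_pos S.c_pos hvc)

lemma muL_pos (hn : 2 ≤ n) : 0 < S.muL := by
  have := S.c_pos
  have := S.α_pos
  have := lt_max_of_lt_left (c := S.βl2) S.βl1_pos
  have hn' : (0 : ℝ) < n := by exact_mod_cast (by omega : 0 < n)
  unfold muL mu
  positivity

/-- Above the threshold speed, the force is small compared with the kinetic energy. -/
lemma threshold (hn : 2 ≤ n) (hvμ : S.muL ≤ ‖v‖) (hvc : ‖v‖ < S.c) :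
    (n : ℝ) ^ 2 * max S.βl1 S.βl2 * S.s v / (S.α * ‖v‖ ^ 2) ≤ 1 / 256 := by
  have hα := S.α_pos
  have hv : 0 < ‖v‖ := (muL_pos hn).trans_le hvμ
  have hm := lt_max_of_lt_left (c := S.βl2) S.βl1_pos
  have := mul_sqrt_le_of_mu_le S.c_pos (by positivity) hvc hvμ
  rw [div_le_iff₀ (by positivity)]
  change _ * S.s v ≤ _ at this
  have e : 2 ^ 8 * S.α⁻¹ * (n : ℝ) ^ 2 * max S.βl1 S.βl2 * S.s v * S.α
      = 256 * ((n : ℝ) ^ 2 * max S.βl1 S.βl2 * S.s v) := by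
    field_simp; ring
  nlinarith [mul_le_mul_of_nonneg_right this hα.le]

lemma one_le_sqrt_two_le (hn : 2 ≤ n) : √2 ≤ √(n : ℝ) ∧ 7 / 5 ≤ √(n : ℝ) ∧
    √(n : ℝ) * √(n : ℝ) = n := by
  have hn' : (2 : ℝ) ≤ n := by exact_mod_cast hn
  refine ⟨Real.sqrt_le_sqrt hn', ?_, Real.mul_self_sqrt (by positivity)⟩
  refine Real.le_sqrt_of_sq_le (by norm_num; linarith)

lemma devBound_le (hn : 2 ≤ n) (hvμ : S.muL ≤ ‖v‖) (hvc : ‖v‖ < S.c) :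
    S.devBound v ≤ ‖v‖ / 16 := by
  have hα := S.α_pos
  have hv : 0 < ‖v‖ := (muL_pos hn).trans_le hvμ
  have h := threshold hn hvμ hvc
  have hs := s_pos hvc
  obtain ⟨h2, h75, hN⟩ := one_le_sqrt_two_le hn
  rw [devBound, two_rpow_nine_halves, rpow_three_halves (Nat.cast_nonneg n)]
  have hm : S.βl1 ≤ max S.βl1 S.βl2 := le_max_left _ _
  have hb := S.βl1_pos
  set N := √(n : ℝ)
  rw [← hN] at h ⊢
  rw [div_le_iff₀ (by positivity)] at h ⊢
  calc 16 * √2 * (N * N * N) * S.βl1 * S.s v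
      ≤ 16 * N * (N * N * N) * max S.βl1 S.βl2 * S.s v := by gcongr
    _ = 16 * ((N * N) ^ 2 * max S.βl1 S.βl2 * S.s v) := by ring
    _ ≤ 16 * (1 / 256 * (S.α * ‖v‖ ^ 2)) := by gcongr
    _ = _ := by ring

lemma force_integral_le (hn : 2 ≤ n) (hvμ : S.muL ≤ ‖v‖) (hvc : ‖v‖ < S.c) :
    2 * S.s v * (2 * n * S.βl1 * (2 * (1 / (S.α * (‖v‖ / 2))))) ≤ S.devBound v := by
  have hα := S.α_pos
  have hv : 0 < ‖v‖ := (muL_pos hn).trans_le hvμ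
  have hs := s_pos hvc
  obtain ⟨h2, h75, hN⟩ := one_le_sqrt_two_le hn
  have hb := S.βl1_pos
  rw [devBound, two_rpow_nine_halves, rpow_three_halves (Nat.cast_nonneg n)]
  have h22 : 1 ≤ √2 * √(n : ℝ) := by
    have : 1 ≤ √(2 : ℝ) := by rw [Real.one_le_sqrt]; norm_num
    nlinarith
  have e : 2 * S.s v * (2 * n * S.βl1 * (2 * (1 / (S.α * (‖v‖ / 2)))))
      = 16 * (1 * n) * S.βl1 * S.s v / (S.α * ‖v‖) := by field_simp; ring
  rw [e]
  have : 16 * √2 * (n * √(n : ℝ)) = 16 * (√2 * √(n : ℝ) * n) := by ring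
  rw [this]
  gcongr

theorem existsUnique_isFreeOut_of_isForce (hn : 2 ≤ n) (hvμ : S.muL ≤ ‖v‖) (hvc : ‖v‖ < S.c)
    {H : E n → E n → E n} (hH : IsForce S.c S.Vl (S.α + 1) (2 * n * S.βl1)
    (2 * (n * √(n : ℝ)) * S.βl2) (n * S.βl1 / S.c) H) :
    ∃! z, IsFreeOut S.c H v (S.devBound v) z := by
  have hα := S.α_pos
  have hc := S.c_pos
  have hv : 0 < ‖v‖ := (muL_pos hn).trans_le hvμ
  have hs := s_pos hvc
  have hb := S.βl1_pos
  have hb2 := S.βl2_pos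
  refine existsUnique_isFreeOut hc hH hα hv hvc (by positivity) (by positivity)
    (by positivity) (devBound_le hn hvμ hvc) (force_integral_le hn hvμ hvc) ?_
  change 32 / 15 * S.s v * _ ≤ _
  have h := threshold hn hvμ hvc
  obtain ⟨h2, h75, hN⟩ := one_le_sqrt_two_le hn
  set N := √(n : ℝ) with hNdef
  set m := max S.βl1 S.βl2 with hm
  have h1m : S.βl1 ≤ m := le_max_left _ _
  have h2m : S.βl2 ≤ m := le_max_right _ _
  have hm0 : 0 < m := hb.trans_le h1m
  have hN0 : 0 < N := by linarith
  rw [← hN] at h ⊢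
  have e1 : (N * N * S.βl1 / S.c) ≤ N * N * m / ‖v‖ := by gcongr
  have e2 : 2 * (N * N * N) * S.βl2 / (‖v‖ / 2) ≤ 4 * (N * N * N) * m / ‖v‖ := by
    rw [div_le_div_iff₀ (by positivity) hv]
    have : 2 * (N * N * N) * S.βl2 * ‖v‖ ≤ 2 * (N * N * N) * m * ‖v‖ := by gcongr
    linarith
  calc 32 / 15 * S.s v * ((2 * (N * N * N) * S.βl2 / (‖v‖ / 2) + N * N * S.βl1 / S.c)
        * (2 * (1 / (S.α * (‖v‖ / 2)))))
      ≤ 32 / 15 * S.s v * ((4 * (N * N * N) * m / ‖v‖ + N * N * m / ‖v‖)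
        * (2 * (1 / (S.α * (‖v‖ / 2))))) := by gcongr
    _ = 128 / 15 * (4 / N + 1 / N ^ 2) * ((N * N) ^ 2 * m * S.s v / (S.α * ‖v‖ ^ 2)) := by
        field_simp; ring
    _ ≤ 128 / 15 * (4 / 1 + 1 / 1 ^ 2) * (1 / 256) := by gcongr <;> linarith
    _ ≤ 1 / 2 := by norm_num

lemma isFree_atTop_iff {z : ℝ → E n} :
    S.IsFree atTop v z ↔ IsFreeOut S.c S.Fl v (S.devBound v) z :=
  ⟨fun h => ⟨h.1, h.2, h.3, h.4⟩, fun h => ⟨h.1, h.2, h.3, h.4⟩⟩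

lemma devBound_neg : S.devBound (-v) = S.devBound v := by
  simp [devBound, Setting.s]

lemma isFreeOut_rev {l : Filter ℝ} {H : E n → E n → E n} {c R : ℝ} {z : ℝ → E n}
    (hl : Tendsto Neg.neg atTop l)
    (h : IsSolution c H z) (h2 : Tendsto (deriv z) l (𝓝 v)) (h0 : z 0 = 0)
    (hR : ∀ t, ‖deriv z t - v‖ ≤ R) : IsFreeOut c (revForce H) (-v) R (fun t => z (-t)) := by
  refine ⟨h.rev, ?_, by simpa using h0, fun t => ?_⟩
  · rw [show deriv (fun t => z (-t)) = fun t => -deriv z (-t) from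
      funext fun t => deriv_comp_neg' z t]
    exact (h2.comp hl).neg
  · rw [deriv_comp_neg', neg_sub_neg, norm_sub_rev]
    exact hR (-t)

/-- The free solutions at `-∞` are the reversed free solutions of the reversed force. -/
lemma isFree_atBot_iff {z : ℝ → E n} :
    S.IsFree atBot v z ↔
      IsFreeOut S.c (revForce S.Fl) (-v) (S.devBound (-v)) (fun t => z (-t)) := by
  rw [devBound_neg]
  refine ⟨fun h => isFreeOut_rev tendsto_neg_atTop_atBot h.1 h.2 h.3 h.4, fun h => ?_⟩
  have e : ∀ t, deriv (fun t => z (-t)) (-t) = -deriv z t := fun t => by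
    rw [deriv_comp_neg', neg_neg]
  refine ⟨?_, ?_, ?_, fun t => ?_⟩
  · have := h.solution.rev
    rw [revForce_revForce] at this
    simpa using this
  · have := (h.asymptotic.comp tendsto_neg_atBot_atTop).neg
    simpa [Function.comp_def, e] using this
  · simpa using h.origin
  · have := h.close (-t)
    rw [e, neg_sub_neg, norm_sub_rev] at this
    exact this

theorem existsUnique_isFree_atTop (hn : 2 ≤ n) (hvμ : S.muL ≤ ‖v‖) (hvc : ‖v‖ < S.c) :
    ∃! z, S.IsFree atTop v z := by
  simp only [isFree_atTop_iff]
  exact existsUnique_isFreeOut_of_isForce hn hvμ hvc (S.isForce_Fl hn)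

theorem existsUnique_isFree_atBot (hn : 2 ≤ n) (hvμ : S.muL ≤ ‖v‖) (hvc : ‖v‖ < S.c) :
    ∃! z, S.IsFree atBot v z := by
  obtain ⟨z, hz, hu⟩ := existsUnique_isFreeOut_of_isForce (v := -v) hn (by rwa [norm_neg])
    (by rwa [norm_neg]) (S.isForce_Fl hn).rev
  refine ⟨fun t => z (-t), isFree_atBot_iff.2 (by simpa using hz), fun y hy => ?_⟩
  have := hu _ (isFree_atBot_iff.1 hy)
  rw [← this]; simp

end Setting

end RelScat

namespace RelScat

variable {n : ℕ}

/-! ### The region around the straight line -/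

/-- The rate `κ = |v|/(2√2) - r` at which the trajectories are known to leave the origin. -/
noncomputable def kap (v : E n) (r : ℝ) : ℝ := ‖v‖ / (2 * √2) - r

lemma kap_neg (v : E n) (r : ℝ) : kap (-v) r = kap v r := by simp [kap]

/-- The hypotheses on the incoming data `(v, x)` and the radius `r`. -/
structure Admissible (S : Setting n) (v x : E n) (r : ℝ) : Prop where
  dim : 2 ≤ n
  speed_lt : ‖v‖ < S.c
  le_speed : S.muL ≤ ‖v‖
  orth : inner ℝ v x = 0
  r_pos : 0 < r
  r_lt : r < ‖v‖ / (2 * √2)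
  r_lt_one : r < 1
  small : 24 * (n : ℝ) ^ 2 * S.s v * max S.βl1 S.β2 * (1 + 1 / S.c) * (1 + 1 / kap v r)
    / (S.α * kap v r * (1 - r) ^ (S.α + 1)) ≤ 1

/-- A convex neighbourhood, at time `t`, of the positions `tv + λx` with `0 ≤ λ ≤ 1`. All the
trajectories that are compared with one another run in it. -/
def tube (v x : E n) (r t : ℝ) : Set (E n) :=
  {q | ∃ l ∈ Icc (0 : ℝ) 1, ‖q - t • v - l • x‖ ≤ r + |t| * (‖v‖ / 8 + r)}

lemma convex_tube (v x : E n) (r t : ℝ) : Convex ℝ (tube v x r t) := by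
  rintro q ⟨l, hl, hq⟩ q' ⟨l', hl', hq'⟩ a b ha hb hab
  refine ⟨a • l + b • l', convex_Icc (0 : ℝ) 1 hl hl' ha hb hab, ?_⟩
  have e : a • q + b • q' - t • v - (a • l + b • l') • x
      = a • (q - t • v - l • x) + b • (q' - t • v - l' • x) := by
    have : t • v = a • (t • v) + b • (t • v) := by rw [← add_smul, hab, one_smul]
    calc _ = a • q + b • q' - (a • (t • v) + b • (t • v)) - (a * l + b * l') • x := by
          rw [← this]; rfl
      _ = _ := by module
  rw [e]
  refine (norm_add_le _ _).trans ?_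
  rw [norm_smul, norm_smul, Real.norm_of_nonneg ha, Real.norm_of_nonneg hb]
  calc a * ‖q - t • v - l • x‖ + b * ‖q' - t • v - l' • x‖
      ≤ a * (r + |t| * (‖v‖ / 8 + r)) + b * (r + |t| * (‖v‖ / 8 + r)) := by gcongr
    _ = (a + b) * (r + |t| * (‖v‖ / 8 + r)) := by ring
    _ = _ := by rw [hab, one_mul]

lemma tube_neg {v x q : E n} {r t : ℝ} : q ∈ tube (-v) x r t ↔ q ∈ tube v x r (-t) := by
  simp [tube]

lemma norm_line_ge {v x : E n} (h : inner ℝ v x = 0) (t l : ℝ) : |t| * ‖v‖ ≤ ‖t • v + l • x‖ := by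
  have h1 : ‖t • v + l • x‖ ^ 2 = ‖t • v‖ ^ 2 + ‖l • x‖ ^ 2 := by
    rw [norm_add_sq_real, inner_smul_left, inner_smul_right, h]; simp
  have h2 : ‖t • v‖ ≤ ‖t • v + l • x‖ := by
    refine le_of_sq_le_sq ?_ (norm_nonneg _)
    rw [h1]; linarith [sq_nonneg ‖l • x‖]
  rwa [norm_smul, Real.norm_eq_abs] at h2

lemma div_two_sqrt_two_le (a : ℝ) (ha : 0 ≤ a) : a / (2 * √2) ≤ 3 / 8 * a := by
  have h : 4 / 3 ≤ √(2 : ℝ) := Real.le_sqrt_of_sq_le (by norm_num)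
  rw [div_le_iff₀ (by positivity)]
  nlinarith

/-- The tube recedes from the origin: orthogonality of `x` to `v` gives `|tv + λx| ≥ |t||v|`, and
`1/(2√2) ≤ 3/8` leaves room for the deviation `|t||v|/8`. -/
lemma rho_le_of_mem_tube {v x q : E n} {r t : ℝ} (h : inner ℝ v x = 0)
    (hq : q ∈ tube v x r t) : rho (1 - r) (kap v r) t ≤ 1 + ‖q‖ := by
  obtain ⟨l, -, hq⟩ := hq
  have h1 := norm_line_ge h t l
  have h2 := norm_sub_le q (q - t • v - l • x)
  rw [show q - (q - t • v - l • x) = t • v + l • x by abel] at h2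
  have h3 := div_two_sqrt_two_le ‖v‖ (norm_nonneg v)
  unfold rho kap
  nlinarith [abs_nonneg t, mul_le_mul_of_nonneg_left h3 (abs_nonneg t),
    mul_nonneg (abs_nonneg t) (norm_nonneg v)]

/-- The quantity `n² s max(β₁^l, β₂) / (α κ (1 - r)^{α+1})`; the smallness hypothesis says that it
is small compared with `1`, `κ` and `c`. -/
noncomputable def smallness (S : Setting n) (v : E n) (r : ℝ) : ℝ :=
  (n : ℝ) ^ 2 * S.s v * max S.βl1 S.β2 / (S.α * kap v r) * (1 - r) ^ (-(S.α + 1))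

namespace Admissible

variable {S : Setting n} {v x : E n} {r : ℝ}

lemma neg (A : Admissible S v x r) : Admissible S (-v) x r := by
  refine ⟨A.dim, by simpa using A.speed_lt, by simpa using A.le_speed, ?_, A.r_pos,
    by simpa using A.r_lt, A.r_lt_one, ?_⟩
  · rw [inner_neg_left, A.orth, neg_zero]
  · simpa [Setting.s, kap_neg] using A.small

lemma kap_pos (A : Admissible S v x r) : 0 < kap v r := sub_pos.2 A.r_lt

lemma one_sub_pos (A : Admissible S v x r) : 0 < 1 - r := sub_pos.2 A.r_lt_one

lemma s_pos (A : Admissible S v x r) : 0 < S.s v := Setting.s_pos A.speed_lt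

lemma kap_le (A : Admissible S v x r) : kap v r ≤ 3 / 8 * ‖v‖ := by
  have := div_two_sqrt_two_le ‖v‖ (norm_nonneg v)
  have := A.r_pos
  unfold kap; linarith

lemma smallness_mul_le (A : Admissible S v x r) :
    smallness S v r * ((1 + 1 / S.c) * (1 + 1 / kap v r)) ≤ 1 / 24 := by
  have h := A.small
  have h1 := A.one_sub_pos
  have h2 := A.kap_pos
  have h3 := S.α_pos
  have h4 : 0 < (1 - r) ^ (S.α + 1) := by positivity
  rw [smallness, Real.rpow_neg h1.le]
  rw [div_le_iff₀ (by positivity)] at h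
  have e : (n : ℝ) ^ 2 * S.s v * max S.βl1 S.β2 / (S.α * kap v r) * ((1 - r) ^ (S.α + 1))⁻¹
      * ((1 + 1 / S.c) * (1 + 1 / kap v r))
      = (24 * (n : ℝ) ^ 2 * S.s v * max S.βl1 S.β2 * (1 + 1 / S.c) * (1 + 1 / kap v r))
        / (24 * (S.α * kap v r * (1 - r) ^ (S.α + 1))) := by
    field_simp
  rw [e, div_le_iff₀ (by positivity)]
  linarith

lemma max_pos (_A : Admissible S v x r) : 0 < max S.βl1 S.β2 := lt_max_of_lt_left S.βl1_pos

lemma n_pos (A : Admissible S v x r) : (0 : ℝ) < n := by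
  exact_mod_cast (by have := A.dim; omega : 0 < n)

lemma smallness_pos (A : Admissible S v x r) : 0 < smallness S v r := by
  have h1 := A.one_sub_pos
  have h2 := A.kap_pos
  have h3 := S.α_pos
  have h4 := A.s_pos
  have h5 := A.max_pos
  have h6 := A.n_pos
  unfold smallness; positivity

lemma smallness_le_kap (A : Admissible S v x r) : smallness S v r ≤ kap v r / 24 := by
  have h := A.smallness_mul_le
  have h0 := A.smallness_pos
  have h2 := A.kap_pos
  have hc := S.c_pos
  have : smallness S v r * (1 / kap v r)
      ≤ smallness S v r * ((1 + 1 / S.c) * (1 + 1 / kap v r)) := by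
    gcongr
    have : 0 < 1 / S.c := by positivity
    have : 0 < 1 / kap v r := by positivity
    nlinarith
  have h3 := this.trans h
  rw [mul_one_div, div_le_iff₀ h2] at h3
  linarith

lemma smallness_le_c (A : Admissible S v x r) : smallness S v r ≤ S.c / 24 := by
  have h := A.smallness_mul_le
  have h0 := A.smallness_pos
  have h2 := A.kap_pos
  have hc := S.c_pos
  have : smallness S v r * (1 / S.c) ≤ smallness S v r * ((1 + 1 / S.c) * (1 + 1 / kap v r)) := by
    gcongr
    have : 0 < 1 / S.c := by positivity
    have : 0 < 1 / kap v r := by positivity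
    nlinarith
  have h3 := this.trans h
  rw [mul_one_div, div_le_iff₀ hc] at h3
  linarith

lemma rho_pos (A : Admissible S v x r) (t : ℝ) : 0 < rho (1 - r) (kap v r) t :=
  RelScat.rho_pos A.one_sub_pos A.kap_pos t

end Admissible

/-! ### Comparison of curves with the free motion on a half-line -/

lemma rpow_neg_anti {a b p : ℝ} (ha : 0 < a) (hab : a ≤ b) (hp : 0 ≤ p) :
    b ^ (-p) ≤ a ^ (-p) := Real.rpow_le_rpow_of_nonpos ha hab (by linarith)

lemma rho_rpow_mul {a k : ℝ} (ha : 0 < a) (hk : 0 < k) (p t : ℝ) :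
    rho a k t ^ (-(p + 1)) * rho a k t = rho a k t ^ (-p) := by
  rw [← Real.rpow_add_one (rho_pos ha hk t).ne']; congr 1; ring

lemma abs_mul_rho_le {a k : ℝ} (ha : 0 < a) (hk : 0 < k) (p t : ℝ) :
    |t| * rho a k t ^ (-(p + 1)) ≤ rho a k t ^ (-p) / k := by
  rw [le_div_iff₀ hk, ← rho_rpow_mul ha hk p]
  have : |t| * k ≤ rho a k t := by unfold rho; linarith
  have h := (Real.rpow_pos_of_pos (rho_pos ha hk t) (-(p + 1))).le
  nlinarith

/-- Integral of a velocity bound over a time interval. -/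
lemma norm_sub_le_of_deriv_le_rho {a k α θ C : ℝ} (ha : 0 < a) (hk : 0 < k) (hα : 0 < α)
    (hC : 0 ≤ C) {u : ℝ → E n} (hu : Differentiable ℝ u) (hu' : Continuous (deriv u))
    (hd : ∀ t ≥ 0, ‖deriv u t‖ ≤ θ + C * rho a k t ^ (-(α + 1))) {t : ℝ} (ht : 0 ≤ t) :
    ‖u t - u 0‖ ≤ θ * t + C * (a ^ (-α) / (α * k)) := by
  have hci := (continuous_rho_rpow ha hk (-(α + 1))).intervalIntegrable (μ := volume) 0 t
  rw [← intervalIntegral.integral_deriv_eq_sub (fun τ _ => hu τ) (hu'.intervalIntegrable _ _)]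
  refine (intervalIntegral.norm_integral_le_of_norm_le ht (g := fun τ =>
    θ + C * rho a k τ ^ (-(α + 1))) ?_ ?_).trans ?_
  · exact Eventually.of_forall fun τ hτ => hd τ hτ.1.le
  · exact intervalIntegrable_const.add (hci.const_mul C)
  · rw [intervalIntegral.integral_add intervalIntegrable_const (hci.const_mul C),
      intervalIntegral.integral_const, intervalIntegral.integral_const_mul, smul_eq_mul, sub_zero,
      mul_comm t]
    have : ∫ τ in (0 : ℝ)..t, rho a k τ ^ (-(α + 1)) ≤ a ^ (-α) / (α * k) := by
      rw [intervalIntegral.integral_of_le ht]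
      have h0 := integral_Ioi_rho ha hk hα (le_refl (0 : ℝ))
      rw [rho_zero] at h0
      rw [← h0]
      exact setIntegral_mono_set (integrable_rho ha hk hα).integrableOn
        (Eventually.of_forall fun τ => (Real.rpow_pos_of_pos (rho_pos ha hk τ) _).le)
        (Eventually.of_forall fun τ hτ => hτ.1)
    gcongr

/-- Decay of a deflection `u` whose velocity is controlled by the integral, from the present to
`+∞`, of a force difference that is itself controlled by `u`. Knowing `|u'| ≤ θ + C₁ ρ^{-(α+1)}`
for the right `C₁` improves `θ` to `θ/2`; no decay of `u'` is needed to start. -/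
theorem norm_deriv_le_of_integral_bound {a k α B₀ Λ k₀ k₁ k₂ M : ℝ} (ha : 0 < a) (hk : 0 < k)
    (hα : 0 < α) (hB : 0 ≤ B₀) (hΛ : 0 ≤ Λ) (hk₀ : 0 ≤ k₀) (hk₁ : 0 ≤ k₁) (hk₂ : 0 ≤ k₂)
    {u h : ℝ → E n} (hu : Differentiable ℝ u) (hu' : Continuous (deriv u)) (h0 : ‖u 0‖ ≤ B₀)
    (hM : ∀ t ≥ 0, ‖deriv u t‖ ≤ M)
    (hint : ∀ t ≥ 0, ‖deriv u t‖ ≤ Λ * ‖∫ τ in Ioi t, h τ‖)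
    (hh : ∀ t ≥ 0, ‖h t‖ ≤ k₁ * rho a k t ^ (-(α + 1 + 1)) * ‖u t‖
      + k₂ * rho a k t ^ (-(α + 1)) * ‖deriv u t‖ + k₀ * rho a k t ^ (-(α + 1 + 1)))
    (hε : Λ * ((k₁ / k + k₂) * (a ^ (-α) / (α * k))) ≤ 1 / 2)
    (hε' : Λ * ((k₁ * (a ^ (-α) / (α * k)) + k₂ * a ^ (-α)) / ((α + 1) * k)) ≤ 1 / 5) :
    ∀ t ≥ 0, ‖deriv u t‖ ≤
      5 / 4 * (Λ * ((k₁ * B₀ + k₀) / ((α + 1) * k))) * rho a k t ^ (-(α + 1)) := by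
  set C := 5 / 4 * (Λ * ((k₁ * B₀ + k₀) / ((α + 1) * k))) with hCdef
  have hC : 0 ≤ C := by positivity
  have hα1 : 0 < α + 1 := by linarith
  have step : ∀ θ, 0 ≤ θ → (∀ t ≥ 0, ‖deriv u t‖ ≤ θ + C * rho a k t ^ (-(α + 1))) →
      ∀ t ≥ 0, ‖deriv u t‖ ≤ θ / 2 + C * rho a k t ^ (-(α + 1)) := by
    intro θ hθ hd t ht
    have hu2 : ∀ τ ≥ 0, ‖u τ‖ ≤ B₀ + θ * τ + C * (a ^ (-α) / (α * k)) := fun τ hτ => by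
      have h1 := norm_sub_le_of_deriv_le_rho ha hk hα hC hu hu' hd hτ
      have h2 := norm_add_le (u τ - u 0) (u 0)
      rw [sub_add_cancel] at h2
      linarith
    have hh2 : ∀ τ > t, ‖h τ‖ ≤ (k₁ / k + k₂) * θ * rho a k τ ^ (-(α + 1))
        + (k₁ * (B₀ + C * (a ^ (-α) / (α * k))) + k₂ * C * a ^ (-α) + k₀)
          * rho a k τ ^ (-(α + 1 + 1)) := by
      intro τ hτ
      have hτ0 : 0 ≤ τ := ht.trans hτ.le
      refine (hh τ hτ0).trans ?_
      have hρ := RelScat.rho_pos ha hk τ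
      have e1 := abs_mul_rho_le ha hk (α + 1) τ
      rw [abs_of_nonneg hτ0] at e1
      have e2 : rho a k τ ^ (-(α + 1)) * rho a k τ ^ (-(α + 1))
          ≤ a ^ (-α) * rho a k τ ^ (-(α + 1 + 1)) := by
        rw [← Real.rpow_add hρ, show -(α + 1) + -(α + 1) = -α + -(α + 1 + 1) by ring,
          Real.rpow_add hρ]
        exact mul_le_mul_of_nonneg_right (rpow_neg_anti ha (le_rho hk τ) hα.le)
          (by positivity)
      set R1 := rho a k τ ^ (-(α + 1))
      set R2 := rho a k τ ^ (-(α + 1 + 1))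
      have hR1 : 0 ≤ R1 := by positivity
      have hR2 : 0 ≤ R2 := by positivity
      calc _ ≤ k₁ * R2 * (B₀ + θ * τ + C * (a ^ (-α) / (α * k))) + k₂ * R1 * (θ + C * R1)
            + k₀ * R2 := by
            gcongr
            · exact hu2 τ hτ0
            · exact hd τ hτ0
        _ = k₁ * θ * (τ * R2) + k₂ * θ * R1 + k₂ * C * (R1 * R1)
            + (k₁ * (B₀ + C * (a ^ (-α) / (α * k))) + k₀) * R2 := by ring
        _ ≤ k₁ * θ * (R1 / k) + k₂ * θ * R1 + k₂ * C * (a ^ (-α) * R2)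
            + (k₁ * (B₀ + C * (a ^ (-α) / (α * k))) + k₀) * R2 := by gcongr
        _ = _ := by ring
    have h3 := norm_integral_Ioi_le_rho ha hk hα hα1 ht hh2
    have hρ := RelScat.rho_pos ha hk t
    have e4 : rho a k t ^ (-α) ≤ a ^ (-α) := rpow_neg_anti ha (le_rho hk t) hα.le
    set R1 := rho a k t ^ (-(α + 1))
    have hR1 : 0 ≤ R1 := by positivity
    calc ‖deriv u t‖ ≤ Λ * ‖∫ τ in Ioi t, h τ‖ := hint t ht
      _ ≤ Λ * ((k₁ / k + k₂) * θ * (a ^ (-α) / (α * k))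
        + (k₁ * (B₀ + C * (a ^ (-α) / (α * k))) + k₂ * C * a ^ (-α) + k₀)
          * (R1 / ((α + 1) * k))) := by
          refine mul_le_mul_of_nonneg_left (h3.trans ?_) hΛ
          gcongr
      _ = θ * (Λ * ((k₁ / k + k₂) * (a ^ (-α) / (α * k)))) + R1 * (4 / 5 * C
          + C * (Λ * ((k₁ * (a ^ (-α) / (α * k)) + k₂ * a ^ (-α)) / ((α + 1) * k)))) := by
          rw [hCdef]; ring
      _ ≤ θ * (1 / 2) + R1 * (4 / 5 * C + C * (1 / 5)) := by gcongr
      _ = _ := by ring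
  have hM0 : 0 ≤ M := (norm_nonneg _).trans (hM 0 le_rfl)
  have iter : ∀ j : ℕ, ∀ t ≥ 0, ‖deriv u t‖ ≤ M * (1 / 2) ^ j + C * rho a k t ^ (-(α + 1)) := by
    intro j
    induction j with
    | zero =>
      intro t ht
      have hρ := RelScat.rho_pos ha hk t
      have : 0 ≤ C * rho a k t ^ (-(α + 1)) := by positivity
      rw [pow_zero, mul_one]
      linarith [hM t ht]
    | succ j ih =>
      intro t ht
      have := step _ (by positivity) ih t ht
      rwa [pow_succ, mul_one_div, ← mul_div_assoc]
  intro t ht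
  have hl : Tendsto (fun j : ℕ => M * (1 / 2 : ℝ) ^ j + C * rho a k t ^ (-(α + 1))) atTop
      (𝓝 (M * 0 + C * rho a k t ^ (-(α + 1)))) :=
    ((tendsto_pow_atTop_nhds_zero_of_lt_one (by norm_num) (by norm_num)).const_mul M).add_const _
  rw [mul_zero, zero_add] at hl
  exact ge_of_tendsto' hl fun j => iter j t ht

end RelScat

namespace RelScat

variable {n : ℕ} {S : Setting n} {v x : E n} {r : ℝ}

/-! ### The forces in the tube -/

/-- The long range force `Fl` and the short range force `Fs`, up to time reversal. -/
structure Forces (S : Setting n) (Fl Fs : E n → E n → E n) : Prop where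
  long : IsForce S.c S.Vl (S.α + 1) (2 * n * S.βl1) (2 * (n * √(n : ℝ)) * S.βl2)
    (n * S.βl1 / S.c) Fl
  short : IsForce S.c S.Vs (S.α + 1 + 1) (2 * n * S.βs2) (2 * (n * √(n : ℝ)) * S.βs3)
    (n * S.βs2 / S.c) Fs

/-- The sum of two forces. -/
def total (Fl Fs : E n → E n → E n) : E n → E n → E n := fun q w => Fl q w + Fs q w

lemma Setting.forces (S : Setting n) (hn : 2 ≤ n) : Forces S S.Fl S.Fs :=
  ⟨S.isForce_Fl hn, S.isForce_Fs hn⟩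

variable {Fl Fs : E n → E n → E n}

lemma Forces.rev (Fo : Forces S Fl Fs) : Forces S (revForce Fl) (revForce Fs) :=
  ⟨Fo.long.rev, Fo.short.rev⟩

lemma Forces.continuous_along (Fo : Forces S Fl Fs) {f : ℝ → E n} (hf : Continuous f)
    (hf' : Continuous (deriv f)) : Continuous (along (total Fl Fs) f) :=
  (Fo.long.continuous_along hf hf').add (Fo.short.continuous_along hf hf')

section

variable {q q' w w' : E n} {t : ℝ}

lemma Forces.long_le (Fo : Forces S Fl Fs) (A : Admissible S v x r) (hq : q ∈ tube v x r t)
    (hw : ‖w‖ ≤ S.c) :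
    ‖Fl q w‖ ≤ 2 * n * S.βl1 * rho (1 - r) (kap v r) t ^ (-(S.α + 1)) := by
  have := S.βl1_pos
  refine (Fo.long.bound q w hw).trans (mul_le_mul_of_nonneg_left ?_ (by positivity))
  exact rpow_neg_anti (A.rho_pos t) (rho_le_of_mem_tube A.orth hq) (by linarith [S.α_pos])

lemma Forces.short_le (Fo : Forces S Fl Fs) (A : Admissible S v x r) (hq : q ∈ tube v x r t)
    (hw : ‖w‖ ≤ S.c) :
    ‖Fs q w‖ ≤ 2 * n * S.β2 * rho (1 - r) (kap v r) t ^ (-(S.α + 1 + 1)) := by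
  have h1 := S.βs2_pos
  have h2 : S.βs2 ≤ S.β2 := le_max_right _ _
  have h3 := A.rho_pos t
  have h4 : 0 < S.β2 := h1.trans_le h2
  refine (Fo.short.bound q w hw).trans ?_
  refine mul_le_mul (by gcongr) ?_ (by positivity) (by positivity)
  exact rpow_neg_anti (A.rho_pos t) (rho_le_of_mem_tube A.orth hq) (by linarith [S.α_pos])

lemma Forces.long_sub_le (Fo : Forces S Fl Fs) (A : Admissible S v x r) (hq : q ∈ tube v x r t)
    (hq' : q' ∈ tube v x r t) (hw : ‖w‖ ≤ S.c) (hw' : ‖w'‖ ≤ S.c) :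
    ‖Fl q w - Fl q' w'‖ ≤
      2 * (n * √(n : ℝ)) * S.β2 * rho (1 - r) (kap v r) t ^ (-(S.α + 1 + 1)) * ‖q - q'‖
        + n * S.βl1 / S.c * rho (1 - r) (kap v r) t ^ (-(S.α + 1)) * ‖w - w'‖ := by
  have h2 : S.βl2 ≤ S.β2 := le_max_left _ _
  have h3 := A.rho_pos t
  refine (Fo.long.lip q q' w w' _ h3 hw hw' fun p hp =>
    rho_le_of_mem_tube A.orth ((convex_tube v x r t).segment_subset hq hq' hp)).trans ?_
  gcongr

lemma Setting.βl1_le (S : Setting n) : S.βl1 ≤ S.β := (le_max_left _ _).trans (le_max_left _ _)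
lemma Setting.β2_le (S : Setting n) : S.β2 ≤ S.β := (le_max_right _ _).trans (le_max_left _ _)
lemma Setting.βs3_le (S : Setting n) : S.βs3 ≤ S.β := le_max_right _ _
lemma Setting.max_le (S : Setting n) : max S.βl1 S.β2 ≤ S.β := le_max_left _ _
lemma Setting.β2_pos (S : Setting n) : 0 < S.β2 := lt_max_of_lt_left S.βl2_pos
lemma Setting.β_pos (S : Setting n) : 0 < S.β := S.βs3_pos.trans_le S.βs3_le

lemma Forces.short_sub_le (Fo : Forces S Fl Fs) (A : Admissible S v x r)
    (hq : q ∈ tube v x r t) (hq' : q' ∈ tube v x r t) (hw : ‖w‖ ≤ S.c) (hw' : ‖w'‖ ≤ S.c) :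
    ‖Fs q w - Fs q' w'‖ ≤
      2 * (n * √(n : ℝ)) * S.β * rho (1 - r) (kap v r) t ^ (-(S.α + 1 + 1 + 1)) * ‖q - q'‖
        + n * S.β / S.c * rho (1 - r) (kap v r) t ^ (-(S.α + 1 + 1)) * ‖w - w'‖ := by
  have h2 : S.βs2 ≤ S.β := (le_max_right _ _).trans S.β2_le
  have h2' := S.βs3_le
  have h3 := A.rho_pos t
  have hc := S.c_pos
  refine (Fo.short.lip q q' w w' _ h3 hw hw' fun p hp =>
    rho_le_of_mem_tube A.orth ((convex_tube v x r t).segment_subset hq hq' hp)).trans ?_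
  gcongr

lemma Admissible.rho_succ_le (A : Admissible S v x r) (p t : ℝ) :
    rho (1 - r) (kap v r) t ^ (-(p + 1)) ≤ (1 - r)⁻¹ * rho (1 - r) (kap v r) t ^ (-p) := by
  have h := A.rho_pos t
  rw [← rho_rpow_mul A.one_sub_pos A.kap_pos p, mul_comm _ (rho (1 - r) (kap v r) t), ← mul_assoc]
  have h1 : 1 ≤ (1 - r)⁻¹ * rho (1 - r) (kap v r) t := by
    rw [inv_mul_eq_div, one_le_div A.one_sub_pos]; exact le_rho A.kap_pos t
  have h2 : 0 ≤ rho (1 - r) (kap v r) t ^ (-(p + 1)) := by positivity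
  nlinarith

lemma Forces.total_le (Fo : Forces S Fl Fs) (A : Admissible S v x r) (hq : q ∈ tube v x r t)
    (hw : ‖w‖ ≤ S.c) :
    ‖total Fl Fs q w‖ ≤ 4 * n * max S.βl1 S.β2 * (1 - r)⁻¹
      * rho (1 - r) (kap v r) t ^ (-(S.α + 1)) := by
  have h1 := Fo.long_le A hq hw
  have h2 := Fo.short_le A hq hw
  have h3 := A.rho_succ_le (S.α + 1) t
  have hρ := A.rho_pos t
  have h4 : 1 ≤ (1 - r)⁻¹ := (one_le_inv₀ A.one_sub_pos).2 (by linarith [A.r_pos])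
  have h5 : S.βl1 ≤ max S.βl1 S.β2 := le_max_left _ _
  have h6 : S.β2 ≤ max S.βl1 S.β2 := le_max_right _ _
  have h7 := A.max_pos
  refine (norm_add_le _ _).trans ?_
  set R1 := rho (1 - r) (kap v r) t ^ (-(S.α + 1))
  have hR1 : 0 ≤ R1 := by positivity
  calc _ ≤ 2 * n * max S.βl1 S.β2 * ((1 - r)⁻¹ * R1)
        + 2 * n * max S.βl1 S.β2 * ((1 - r)⁻¹ * R1) := by
        refine add_le_add (h1.trans ?_) (h2.trans ?_)
        · refine mul_le_mul (by gcongr) ?_ hR1 (by positivity)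
          nlinarith
        · gcongr
    _ = _ := by ring

end

/-! ### Momentum transfers -/

/-- A bound of all momentum transfers. -/
noncomputable def impulse (S : Setting n) (v : E n) (r : ℝ) : ℝ := 8 * smallness S v r / (n * S.s v)

lemma Admissible.impulse_eq (A : Admissible S v x r) : impulse S v r =
    4 * n * max S.βl1 S.β2 * (1 - r)⁻¹ * (2 * ((1 - r) ^ (-S.α) / (S.α * kap v r))) := by
  have := A.one_sub_pos
  have := A.kap_pos
  have := S.α_pos
  have := A.s_pos
  have := A.n_pos
  rw [impulse, smallness, Real.rpow_neg (by linarith), Real.rpow_neg (by linarith),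
    Real.rpow_add_one (by linarith)]
  field_simp
  ring

lemma Admissible.impulse_pos (A : Admissible S v x r) : 0 < impulse S v r := by
  have := A.s_pos
  have := A.n_pos
  have := A.smallness_pos
  unfold impulse; positivity

lemma Admissible.s_mul_impulse_le (A : Admissible S v x r) :
    S.s v * impulse S v r ≤ ‖v‖ / 16 := by
  have h1 := A.s_pos
  have h2 := A.n_pos
  have h3 := A.smallness_le_kap
  have h4 := A.kap_le
  have h5 : (2 : ℝ) ≤ n := by exact_mod_cast A.dim
  have h6 := A.smallness_pos
  have e : S.s v * impulse S v r = 8 * smallness S v r / n := by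
    unfold impulse; field_simp
  rw [e, div_le_iff₀ h2]
  nlinarith [norm_nonneg v]

lemma Admissible.impulse_le (A : Admissible S v x r) : impulse S v r ≤ S.c / 16 / S.s v := by
  rw [le_div_iff₀ A.s_pos]
  linarith [A.s_mul_impulse_le, A.speed_lt, mul_comm (S.s v) (impulse S v r)]

section

variable {f : ℝ → E n}

lemma Forces.integrable_total (Fo : Forces S Fl Fs) (A : Admissible S v x r) (hf : Continuous f)
    (hf' : Continuous (deriv f)) (ht : ∀ t, f t ∈ tube v x r t) (hs : ∀ t, ‖deriv f t‖ ≤ S.c) :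
    Integrable (along (total Fl Fs) f) :=
  integrable_of_le_rho A.one_sub_pos A.kap_pos S.α_pos (Fo.continuous_along hf hf')
    fun t => Fo.total_le A (ht t) (hs t)

lemma Forces.norm_integral_total_le (Fo : Forces S Fl Fs) (A : Admissible S v x r)
    (ht : ∀ t, f t ∈ tube v x r t) (hs : ∀ t, ‖deriv f t‖ ≤ S.c) (s : Set ℝ) :
    ‖∫ t in s, along (total Fl Fs) f t‖ ≤ impulse S v r := by
  rw [A.impulse_eq]
  exact norm_setIntegral_le_rho A.one_sub_pos A.kap_pos S.α_pos
    (fun t => Fo.total_le A (ht t) (hs t)) s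

lemma Forces.integrable_long (Fo : Forces S Fl Fs) (A : Admissible S v x r) (hf : Continuous f)
    (hf' : Continuous (deriv f)) (ht : ∀ t, f t ∈ tube v x r t) (hs : ∀ t, ‖deriv f t‖ ≤ S.c) :
    Integrable (along Fl f) :=
  integrable_of_le_rho A.one_sub_pos A.kap_pos S.α_pos (Fo.long.continuous_along hf hf')
    fun t => Fo.long_le A (ht t) (hs t)

lemma Forces.norm_integral_long_le (Fo : Forces S Fl Fs) (A : Admissible S v x r)
    (ht : ∀ t, f t ∈ tube v x r t) (hs : ∀ t, ‖deriv f t‖ ≤ S.c) (s : Set ℝ) :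
    ‖∫ t in s, along Fl f t‖ ≤ impulse S v r := by
  rw [A.impulse_eq]
  refine norm_setIntegral_le_rho A.one_sub_pos A.kap_pos S.α_pos
    (fun t => (Fo.long_le A (ht t) (hs t)).trans ?_) s
  have h4 : 1 ≤ (1 - r)⁻¹ := (one_le_inv₀ A.one_sub_pos).2 (by linarith [A.r_pos])
  have h5 : S.βl1 ≤ max S.βl1 S.β2 := le_max_left _ _
  have h7 := A.max_pos
  have hρ := A.rho_pos t
  refine mul_le_mul_of_nonneg_right ?_ (by positivity)
  have h8 := A.n_pos
  have : 2 * n * S.βl1 ≤ 4 * n * max S.βl1 S.β2 := by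
    nlinarith [mul_le_mul_of_nonneg_left h5 h8.le, mul_pos h8 h7]
  have h9 : 0 < 4 * n * max S.βl1 S.β2 := by positivity
  nlinarith

end

/-- Two outgoing velocities with the same asymptotic velocity. -/
lemma norm_velOut_sub_velOut_le {c Q : ℝ} (hc : 0 < c) {w : E n} (hw : ‖w‖ < c)
    {H H' : E n → E n → E n} {f f' : ℝ → E n} {t : ℝ} (hi : IntegrableOn (along H f) (Ioi t))
    (hi' : IntegrableOn (along H' f') (Ioi t)) (hQ : ‖∫ τ in Ioi t, along H' f' τ‖ ≤ Q)
    (hQ' : Q ≤ c / 16 / √(1 - ‖w‖ ^ 2 / c ^ 2)) :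
    ‖velOut c w H f t - velOut c w H' f' t‖ ≤
      32 / 15 * √(1 - ‖w‖ ^ 2 / c ^ 2) * ‖∫ τ in Ioi t, (along H f τ - along H' f' τ)‖ := by
  have hs : 0 < √(1 - ‖w‖ ^ 2 / c ^ 2) := Real.sqrt_pos.2 (one_sub_sq_pos hc hw)
  rw [norm_sub_rev]
  refine (norm_g_sub_g_le hc _ _).trans ?_
  rw [integral_sub hi hi', sub_sub_sub_cancel_left]
  have hg : gam c (gInv c w) = 1 / √(1 - ‖w‖ ^ 2 / c ^ 2) := gam_gInv hc hw
  set P' := ∫ τ in Ioi t, along H' f' τ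
  set s := √(1 - ‖w‖ ^ 2 / c ^ 2)
  have b3 : 1 / gam c (gInv c w - P') ≤ 16 / 15 * s := by
    have := inv_gam_le (p := gInv c w) (q := gInv c w - P') hc ?_
    · rwa [hg, one_div_one_div] at this
    · rw [hg, show gInv c w - P' - gInv c w = -P' by abel, norm_neg, mul_one_div]
      exact hQ.trans hQ'
  have : 2 / gam c (gInv c w - P') = 2 * (1 / gam c (gInv c w - P')) := by ring
  rw [this]
  refine mul_le_mul_of_nonneg_right ?_ (norm_nonneg _)
  linarith

/-! ### Free solutions in the tube -/

lemma mem_tube_of_norm_sub_le {q : E n} {t : ℝ} (hr : 0 ≤ r) (h : ‖q - t • v‖ ≤ |t| * (‖v‖ / 8)) :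
    q ∈ tube v x r t ∧ q + x ∈ tube v x r t := by
  have h1 : |t| * (‖v‖ / 8) ≤ r + |t| * (‖v‖ / 8 + r) := by nlinarith [abs_nonneg t]
  refine ⟨⟨0, by simp, ?_⟩, ⟨1, by simp, ?_⟩⟩
  · simpa using h.trans h1
  · rw [one_smul, show q + x - t • v - x = q - t • v by abel]
    exact h.trans h1

/-- A free solution whose asymptotic velocity `w` has the speed of `v` and is close to `v`. -/
structure FreeNear (S : Setting n) (v : E n) (Fl : E n → E n → E n) (w : E n) (ζ : ℝ → E n) :
    Prop where
  free : IsFreeOut S.c Fl w (S.devBound w) ζ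
  norm_eq : ‖w‖ = ‖v‖
  near : ‖w - v‖ ≤ ‖v‖ / 16

namespace FreeNear

variable {w : E n} {ζ : ℝ → E n}

lemma dev_le (Z : FreeNear S v Fl w ζ) (A : Admissible S v x r) (t : ℝ) :
    ‖deriv ζ t - w‖ ≤ ‖v‖ / 16 := by
  rw [← Z.norm_eq]
  exact (Z.free.close t).trans (Setting.devBound_le A.dim (by rw [Z.norm_eq]; exact A.le_speed)
    (by rw [Z.norm_eq]; exact A.speed_lt))

lemma differentiable (Z : FreeNear S v Fl w ζ) : Differentiable ℝ ζ :=
  fun t => (Z.free.solution.hasDerivAt t).differentiableAt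

lemma norm_sub_smul_le (Z : FreeNear S v Fl w ζ) (A : Admissible S v x r) (t : ℝ) :
    ‖ζ t - t • w‖ ≤ ‖v‖ / 16 * |t| := by
  have := norm_sub_le_of_deriv Z.differentiable (Z.dev_le A) t
  rwa [Z.free.origin, sub_zero] at this

lemma norm_sub_line_le (Z : FreeNear S v Fl w ζ) (A : Admissible S v x r) (t : ℝ) :
    ‖ζ t - t • v‖ ≤ |t| * (‖v‖ / 8) := by
  have h1 := Z.norm_sub_smul_le A t
  have h2 : ‖t • (w - v)‖ ≤ |t| * (‖v‖ / 16) := by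
    rw [norm_smul, Real.norm_eq_abs]
    exact mul_le_mul_of_nonneg_left Z.near (abs_nonneg t)
  have h3 := norm_add_le (ζ t - t • w) (t • (w - v))
  rw [show ζ t - t • w + t • (w - v) = ζ t - t • v by rw [smul_sub]; abel] at h3
  linarith

lemma mem_tube (Z : FreeNear S v Fl w ζ) (A : Admissible S v x r) (t : ℝ) :
    ζ t ∈ tube v x r t := (mem_tube_of_norm_sub_le A.r_pos.le (Z.norm_sub_line_le A t)).1

lemma add_mem_tube (Z : FreeNear S v Fl w ζ) (A : Admissible S v x r) (t : ℝ) :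
    ζ t + x ∈ tube v x r t := (mem_tube_of_norm_sub_le A.r_pos.le (Z.norm_sub_line_le A t)).2

lemma s_eq (Z : FreeNear S v Fl w ζ) : S.s w = S.s v := by
  rw [Setting.s, Z.norm_eq, Setting.s]

lemma speed_lt (Z : FreeNear S v Fl w ζ) (A : Admissible S v x r) : ‖w‖ < S.c := by
  rw [Z.norm_eq]; exact A.speed_lt

lemma continuous_along (Z : FreeNear S v Fl w ζ) (Fo : Forces S Fl Fs) :
    Continuous (along Fl ζ) :=
  Fo.long.continuous_along Z.free.solution.continuous Z.free.solution.continuous_deriv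

lemma integrable (Z : FreeNear S v Fl w ζ) (Fo : Forces S Fl Fs) (A : Admissible S v x r) :
    Integrable (along Fl ζ) :=
  Fo.integrable_long A Z.free.solution.continuous Z.free.solution.continuous_deriv
    (Z.mem_tube A) fun t => (Z.free.solution.speed_lt t).le

lemma deriv_eq (Z : FreeNear S v Fl w ζ) (Fo : Forces S Fl Fs) (A : Admissible S v x r) (t : ℝ) :
    deriv ζ t = velOut S.c w Fl ζ t :=
  Z.free.solution.deriv_eq_velOut S.c_pos (Z.speed_lt A) (Z.continuous_along Fo)
    (Z.integrable Fo A).integrableOn Z.free.asymptotic t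

lemma norm_integral_le (Z : FreeNear S v Fl w ζ) (Fo : Forces S Fl Fs) (A : Admissible S v x r)
    (t : ℝ) : ‖∫ τ in Ioi t, along Fl ζ τ‖ ≤ impulse S v r :=
  Fo.norm_integral_long_le A (Z.mem_tube A) (fun t => (Z.free.solution.speed_lt t).le) _

/-- The deflection of a curve from the free solution, in terms of forces. -/
lemma norm_velOut_sub_le (Z : FreeNear S v Fl w ζ) (Fo : Forces S Fl Fs)
    (A : Admissible S v x r) {H : E n → E n → E n} {f : ℝ → E n} {t : ℝ}
    (hi : IntegrableOn (along H f) (Ioi t)) :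
    ‖velOut S.c w H f t - velOut S.c w Fl ζ t‖ ≤
      32 / 15 * S.s v * ‖∫ τ in Ioi t, (along H f τ - along Fl ζ τ)‖ := by
  have := norm_velOut_sub_velOut_le S.c_pos (Z.speed_lt A) hi (Z.integrable Fo A).integrableOn
    (Z.norm_integral_le Fo A t) (by rw [Z.norm_eq]; exact A.impulse_le)
  rwa [Z.norm_eq] at this

/-- The force difference between a trajectory and a free solution. -/
lemma norm_along_sub_le (Z : FreeNear S v Fl w ζ) (Fo : Forces S Fl Fs) (A : Admissible S v x r)
    {f : ℝ → E n} {t : ℝ} (ht : f t ∈ tube v x r t) (hs : ‖deriv f t‖ ≤ S.c) :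
    ‖along (total Fl Fs) f t - along Fl ζ t‖ ≤
      2 * (n * √(n : ℝ)) * S.β2 * rho (1 - r) (kap v r) t ^ (-(S.α + 1 + 1)) * ‖f t - ζ t‖
        + n * S.βl1 / S.c * rho (1 - r) (kap v r) t ^ (-(S.α + 1)) * ‖deriv f t - deriv ζ t‖
        + 2 * n * S.β2 * rho (1 - r) (kap v r) t ^ (-(S.α + 1 + 1)) := by
  have h1 := Fo.long_sub_le A ht (Z.mem_tube A t) hs (Z.free.solution.speed_lt t).le
  have h2 := Fo.short_le A ht hs
  have e : along (total Fl Fs) f t - along Fl ζ t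
      = (Fl (f t) (deriv f t) - Fl (ζ t) (deriv ζ t)) + Fs (f t) (deriv f t) := by
    simp only [along, total]; abel
  rw [e]
  exact (norm_add_le _ _).trans (add_le_add h1 h2)

end FreeNear

/-- The constant of the deflection estimates. -/
noncomputable def defl (S : Setting n) (x : E n) (r : ℝ) : ℝ :=
  8 / 3 * (2 * (n * √(n : ℝ)) * S.β2 * (‖x‖ + r) + 2 * n * S.β2)

lemma Admissible.defl_pos (A : Admissible S v x r) : 0 < defl S x r := by
  have := S.β2_pos
  have := A.r_pos
  have := A.n_pos
  unfold defl; positivity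

/-- The constant of the decay of the deflection velocities. -/
noncomputable def deflVel (S : Setting n) (v x : E n) (r : ℝ) : ℝ :=
  S.s v * defl S x r / ((S.α + 1) * kap v r)

lemma Admissible.deflVel_pos (A : Admissible S v x r) : 0 < deflVel S v x r := by
  have := A.s_pos
  have := A.defl_pos
  have := A.kap_pos
  have := S.α_pos
  unfold deflVel; positivity

lemma deflVel_neg : deflVel S (-v) x r = deflVel S v x r := by
  simp [deflVel, Setting.s, kap_neg]

/-- The bound of the deflections `y_-` and `y_+`. -/
noncomputable def deflBound (S : Setting n) (v x : E n) (r : ℝ) : ℝ :=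
  deflVel S v x r * ((1 - r) ^ (-S.α) / (S.α * kap v r))

lemma Admissible.deflBound_pos (A : Admissible S v x r) : 0 < deflBound S v x r := by
  have := A.one_sub_pos
  have := A.kap_pos
  have := S.α_pos
  have := A.deflVel_pos
  unfold deflBound; positivity

lemma Admissible.smallness_ge (A : Admissible S v x r) :
    (n : ℝ) ^ 2 * S.s v * max S.βl1 S.β2 * ((1 - r) ^ (-S.α) / (S.α * kap v r))
      ≤ smallness S v r := by
  have h1 := A.one_sub_pos
  have h2 := A.kap_pos
  have h3 := S.α_pos
  have h4 := A.s_pos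
  have h5 := A.max_pos
  have h6 := A.n_pos
  have h : (1 - r) ^ (-S.α) ≤ (1 - r) ^ (-(S.α + 1)) :=
    Real.rpow_le_rpow_of_exponent_ge h1 (by linarith [A.r_pos]) (by linarith)
  rw [smallness, div_mul_eq_mul_div, mul_div_assoc]
  gcongr

/-- Smallness of the coefficients of the deflection estimate. -/
lemma Admissible.coeff_le (A : Admissible S v x r) :
    2 * (n * √(n : ℝ)) * S.β2 * S.s v * ((1 - r) ^ (-S.α) / (S.α * kap v r)) ≤ 5 / 84 * kap v r ∧
    n * S.βl1 / S.c * S.s v * ((1 - r) ^ (-S.α) / (S.α * kap v r)) ≤ 1 / 48 := by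
  have h0 := A.smallness_ge
  have h1 := A.one_sub_pos
  have h2 := A.kap_pos
  have h3 := S.α_pos
  have h4 := A.s_pos
  have h5 := A.max_pos
  have h6 := A.n_pos
  have h7 := A.smallness_le_kap
  have h8 := A.smallness_le_c
  have hc := S.c_pos
  obtain ⟨-, h75, hN⟩ := Setting.one_le_sqrt_two_le A.dim
  have hn : (2 : ℝ) ≤ n := by exact_mod_cast A.dim
  have hm1 : S.βl1 ≤ max S.βl1 S.β2 := le_max_left _ _
  have hm2 : S.β2 ≤ max S.βl1 S.β2 := le_max_right _ _
  set m := max S.βl1 S.β2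
  set Q := (1 - r) ^ (-S.α) / (S.α * kap v r)
  have hQ : 0 < Q := by positivity
  set N := √(n : ℝ)
  have hN0 : 0 < N := by linarith
  constructor
  · calc 2 * (n * N) * S.β2 * S.s v * Q ≤ 2 * (n * N) * m * S.s v * Q := by gcongr
      _ = 2 / N * ((n : ℝ) ^ 2 * S.s v * m * Q) := by
        have : (n : ℝ) ^ 2 = n * N * N := by rw [← hN]; ring
        rw [this]; field_simp
      _ ≤ 2 / (7 / 5) * (kap v r / 24) := by gcongr; exact h0.trans h7
      _ = _ := by ring
  · calc n * S.βl1 / S.c * S.s v * Q ≤ n * m / S.c * S.s v * Q := by gcongr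
      _ = 1 / (n * S.c) * ((n : ℝ) ^ 2 * S.s v * m * Q) := by field_simp
      _ ≤ 1 / (2 * S.c) * (S.c / 24) := by gcongr; exact h0.trans h8
      _ = _ := by field_simp; norm_num

/-- Decay of the deflection of a trajectory from a free solution with the same asymptotic
velocity at `+∞`. -/
theorem FreeNear.norm_deflection_le {w : E n} {ζ f : ℝ → E n} (Z : FreeNear S v Fl w ζ)
    (Fo : Forces S Fl Fs) (A : Admissible S v x r) (hf : ContDiff ℝ 1 f)
    (ht : ∀ t, f t ∈ tube v x r t) (hs : ∀ t, ‖deriv f t‖ ≤ S.c)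
    (hd : ∀ t, deriv f t = velOut S.c w (total Fl Fs) f t) (h0 : ‖f 0‖ ≤ ‖x‖ + r) :
    ∀ t ≥ 0, ‖deriv f t - deriv ζ t‖ ≤
      deflVel S v x r * rho (1 - r) (kap v r) t ^ (-(S.α + 1)) := by
  have h1 := A.one_sub_pos
  have h2 := A.kap_pos
  have h3 := S.α_pos
  have h4 := A.s_pos
  have hβ := S.β2_pos
  have hβ1 := S.βl1_pos
  have hc := S.c_pos
  have hr := A.r_pos
  have hfd : Differentiable ℝ f := hf.differentiable (by norm_num)
  have hfc : Continuous (deriv f) := hf.continuous_deriv (by norm_num)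
  have hu : ∀ t, deriv (fun t => f t - ζ t) t = deriv f t - deriv ζ t := fun t =>
    deriv_fun_sub (hfd t) (Z.differentiable t)
  obtain ⟨c1, c2⟩ := A.coeff_le
  set k₁ := 2 * (n * √(n : ℝ)) * S.β2
  set k₂ := n * S.βl1 / S.c
  set Q := (1 - r) ^ (-S.α) / (S.α * kap v r) with hQ
  have hQ0 : 0 < Q := by positivity
  have hk₁ : 0 ≤ k₁ := by positivity
  have hk₂ : 0 ≤ k₂ := by positivity
  have hint := (Fo.integrable_total A hf.continuous hfc ht hs)
  have key := norm_deriv_le_of_integral_bound (a := 1 - r) (k := kap v r) (α := S.α)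
    (B₀ := ‖x‖ + r) (Λ := 32 / 15 * S.s v) (k₀ := 2 * n * S.β2) (k₁ := k₁)
    (k₂ := k₂) (M := 2 * S.c) h1 h2 h3 (by positivity) (by positivity)
    (by positivity) hk₁ hk₂
    (u := fun t => f t - ζ t) (h := fun t => along (total Fl Fs) f t - along Fl ζ t)
    (hfd.sub Z.differentiable) ?_ ?_ ?_ ?_ ?_ ?_ ?_
  · intro t ht0
    have := key t ht0
    rw [hu] at this
    refine this.trans (le_of_eq ?_)
    rw [deflVel, defl]; ring
  · rw [show deriv (fun t => f t - ζ t) = fun t => deriv f t - deriv ζ t from funext hu]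
    exact hfc.sub Z.free.solution.continuous_deriv
  · simpa [Z.free.origin] using h0
  · intro t _
    rw [hu]
    linarith [_root_.norm_sub_le (deriv f t) (deriv ζ t), hs t, (Z.free.solution.speed_lt t).le]
  · intro t _
    rw [hu, hd, Z.deriv_eq Fo A]
    exact Z.norm_velOut_sub_le Fo A hint.integrableOn
  · intro t _
    rw [hu]
    exact Z.norm_along_sub_le Fo A (ht t) (hs t)
  · have e : 32 / 15 * S.s v * ((k₁ / kap v r + k₂) * Q)
        = 32 / 15 * ((k₁ * S.s v * Q) / kap v r + k₂ * S.s v * Q) := by ring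
    rw [e]
    have : k₁ * S.s v * Q / kap v r ≤ 5 / 84 := by rwa [div_le_iff₀ h2]
    linarith
  · have e : 32 / 15 * S.s v * ((k₁ * Q + k₂ * (1 - r) ^ (-S.α)) / ((S.α + 1) * kap v r))
        = 32 / 15 * (1 / (S.α + 1) * ((k₁ * S.s v * Q) / kap v r)
          + S.α / (S.α + 1) * (k₂ * S.s v * Q)) := by
      rw [hQ]; field_simp
    rw [e]
    have i1 : k₁ * S.s v * Q / kap v r ≤ 5 / 84 := by rwa [div_le_iff₀ h2]
    have i2 : 1 / (S.α + 1) ≤ 1 := by rw [div_le_one (by linarith)]; linarith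
    have i3 : S.α / (S.α + 1) ≤ 1 := by rw [div_le_one (by linarith)]; linarith
    calc _ ≤ (32 / 15 * (1 * (5 / 84) + 1 * (1 / 48)) : ℝ) := by gcongr
      _ ≤ 1 / 5 := by norm_num

/-- Integrability of the deflection velocity when the deflection is known to be bounded and its
velocity to decay; this suffices to differentiate the integral equation of the trajectory. -/
lemma FreeNear.norm_velOut_sub_le_of_bounded {w : E n} {ζ f : ℝ → E n} (Z : FreeNear S v Fl w ζ)
    (Fo : Forces S Fl Fs) (A : Admissible S v x r) (hf : ContDiff ℝ 1 f)
    (ht : ∀ t, f t ∈ tube v x r t) (hs : ∀ t, ‖deriv f t‖ ≤ S.c) {B C : ℝ}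
    (hu : ∀ t > 0, ‖f t - ζ t‖ ≤ B)
    (hu' : ∀ t > 0, ‖deriv f t - deriv ζ t‖ ≤ C * rho (1 - r) (kap v r) t ^ (-1 : ℝ)) :
    ∃ D, ∀ t ≥ 0, ‖velOut S.c w (total Fl Fs) f t - velOut S.c w Fl ζ t‖ ≤
      D * rho (1 - r) (kap v r) t ^ (-(S.α + 1)) := by
  have h3 := S.α_pos
  have hβ := S.β2_pos
  have hβ1 := S.βl1_pos
  have hc := S.c_pos
  have h4 := A.s_pos
  set K := 2 * (n * √(n : ℝ)) * S.β2 * B + n * S.βl1 / S.c * C + 2 * n * S.β2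
  refine ⟨32 / 15 * S.s v * (K / ((S.α + 1) * kap v r)), fun t h0 => ?_⟩
  have hint := (Fo.integrable_total A hf.continuous (hf.continuous_deriv (by norm_num)) ht hs)
  refine (Z.norm_velOut_sub_le Fo A hint.integrableOn).trans ?_
  have := norm_integral_Ioi_le_rho' A.one_sub_pos A.kap_pos (p := S.α + 1) (by linarith) h0
    (C := K) (h := fun τ => along (total Fl Fs) f τ - along Fl ζ τ) (fun τ hτ => ?_)
  · calc _ ≤ 32 / 15 * S.s v * (K * (rho (1 - r) (kap v r) t ^ (-(S.α + 1))
          / ((S.α + 1) * kap v r))) := by gcongr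
      _ = _ := by ring
  · have hτ0 : 0 < τ := h0.trans_lt hτ
    have hρ := A.rho_pos τ
    refine (Z.norm_along_sub_le Fo A (ht τ) (hs τ)).trans ?_
    have e : rho (1 - r) (kap v r) τ ^ (-(S.α + 1 + 1))
        = rho (1 - r) (kap v r) τ ^ (-(S.α + 1)) * rho (1 - r) (kap v r) τ ^ (-1 : ℝ) := by
      rw [← Real.rpow_add hρ]; congr 1; ring
    calc _ ≤ 2 * (n * √(n : ℝ)) * S.β2 * rho (1 - r) (kap v r) τ ^ (-(S.α + 1 + 1)) * B
        + n * S.βl1 / S.c * rho (1 - r) (kap v r) τ ^ (-(S.α + 1))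
          * (C * rho (1 - r) (kap v r) τ ^ (-1 : ℝ))
        + 2 * n * S.β2 * rho (1 - r) (kap v r) τ ^ (-(S.α + 1 + 1)) := by
          gcongr
          · exact hu τ hτ0
          · exact hu' τ hτ0
      _ = _ := by rw [e]; ring

end RelScat

namespace RelScat

variable {n : ℕ} {S : Setting n} {v x : E n} {r : ℝ} {y : ℝ → E n}

/-! ### The trajectory of a fixed point -/

/-- A fixed point `y` of the integral operator for the data `(v, x)`. -/
structure FixedPoint (S : Setting n) (v x : E n) (r : ℝ) (y : ℝ → E n) : Prop where
  adm : Admissible S v x r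
  mem : S.MemM r v y
  fixed : ∀ t, S.A v x y t = y t

lemma Admissible.isFree_zMinus (A : Admissible S v x r) : S.IsFree atBot v (S.zMinus v) :=
  Classical.epsilon_spec (Setting.existsUnique_isFree_atBot A.dim A.le_speed A.speed_lt).exists

/-- The reversed free solution. -/
lemma Admissible.freeNear_in (A : Admissible S v x r) :
    FreeNear S (-v) (revForce S.Fl) (-v) (fun t => S.zMinus v (-t)) :=
  ⟨Setting.isFree_atBot_iff.1 A.isFree_zMinus, rfl, by rw [sub_self, norm_zero]; positivity⟩

lemma F_eq_total (S : Setting n) : S.F = total S.Fl S.Fs := rfl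

lemma revForce_total (Fl Fs : E n → E n → E n) :
    revForce (total Fl Fs) = total (revForce Fl) (revForce Fs) := rfl

namespace Admissible

lemma zMinus_zero (A : Admissible S v x r) : S.zMinus v 0 = 0 := A.isFree_zMinus.origin

lemma hasDerivAt_zMinus (A : Admissible S v x r) (t : ℝ) :
    HasDerivAt (S.zMinus v) (deriv (S.zMinus v) t) t := A.isFree_zMinus.solution.hasDerivAt t

lemma norm_zMinus_sub_le (A : Admissible S v x r) (t : ℝ) :
    ‖S.zMinus v t - t • v‖ ≤ ‖v‖ / 16 * |t| := by
  have := A.freeNear_in.norm_sub_smul_le A.neg (-t)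
  simpa using this

lemma deriv_zMinus (A : Admissible S v x r) (t : ℝ) :
    deriv (S.zMinus v) t = velIn S.c v S.Fl (S.zMinus v) t := by
  have := A.freeNear_in.deriv_eq (S.forces A.dim).rev A.neg (-t)
  rw [deriv_comp_neg', neg_neg] at this
  rw [velIn_eq_neg_velOut, ← this, neg_neg]

end Admissible

namespace FixedPoint

lemma contDiff_traj (Y : FixedPoint S v x r y) : ContDiff ℝ 1 (S.traj v x y) := by
  have h := Y.adm.isFree_zMinus.solution.smooth.of_le (m := 1) (by norm_num)
  exact (h.add contDiff_const).add Y.mem.smooth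

lemma hasDerivAt_y (Y : FixedPoint S v x r y) (t : ℝ) : HasDerivAt y (deriv y t) t :=
  (Y.mem.smooth.differentiable (by norm_num) t).hasDerivAt

lemma deriv_traj (Y : FixedPoint S v x r y) (t : ℝ) :
    deriv (S.traj v x y) t = deriv (S.zMinus v) t + deriv y t :=
  (((Y.adm.hasDerivAt_zMinus t).add_const x).add (Y.hasDerivAt_y t)).deriv

lemma speed_le (Y : FixedPoint S v x r y) (t : ℝ) : ‖deriv (S.traj v x y) t‖ ≤ S.c := by
  rw [Y.deriv_traj]; exact Y.mem.speed_le t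

lemma norm_deriv_le (Y : FixedPoint S v x r y) (t : ℝ) : ‖deriv y t‖ ≤ r := by
  have hcl : IsClosed {t | ‖deriv y t‖ ≤ r} :=
    isClosed_le (Y.mem.smooth.continuous_deriv (by norm_num)).norm continuous_const
  have hsub : ({0}ᶜ : Set ℝ) ⊆ {t | ‖deriv y t‖ ≤ r} := by
    intro t ht
    rcases lt_or_gt_of_ne (show t ≠ 0 from ht) with h | h
    · refine le_trans ?_ (Y.mem.deriv_neg t h)
      exact le_mul_of_one_le_left (norm_nonneg _) (le_max_left _ _)
    · exact Y.mem.deriv_pos t h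
  have := hcl.closure_subset_iff.2 hsub
  rw [(dense_compl_singleton (0 : ℝ)).closure_eq] at this
  exact this (mem_univ t)

lemma norm_deriv_le_rho (Y : FixedPoint S v x r y) {t : ℝ} (ht : t < 0) :
    ‖deriv y t‖ ≤ r * rho (1 - r) (kap v r) t ^ (-1 : ℝ) := by
  have hρ := Y.adm.rho_pos t
  rw [Real.rpow_neg_one, ← div_eq_mul_inv, le_div_iff₀ hρ, mul_comm]
  refine le_trans ?_ (Y.mem.deriv_neg t ht)
  exact mul_le_mul_of_nonneg_right (le_max_right _ _) (norm_nonneg _)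

lemma norm_le (Y : FixedPoint S v x r y) {t : ℝ} (ht : t ≤ 0) : ‖y t‖ ≤ r := by
  have hcl : IsClosed {t | ‖y t‖ ≤ r} :=
    isClosed_le Y.mem.smooth.continuous.norm continuous_const
  have hsub : Iio (0 : ℝ) ⊆ {t | ‖y t‖ ≤ r} := fun t ht => Y.mem.neg t ht
  have := hcl.closure_subset_iff.2 hsub
  rw [closure_Iio] at this
  exact this ht

lemma norm_le' (Y : FixedPoint S v x r y) (t : ℝ) : ‖y t‖ ≤ r + |t| * r := by
  have h1 := norm_sub_le_of_deriv (fun t => (Y.hasDerivAt_y t).differentiableAt) (w := 0) (R := r)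
    (fun t => by simpa using Y.norm_deriv_le t) t
  rw [smul_zero, sub_zero] at h1
  have h2 := norm_add_le (y t - y 0) (y 0)
  rw [sub_add_cancel] at h2
  linarith [Y.norm_le (le_refl 0)]

lemma norm_traj_sub_le (Y : FixedPoint S v x r y) (t : ℝ) :
    ‖S.traj v x y t - t • v - x‖ ≤ r + |t| * (‖v‖ / 8 + r) := by
  rw [show S.traj v x y t - t • v - x = (S.zMinus v t - t • v) + y t by
    simp only [Setting.traj]; abel]
  have h1 := Y.adm.norm_zMinus_sub_le t
  have h2 := Y.norm_le' t
  have h3 := norm_add_le (S.zMinus v t - t • v) (y t)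
  nlinarith [mul_nonneg (abs_nonneg t) (norm_nonneg v)]

lemma mem_tube (Y : FixedPoint S v x r y) (t : ℝ) : S.traj v x y t ∈ tube v x r t :=
  ⟨1, by simp, by rw [one_smul]; exact Y.norm_traj_sub_le t⟩

lemma mem_tube_rev (Y : FixedPoint S v x r y) (t : ℝ) :
    S.traj v x y (-t) ∈ tube (-v) x r t := tube_neg.2 (Y.mem_tube (-t))

lemma continuous_deriv_traj (Y : FixedPoint S v x r y) : Continuous (deriv (S.traj v x y)) :=
  Y.contDiff_traj.continuous_deriv (by norm_num)

lemma continuous_along (Y : FixedPoint S v x r y) : Continuous (along S.F (S.traj v x y)) :=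
  (S.forces Y.adm.dim).continuous_along Y.contDiff_traj.continuous Y.continuous_deriv_traj

lemma integrable (Y : FixedPoint S v x r y) : Integrable (along S.F (S.traj v x y)) :=
  (S.forces Y.adm.dim).integrable_total Y.adm Y.contDiff_traj.continuous Y.continuous_deriv_traj
    Y.mem_tube Y.speed_le

lemma norm_integral_le (Y : FixedPoint S v x r y) (s : Set ℝ) :
    ‖∫ t in s, along S.F (S.traj v x y) t‖ ≤ impulse S v r :=
  (S.forces Y.adm.dim).norm_integral_total_le Y.adm Y.mem_tube Y.speed_le s

lemma hasDerivAt_momentum (Y : FixedPoint S v x r y) (t : ℝ) :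
    HasDerivAt (fun t => gInv S.c v + ∫ τ in Iic t, along S.F (S.traj v x y) τ)
      (along S.F (S.traj v x y) t) t :=
  (hasDerivAt_integral_Iic Y.continuous_along Y.integrable.integrableOn t).const_add _

lemma continuous_velIn (Y : FixedPoint S v x r y) :
    Continuous (velIn S.c v S.F (S.traj v x y)) :=
  contDiff_g (k := 0) |>.continuous.comp
    (continuous_iff_continuousAt.2 fun t => (Y.hasDerivAt_momentum t).continuousAt)

lemma continuous_Adot (Y : FixedPoint S v x r y) : Continuous (S.Adot v x y) := by
  refine Y.continuous_velIn.sub ?_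
  rw [show velIn S.c v S.Fl (S.zMinus v) = deriv (S.zMinus v) from
    funext fun t => (Y.adm.deriv_zMinus t).symm]
  exact Y.adm.isFree_zMinus.solution.continuous_deriv

lemma Adot_eq (v x : E n) (y : ℝ → E n) (t : ℝ) : S.Adot v x y t =
    -(velOut S.c (-v) (total (revForce S.Fl) (revForce S.Fs)) (fun t => S.traj v x y (-t)) (-t)
      - velOut S.c (-v) (revForce S.Fl) (fun t => S.zMinus v (-t)) (-t)) := by
  rw [Setting.Adot, velIn_eq_neg_velOut, velIn_eq_neg_velOut, F_eq_total, revForce_total]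
  abel

lemma integrableOn_Adot (Y : FixedPoint S v x r y) : IntegrableOn (S.Adot v x y) (Iic 0) := by
  have hB : ∀ t > 0, ‖S.traj v x y (-t) - S.zMinus v (-t)‖ ≤ ‖x‖ + r := fun t ht => by
    have : S.traj v x y (-t) - S.zMinus v (-t) = x + y (-t) := by
      simp only [Setting.traj]; abel
    rw [this]
    exact (norm_add_le _ _).trans (by linarith [Y.norm_le (show -t ≤ 0 by linarith)])
  have hC : ∀ t > 0, ‖deriv (fun t => S.traj v x y (-t)) t - deriv (fun t => S.zMinus v (-t)) t‖
      ≤ r * rho (1 - r) (kap (-v) r) t ^ (-1 : ℝ) := fun t ht => by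
    rw [deriv_comp_neg', deriv_comp_neg', Y.deriv_traj, neg_sub_neg,
      show deriv (S.zMinus v) (-t) - (deriv (S.zMinus v) (-t) + deriv y (-t)) = -deriv y (-t) by
        abel, norm_neg, kap_neg, ← rho_neg]
    exact Y.norm_deriv_le_rho (by linarith)
  obtain ⟨D, hD⟩ := Y.adm.freeNear_in.norm_velOut_sub_le_of_bounded (S.forces Y.adm.dim).rev
    Y.adm.neg (f := fun t => S.traj v x y (-t)) (Y.contDiff_traj.comp contDiff_neg)
    Y.mem_tube_rev (fun t => by rw [deriv_comp_neg', norm_neg]; exact Y.speed_le _) hB hC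
  refine integrableOn_Iic_of_le_rho (C := D) Y.adm.one_sub_pos Y.adm.kap_pos S.α_pos
    Y.continuous_Adot fun t ht => ?_
  rw [Adot_eq, norm_neg]
  have := hD (-t) (by linarith)
  rwa [rho_neg, kap_neg] at this

lemma deriv_y (Y : FixedPoint S v x r y) (t : ℝ) : deriv y t = S.Adot v x y t := by
  have h := hasDerivAt_integral_Iic Y.continuous_Adot Y.integrableOn_Adot t
  have e : (fun t => ∫ τ in Iic t, S.Adot v x y τ) = y := funext Y.fixed
  rw [e] at h
  exact h.deriv

lemma deriv_traj_eq_velIn (Y : FixedPoint S v x r y) (t : ℝ) :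
    deriv (S.traj v x y) t = velIn S.c v S.F (S.traj v x y) t := by
  rw [Y.deriv_traj, Y.deriv_y, Setting.Adot, ← Y.adm.deriv_zMinus]; abel

lemma isSolution (Y : FixedPoint S v x r y) : IsSolution S.c S.F (S.traj v x y) := by
  refine isSolution_of_momentum S.c_pos (fun t => ?_) Y.hasDerivAt_momentum Y.continuous_along
  have := (Y.contDiff_traj.differentiable (by norm_num) t).hasDerivAt
  rwa [Y.deriv_traj_eq_velIn] at this

/-! ### Conservation of energy -/

lemma hasDerivAt_gam {c : ℝ} {P : ℝ → E n} {P' : E n} {t : ℝ}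
    (h : HasDerivAt P P' t) : HasDerivAt (fun t => gam c (P t))
      (inner ℝ (g c (P t)) P' / c ^ 2) t := by
  have h1 : HasDerivAt (fun t => 1 + ‖P t‖ ^ 2 / c ^ 2) (2 * inner ℝ (P t) P' / c ^ 2) t :=
    (h.norm_sq.div_const _).const_add 1
  have h2 := h1.sqrt (by positivity)
  refine h2.congr_deriv ?_
  rw [g_eq, inner_smul_left, gam]
  simp only [conj_trivial]
  ring

lemma hasDerivAt_comp_potential {W : E n → ℝ} (hW : ContDiff ℝ 2 W) {f : ℝ → E n} {f' : E n}
    {t : ℝ} (hf : HasDerivAt f f' t) : HasDerivAt (fun t => W (f t)) (fderiv ℝ W (f t) f') t :=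
  ((hW.differentiable (by norm_num) (f t)).hasFDerivAt).comp_hasDerivAt t hf

/-- A decaying potential tends to zero along a curve in the tube. -/
lemma tendsto_potential {W : E n → ℝ} {b γ : ℝ} (A : Admissible S v x r) (hγ : 0 < γ)
    (hb : 0 ≤ b) (hW : ∀ q, |W q| ≤ b * (1 + ‖q‖) ^ (-γ)) {f : ℝ → E n} {l : Filter ℝ}
    (hl : Tendsto (fun t : ℝ => |t|) l atTop) (hf : ∀ᶠ t in l, f t ∈ tube v x r t) :
    Tendsto (fun t => W (f t)) l (𝓝 0) := by
  have h1 : Tendsto (fun t => rho (1 - r) (kap v r) t) l atTop :=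
    tendsto_atTop_add_const_left _ _ (hl.const_mul_atTop A.kap_pos)
  have h2 : Tendsto (fun t => b * rho (1 - r) (kap v r) t ^ (-γ)) l (𝓝 (b * 0)) :=
    ((tendsto_rpow_neg_atTop hγ).comp h1).const_mul b
  rw [mul_zero] at h2
  refine squeeze_zero_norm' ?_ h2
  filter_upwards [hf] with t ht
  refine (hW _).trans (mul_le_mul_of_nonneg_left ?_ hb)
  exact rpow_neg_anti (A.rho_pos t) (rho_le_of_mem_tube A.orth ht) hγ.le

/-- The outgoing momentum. -/
lemma gInv_a (v x : E n) (y : ℝ → E n) : gInv S.c (S.a v x y)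
    = gInv S.c v + ∫ τ, along S.F (S.traj v x y) τ := gInv_g S.c_pos _

/-- By conservation of energy the Lorentz factor is the same at both ends of the trajectory. -/
lemma gam_out_eq (Y : FixedPoint S v x r y) :
    gam S.c (gInv S.c (S.a v x y)) = gam S.c (gInv S.c v) := by
  have hc := S.c_pos
  set X := S.traj v x y with hX
  set P : ℝ → E n := fun t => gInv S.c v + ∫ τ in Iic t, along S.F X τ with hP
  -- the energy divided by `c²`
  set e : ℝ → ℝ := fun t => gam S.c (P t) + (S.Vl (X t) + S.Vs (X t)) / S.c ^ 2 with he
  have hXd : ∀ t, HasDerivAt X (g S.c (P t)) t := fun t => by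
    have := (Y.contDiff_traj.differentiable (by norm_num) t).hasDerivAt
    rwa [Y.deriv_traj_eq_velIn] at this
  have hed : ∀ t, HasDerivAt e 0 t := fun t => by
    have h1 := hasDerivAt_gam (c := S.c) (Y.hasDerivAt_momentum t)
    have h2 := ((hasDerivAt_comp_potential S.Vl_smooth (hXd t)).add
      (hasDerivAt_comp_potential S.Vs_smooth (hXd t))).div_const (S.c ^ 2)
    refine (h1.add h2).congr_deriv ?_
    have hw1 := (S.isForce_Fl Y.adm.dim).work (X t) (g S.c (P t))
    have hw2 := (S.isForce_Fs Y.adm.dim).work (X t) (g S.c (P t))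
    have hal : along S.F X t = S.Fl (X t) (g S.c (P t)) + S.Fs (X t) (g S.c (P t)) := by
      rw [along, (hXd t).deriv]; rfl
    rw [hal, inner_add_right, hw1, hw2]
    ring
  have hconst : ∀ t, e t = e 0 := fun t =>
    is_const_of_deriv_eq_zero (fun t => (hed t).differentiableAt) (fun t => (hed t).deriv) t 0
  have hα := S.α_pos
  have hpot : ∀ l : Filter ℝ, Tendsto (fun t : ℝ => |t|) l atTop →
      Tendsto (fun t => (S.Vl (X t) + S.Vs (X t)) / S.c ^ 2) l (𝓝 0) := fun l hl => by
    have h1 := tendsto_potential Y.adm hα S.βl0_pos.le S.Vl_decay.zero hl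
      (Eventually.of_forall Y.mem_tube)
    have h2 := tendsto_potential Y.adm (by linarith) S.βs1_pos.le S.Vs_decay.zero hl
      (Eventually.of_forall Y.mem_tube)
    simpa using (h1.add h2).div_const (S.c ^ 2)
  have hgam : Continuous (gam S.c : E n → ℝ) := by unfold gam; fun_prop
  have hbot : Tendsto e atBot (𝓝 (gam S.c (gInv S.c v))) := by
    have h1 := (tendsto_integral_Iic Y.integrable.integrableOn).const_add (gInv S.c v)
    rw [add_zero] at h1
    have := (hgam.continuousAt.tendsto.comp h1).add (hpot atBot tendsto_abs_atBot_atTop)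
    rwa [add_zero] at this
  have htop : Tendsto e atTop (𝓝 (gam S.c (gInv S.c (S.a v x y)))) := by
    have h1 : Tendsto P atTop (𝓝 (gInv S.c (S.a v x y))) := by
      have h0 := ((tendsto_integral_Ioi Y.integrable.integrableOn).const_sub
        (∫ τ, along S.F X τ)).const_add (gInv S.c v)
      rw [sub_zero, ← gInv_a] at h0
      refine h0.congr fun t => ?_
      rw [hP, ← integral_Iic_eq_sub Y.integrable]
    have := (hgam.continuousAt.tendsto.comp h1).add (hpot atTop tendsto_abs_atTop_atTop)
    rwa [add_zero] at this
  have c1 := tendsto_nhds_unique hbot (by rw [show e = fun _ => e 0 from funext hconst]; exact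
    tendsto_const_nhds)
  have c2 := tendsto_nhds_unique htop (by rw [show e = fun _ => e 0 from funext hconst]; exact
    tendsto_const_nhds)
  rw [c1, c2]

/-- Since the speeds at both ends agree, the velocity transfer is exactly proportional to the
momentum transfer. -/
lemma asc_eq (Y : FixedPoint S v x r y) :
    S.asc v x y = S.s v • ∫ τ, along S.F (S.traj v x y) τ := by
  have hs := Y.adm.s_pos
  have h := Y.gam_out_eq
  rw [gam_gInv S.c_pos Y.adm.speed_lt, gInv_a] at h
  rw [Setting.asc, Setting.a, g_eq, h, one_div_one_div]
  change S.s v • (_ + _) - v = _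
  rw [smul_add, gInv]
  change S.s v • (1 / S.s v) • v + _ - v = _
  rw [smul_smul, mul_one_div, div_self hs.ne', one_smul]
  abel

lemma norm_a (Y : FixedPoint S v x r y) : ‖S.a v x y‖ = ‖v‖ := by
  have h := Y.gam_out_eq
  have e1 := gam_sq (c := S.c) (gInv S.c (S.a v x y))
  have e2 := gam_sq (c := S.c) (gInv S.c v)
  have hc := S.c_pos
  rw [h, e2] at e1
  have e3 : ‖gInv S.c v‖ = ‖gInv S.c (S.a v x y)‖ := by
    rw [← sq_eq_sq₀ (norm_nonneg _) (norm_nonneg _)]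
    field_simp at e1
    linarith
  have e4 : S.a v x y = g S.c (gInv S.c (S.a v x y)) := by rw [gInv_a]; rfl
  have e5 : v = g S.c (gInv S.c v) := (g_gInv S.c_pos Y.adm.speed_lt).symm
  rw [e4, norm_g, h, ← e3, ← norm_g, ← e5]

lemma norm_asc_le_impulse (Y : FixedPoint S v x r y) : ‖S.asc v x y‖ ≤ S.s v * impulse S v r := by
  have := Y.norm_integral_le univ
  rw [setIntegral_univ] at this
  rw [Y.asc_eq, norm_smul, Real.norm_of_nonneg Y.adm.s_pos.le]
  exact mul_le_mul_of_nonneg_left this Y.adm.s_pos.le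

lemma le_speed_a (Y : FixedPoint S v x r y) : S.muL ≤ ‖S.a v x y‖ := by
  rw [Y.norm_a]; exact Y.adm.le_speed

lemma speed_a_lt (Y : FixedPoint S v x r y) : ‖S.a v x y‖ < S.c := by
  rw [Y.norm_a]; exact Y.adm.speed_lt

lemma isFree_zPlus (Y : FixedPoint S v x r y) :
    S.IsFree atTop (S.a v x y) (S.zPlus (S.a v x y)) :=
  Classical.epsilon_spec
    (Setting.existsUnique_isFree_atTop Y.adm.dim Y.le_speed_a Y.speed_a_lt).exists

lemma freeNear_out (Y : FixedPoint S v x r y) :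
    FreeNear S v S.Fl (S.a v x y) (S.zPlus (S.a v x y)) :=
  ⟨Setting.isFree_atTop_iff.1 Y.isFree_zPlus, Y.norm_a,
    Y.norm_asc_le_impulse.trans Y.adm.s_mul_impulse_le⟩

lemma deriv_traj_eq_velOut (Y : FixedPoint S v x r y) (t : ℝ) :
    deriv (S.traj v x y) t = velOut S.c (S.a v x y) S.F (S.traj v x y) t := by
  rw [Y.deriv_traj_eq_velIn, velIn, velOut, gInv_a, integral_Iic_eq_sub Y.integrable]
  congr 1; abel

/-! ### Decay of the deflections -/

lemma norm_traj_zero_le (Y : FixedPoint S v x r y) : ‖S.traj v x y 0‖ ≤ ‖x‖ + r := by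
  rw [Setting.traj, Y.adm.zMinus_zero, zero_add]
  exact (norm_add_le _ _).trans (by linarith [Y.norm_le (le_refl 0)])

/-- The incoming deflection is an outgoing one for the reversed motion. -/
theorem norm_deriv_y_le (Y : FixedPoint S v x r y) {t : ℝ} (ht : t ≤ 0) :
    ‖deriv y t‖ ≤ deflVel S v x r
      * rho (1 - r) (kap v r) t ^ (-(S.α + 1)) := by
  have := Y.adm.freeNear_in.norm_deflection_le (S.forces Y.adm.dim).rev Y.adm.neg
    (f := fun t => S.traj v x y (-t)) (Y.contDiff_traj.comp contDiff_neg) Y.mem_tube_rev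
    (fun t => by rw [deriv_comp_neg', norm_neg]; exact Y.speed_le _) (fun t => ?_)
    (by simpa using Y.norm_traj_zero_le) (-t) (by linarith)
  · rw [deriv_comp_neg', deriv_comp_neg', Y.deriv_traj, neg_neg, neg_sub_neg, kap_neg, rho_neg,
      show deriv (S.zMinus v) t - (deriv (S.zMinus v) t + deriv y t) = -deriv y t by abel,
      norm_neg, deflVel_neg] at this
    exact this
  · have h := velIn_eq_neg_velOut (c := S.c) (H := S.F) v (S.traj v x y) (-t)
    rw [neg_neg, F_eq_total, revForce_total, ← F_eq_total] at h
    rw [deriv_comp_neg', Y.deriv_traj_eq_velIn, h, neg_neg]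

lemma yPlusIntegrand_eq (Y : FixedPoint S v x r y) (t : ℝ) : S.yPlusIntegrand v x y t
    = deriv (S.traj v x y) t - deriv (S.zPlus (S.a v x y)) t := by
  rw [Setting.yPlusIntegrand, ← Y.deriv_traj_eq_velOut,
    ← Y.freeNear_out.deriv_eq (S.forces Y.adm.dim) Y.adm]

lemma continuous_yPlusIntegrand (Y : FixedPoint S v x r y) :
    Continuous (S.yPlusIntegrand v x y) := by
  rw [show S.yPlusIntegrand v x y = _ from funext Y.yPlusIntegrand_eq]
  exact Y.continuous_deriv_traj.sub Y.freeNear_out.free.solution.continuous_deriv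

theorem norm_yPlusIntegrand_le (Y : FixedPoint S v x r y) {t : ℝ} (ht : 0 ≤ t) :
    ‖S.yPlusIntegrand v x y t‖ ≤ deflVel S v x r
      * rho (1 - r) (kap v r) t ^ (-(S.α + 1)) := by
  rw [Y.yPlusIntegrand_eq]
  exact Y.freeNear_out.norm_deflection_le (S.forces Y.adm.dim) Y.adm Y.contDiff_traj Y.mem_tube
    Y.speed_le Y.deriv_traj_eq_velOut Y.norm_traj_zero_le t ht

lemma integrableOn_yPlusIntegrand (Y : FixedPoint S v x r y) :
    IntegrableOn (S.yPlusIntegrand v x y) (Ioi 0) :=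
  integrableOn_Ioi_of_le_rho Y.adm.one_sub_pos Y.adm.kap_pos S.α_pos
    Y.continuous_yPlusIntegrand fun _ ht => Y.norm_yPlusIntegrand_le (le_of_lt ht)

lemma hasDerivAt_yPlus (Y : FixedPoint S v x r y) (t : ℝ) :
    HasDerivAt (S.yPlus v x y) (S.yPlusIntegrand v x y t) t := by
  have := (hasDerivAt_integral_Ioi Y.continuous_yPlusIntegrand Y.integrableOn_yPlusIntegrand t).neg
  rwa [neg_neg] at this

lemma deflBound_mono (A : Admissible S v x r) (t : ℝ) :
    deflVel S v x r
      * (rho (1 - r) (kap v r) t ^ (-S.α) / (S.α * kap v r)) ≤ deflBound S v x r := by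
  have h1 := A.kap_pos
  have h2 := S.α_pos
  have h3 := A.deflVel_pos
  unfold deflBound
  have := rpow_neg_anti A.one_sub_pos (le_rho (a := 1 - r) h1 t) h2.le
  gcongr ?_ * (?_ / ?_)

lemma norm_y_le (Y : FixedPoint S v x r y) {t : ℝ} (ht : t ≤ 0) : ‖y t‖ ≤ deflBound S v x r := by
  rw [← Y.fixed t]
  refine (norm_integral_Iic_le_rho' Y.adm.one_sub_pos Y.adm.kap_pos S.α_pos ht
    fun τ hτ => ?_).trans (deflBound_mono Y.adm t)
  rw [← Y.deriv_y]
  exact Y.norm_deriv_y_le (hτ.le.trans ht)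

lemma norm_yPlus_le (Y : FixedPoint S v x r y) {t : ℝ} (ht : 0 ≤ t) :
    ‖S.yPlus v x y t‖ ≤ deflBound S v x r := by
  rw [Setting.yPlus, norm_neg]
  exact (norm_integral_Ioi_le_rho' Y.adm.one_sub_pos Y.adm.kap_pos S.α_pos ht
    fun τ hτ => Y.norm_yPlusIntegrand_le (ht.trans hτ.le)).trans (deflBound_mono Y.adm t)

/-- Both sides have the same velocity, and `b` is chosen so that they agree at time `0`. -/
lemma traj_eq_out (Y : FixedPoint S v x r y) (t : ℝ) :
    S.traj v x y t = S.zPlus (S.a v x y) t + S.b v x y + S.yPlus v x y t := by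
  set f : ℝ → E n := fun t => S.traj v x y t - S.zPlus (S.a v x y) t - S.yPlus v x y t with hf
  have hd : ∀ t, HasDerivAt f 0 t := fun t => by
    have h1 := (Y.contDiff_traj.differentiable (by norm_num) t).hasDerivAt
    have h2 := (Y.freeNear_out.differentiable t).hasDerivAt
    refine ((h1.sub h2).sub (Y.hasDerivAt_yPlus t)).congr_deriv ?_
    rw [Y.yPlusIntegrand_eq, sub_self]
  have h := is_const_of_deriv_eq_zero (fun t => (hd t).differentiableAt)
    (fun t => (hd t).deriv) t 0
  have h0 : f 0 = S.b v x y := by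
    rw [hf]
    simp only [Setting.traj, Setting.b]
    rw [Y.adm.zMinus_zero, Y.freeNear_out.free.origin, Y.fixed 0]
    abel
  rw [h0] at h
  rw [← h]; simp only [hf]; abel

end FixedPoint

end RelScat

namespace RelScat

variable {n : ℕ} {S : Setting n} {v x : E n} {r : ℝ} {y : ℝ → E n} {Fl Fs : E n → E n → E n}

/-! ### Comparison with the straight line -/

lemma line_mem_tube (hr : 0 ≤ r) (t : ℝ) : t • v + x ∈ tube v x r t :=
  (mem_tube_of_norm_sub_le hr (by rw [sub_self, norm_zero]; positivity)).2

lemma IsForce.continuous_line {c p K₀ K₁ K₂ : ℝ} {V : E n → ℝ} {H : E n → E n → E n}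
    (h : IsForce c V p K₀ K₁ K₂ H) (v x : E n) : Continuous fun t : ℝ => H (t • v + x) v :=
  h.cont.comp (by fun_prop : Continuous fun t : ℝ => (t • v + x, v))

lemma Admissible.abs_mul_rho_le (A : Admissible S v x r) (p t : ℝ) :
    |t| * rho (1 - r) (kap v r) t ^ (-(p + 1)) ≤ rho (1 - r) (kap v r) t ^ (-p) / kap v r :=
  RelScat.abs_mul_rho_le A.one_sub_pos A.kap_pos p t

/-- The bound `δ` of the velocity changes along the trajectory. -/
noncomputable def velBound (S : Setting n) (v : E n) (r : ℝ) : ℝ := 2 * S.s v * impulse S v r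

lemma Admissible.velBound_pos (A : Admissible S v x r) : 0 < velBound S v r := by
  have := A.s_pos
  have := A.impulse_pos
  unfold velBound; positivity

/-- The coefficient of the short range force difference between a trajectory and the line. -/
noncomputable def shortDiff (S : Setting n) (v : E n) (r Y δ : ℝ) : ℝ :=
  2 * (n * √(n : ℝ)) * S.β * (Y * (1 - r)⁻¹ + δ / kap v r) + n * S.β / S.c * δ

section

variable {q w : E n} {t Y δ : ℝ}

lemma Forces.short_sub_line_le (Fo : Forces S Fl Fs) (A : Admissible S v x r)
    (hq : q ∈ tube v x r t) (hw : ‖w‖ ≤ S.c) (hY : 0 ≤ Y)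
    (h1 : ‖q - (t • v + x)‖ ≤ Y + |t| * δ) (h2 : ‖w - v‖ ≤ δ) :
    ‖Fs q w - Fs (t • v + x) v‖ ≤
      shortDiff S v r Y δ * rho (1 - r) (kap v r) t ^ (-(S.α + 1 + 1)) := by
  have hδ : 0 ≤ δ := (norm_nonneg _).trans h2
  have hβ := S.β_pos
  have hc := S.c_pos
  have hρ := A.rho_pos t
  have e1 := A.rho_succ_le (S.α + 1 + 1) t
  have e2 := A.abs_mul_rho_le (S.α + 1 + 1) t
  refine (Fo.short_sub_le A hq (line_mem_tube A.r_pos.le t) hw A.speed_lt.le).trans ?_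
  set R3 := rho (1 - r) (kap v r) t ^ (-(S.α + 1 + 1 + 1))
  set R2 := rho (1 - r) (kap v r) t ^ (-(S.α + 1 + 1))
  have hR3 : 0 ≤ R3 := by positivity
  have hR2 : 0 ≤ R2 := by positivity
  calc _ ≤ 2 * (n * √(n : ℝ)) * S.β * R3 * (Y + |t| * δ) + n * S.β / S.c * R2 * δ := by gcongr
    _ = 2 * (n * √(n : ℝ)) * S.β * (Y * R3 + δ * (|t| * R3)) + n * S.β / S.c * R2 * δ := by ring
    _ ≤ 2 * (n * √(n : ℝ)) * S.β * (Y * ((1 - r)⁻¹ * R2) + δ * (R2 / kap v r))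
        + n * S.β / S.c * R2 * δ := by gcongr
    _ = _ := by rw [shortDiff]; ring

/-- The long range force has one power of decay less, with constants that are also at most `β`. -/
lemma Forces.long_sub_line_le (Fo : Forces S Fl Fs) (A : Admissible S v x r)
    (hq : q ∈ tube v x r t) (hw : ‖w‖ ≤ S.c) (hY : 0 ≤ Y)
    (h1 : ‖q - (t • v + x)‖ ≤ Y + |t| * δ) (h2 : ‖w - v‖ ≤ δ) :
    ‖Fl q w - Fl (t • v + x) v‖ ≤
      shortDiff S v r Y δ * rho (1 - r) (kap v r) t ^ (-(S.α + 1)) := by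
  have hδ : 0 ≤ δ := (norm_nonneg _).trans h2
  have hβ := S.β_pos
  have hβ2 := S.β2_le
  have hβ2' := S.β2_pos
  have hβ1 := S.βl1_le
  have hc := S.c_pos
  have hρ := A.rho_pos t
  have e1 := A.rho_succ_le (S.α + 1) t
  have e2 := A.abs_mul_rho_le (S.α + 1) t
  refine (Fo.long_sub_le A hq (line_mem_tube A.r_pos.le t) hw A.speed_lt.le).trans ?_
  set R3 := rho (1 - r) (kap v r) t ^ (-(S.α + 1 + 1))
  set R2 := rho (1 - r) (kap v r) t ^ (-(S.α + 1))
  have hR3 : 0 ≤ R3 := by positivity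
  have hR2 : 0 ≤ R2 := by positivity
  calc _ ≤ 2 * (n * √(n : ℝ)) * S.β * R3 * (Y + |t| * δ) + n * S.β / S.c * R2 * δ := by gcongr
    _ = 2 * (n * √(n : ℝ)) * S.β * (Y * R3 + δ * (|t| * R3)) + n * S.β / S.c * R2 * δ := by ring
    _ ≤ 2 * (n * √(n : ℝ)) * S.β * (Y * ((1 - r)⁻¹ * R2) + δ * (R2 / kap v r))
        + n * S.β / S.c * R2 * δ := by gcongr
    _ = _ := by rw [shortDiff]; ring

end

namespace FixedPoint

lemma norm_deriv_traj_sub_le (Y : FixedPoint S v x r y) (t : ℝ) :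
    ‖deriv (S.traj v x y) t - v‖ ≤ velBound S v r := by
  have h1 := norm_g_sub_g_le S.c_pos (gInv S.c v)
    (gInv S.c v + ∫ τ in Iic t, along S.F (S.traj v x y) τ)
  rw [g_gInv S.c_pos Y.adm.speed_lt, gam_gInv S.c_pos Y.adm.speed_lt, div_div_eq_mul_div, div_one,
    sub_add_cancel_left, norm_neg, norm_sub_rev] at h1
  rw [Y.deriv_traj_eq_velIn]
  refine h1.trans ?_
  have := Y.norm_integral_le (Iic t)
  have := Y.adm.s_pos
  rw [velBound]
  exact mul_le_mul_of_nonneg_left (Y.norm_integral_le (Iic t)) (by positivity)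

/-- The linear growth in `t` is harmless: it costs one power of decay of the force differences. -/
lemma norm_traj_sub_line_le (Y : FixedPoint S v x r y) (t : ℝ) :
    ‖S.traj v x y t - (t • v + x)‖ ≤ deflBound S v x r + |t| * velBound S v r := by
  have h1 := norm_sub_le_of_deriv (Y.contDiff_traj.differentiable (by norm_num))
    Y.norm_deriv_traj_sub_le t
  have h0 : S.traj v x y 0 = x + y 0 := by rw [Setting.traj, Y.adm.zMinus_zero, zero_add]
  rw [h0] at h1
  have h2 := norm_add_le (S.traj v x y t - (x + y 0) - t • v) (y 0)
  rw [show S.traj v x y t - (x + y 0) - t • v + y 0 = S.traj v x y t - (t • v + x) by abel] at h2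
  linarith [Y.norm_y_le (le_refl 0)]

end FixedPoint

lemma Admissible.shortDiff_nonneg (A : Admissible S v x r) :
    0 ≤ shortDiff S v r (deflBound S v x r) (velBound S v r) := by
  have := A.deflBound_pos
  have := A.velBound_pos
  have := A.kap_pos
  have := A.one_sub_pos
  have := S.β_pos
  have := S.c_pos
  unfold shortDiff; positivity

lemma Forces.integrable_line_total (Fo : Forces S Fl Fs) (A : Admissible S v x r) :
    Integrable fun t : ℝ => total Fl Fs (t • v + x) v :=
  integrable_of_le_rho A.one_sub_pos A.kap_pos S.α_pos
    ((Fo.long.continuous_line v x).add (Fo.short.continuous_line v x))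
    fun t => Fo.total_le A (line_mem_tube A.r_pos.le t) A.speed_lt.le

lemma Forces.integrable_line_short (Fo : Forces S Fl Fs) (A : Admissible S v x r) :
    Integrable fun t : ℝ => Fs (t • v + x) v :=
  integrable_of_le_rho A.one_sub_pos A.kap_pos (by linarith [S.α_pos] : 0 < S.α + 1)
    (Fo.short.continuous_line v x)
    fun t => Fo.short_le A (line_mem_tube A.r_pos.le t) A.speed_lt.le

/-- The velocity transfer is that of the straight line up to second order. -/
theorem FixedPoint.norm_asc_sub_le_shortDiff (Y : FixedPoint S v x r y) :
    ‖S.asc v x y - S.s v • ∫ τ : ℝ, S.F (τ • v + x) v‖ ≤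
      S.s v * ((1 + (1 - r)⁻¹) * shortDiff S v r (deflBound S v x r) (velBound S v r)
        * (2 * ((1 - r) ^ (-S.α) / (S.α * kap v r)))) := by
  have A := Y.adm
  have Fo := S.forces A.dim
  rw [Y.asc_eq, ← smul_sub, norm_smul, Real.norm_of_nonneg A.s_pos.le]
  refine mul_le_mul_of_nonneg_left ?_ A.s_pos.le
  have hline : Integrable fun τ : ℝ => S.F (τ • v + x) v := Fo.integrable_line_total A
  rw [← integral_sub Y.integrable hline]
  refine norm_integral_le_rho A.one_sub_pos A.kap_pos S.α_pos fun t => ?_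
  have hY := A.deflBound_pos.le
  have h1 := Fo.long_sub_line_le A (Y.mem_tube t) (Y.speed_le t) hY
    (Y.norm_traj_sub_line_le t) (Y.norm_deriv_traj_sub_le t)
  have h2 := Fo.short_sub_line_le A (Y.mem_tube t) (Y.speed_le t) hY
    (Y.norm_traj_sub_line_le t) (Y.norm_deriv_traj_sub_le t)
  have h3 := A.rho_succ_le (S.α + 1) t
  have e : along S.F (S.traj v x y) t - S.F (t • v + x) v
      = (S.Fl (S.traj v x y t) (deriv (S.traj v x y) t) - S.Fl (t • v + x) v)
        + (S.Fs (S.traj v x y t) (deriv (S.traj v x y) t) - S.Fs (t • v + x) v) := by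
    simp only [along, Setting.F]; abel
  rw [e]
  refine (norm_add_le _ _).trans ((add_le_add h1 h2).trans ?_)
  have hD := A.shortDiff_nonneg
  calc _ ≤ shortDiff S v r (deflBound S v x r) (velBound S v r)
          * rho (1 - r) (kap v r) t ^ (-(S.α + 1))
        + shortDiff S v r (deflBound S v x r) (velBound S v r)
          * ((1 - r)⁻¹ * rho (1 - r) (kap v r) t ^ (-(S.α + 1))) := by gcongr
    _ = _ := by ring

/-! ### Position transfer on a half-line -/

/-- The work of the short range force along an outgoing half-line is the potential at its origin:
the magnetic part does no work. -/
lemma Forces.inner_integral_line (Fo : Forces S Fl Fs) (A : Admissible S v x r) (σ : ℝ) :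
    inner ℝ v (∫ τ in Ioi σ, Fs (τ • v + x) v) = S.Vs (σ • v + x) := by
  have hi := (Fo.integrable_line_short A).integrableOn (s := Ioi σ)
  have e : inner ℝ v (∫ τ in Ioi σ, Fs (τ • v + x) v)
      = ∫ τ in Ioi σ, inner ℝ v (Fs (τ • v + x) v) :=
    ((innerSL ℝ v).integral_comp_comm hi).symm
  have hd : ∀ t ∈ Ici σ, HasDerivAt (fun t : ℝ => -S.Vs (t • v + x))
      (inner ℝ v (Fs (t • v + x) v)) t := fun t _ => by
    rw [Fo.short.work]
    have h1 : HasDerivAt (fun t : ℝ => t • v + x) v t := by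
      simpa using ((hasDerivAt_id t).smul_const v).add_const x
    exact (FixedPoint.hasDerivAt_comp_potential S.Vs_smooth h1).neg
  have hlim : Tendsto (fun t : ℝ => -S.Vs (t • v + x)) atTop (𝓝 0) := by
    have := FixedPoint.tendsto_potential A (by linarith [S.α_pos]) S.βs1_pos.le S.Vs_decay.zero
      tendsto_abs_atTop_atTop (Eventually.of_forall fun t => line_mem_tube A.r_pos.le t)
    simpa using this.neg
  rw [e, integral_Ioi_of_hasDerivAt_of_tendsto' hd
    ((innerSL ℝ v).integrable_comp hi) hlim]
  simp

lemma Admissible.integrable_potential (A : Admissible S v x r) :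
    Integrable fun σ : ℝ => S.Vs (σ • v + x) := by
  refine integrable_of_le_rho (C := S.βs1) A.one_sub_pos A.kap_pos S.α_pos
    (S.Vs_smooth.continuous.comp (by fun_prop)) fun t => ?_
  refine (S.Vs_decay.zero _).trans (mul_le_mul_of_nonneg_left ?_ S.βs1_pos.le)
  exact rpow_neg_anti (A.rho_pos t) (rho_le_of_mem_tube A.orth (line_mem_tube A.r_pos.le t))
    (by linarith [S.α_pos])

lemma Forces.norm_integral_line_le (Fo : Forces S Fl Fs) (A : Admissible S v x r) {σ : ℝ}
    (hσ : 0 ≤ σ) : ‖∫ τ in Ioi σ, Fs (τ • v + x) v‖ ≤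
      2 * n * S.β2 * (rho (1 - r) (kap v r) σ ^ (-(S.α + 1)) / ((S.α + 1) * kap v r)) :=
  norm_integral_Ioi_le_rho' A.one_sub_pos A.kap_pos (by linarith [S.α_pos] : 0 < S.α + 1) hσ
    fun t _ => Fo.short_le A (line_mem_tube A.r_pos.le t) A.speed_lt.le

lemma Forces.integrableOn_integral_line (Fo : Forces S Fl Fs) (A : Admissible S v x r) :
    IntegrableOn (fun σ : ℝ => ∫ τ in Ioi σ, Fs (τ • v + x) v) (Ioi 0) := by
  refine integrableOn_Ioi_of_le_rho (C := 2 * n * S.β2 / ((S.α + 1) * kap v r)) A.one_sub_pos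
    A.kap_pos S.α_pos (continuous_iff_continuousAt.2 fun t => (hasDerivAt_integral_Ioi
      (Fo.short.continuous_line v x) (Fo.integrable_line_short A).integrableOn t).continuousAt)
    fun t ht => (Fo.norm_integral_line_le A (le_of_lt ht)).trans (le_of_eq ?_)
  ring

end RelScat

namespace RelScat

variable {n : ℕ} {S : Setting n} {v x : E n} {r : ℝ} {y : ℝ → E n} {Fl Fs : E n → E n → E n}

namespace FreeNear

variable {w : E n} {ζ f : ℝ → E n}

lemma continuous_along_add (Z : FreeNear S v Fl w ζ) (Fo : Forces S Fl Fs) (x : E n) :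
    Continuous (along Fl fun τ => ζ τ + x) := by
  refine Fo.long.continuous_along (Z.free.solution.continuous.add continuous_const) ?_
  rw [show deriv (fun τ => ζ τ + x) = deriv ζ from funext fun t => deriv_add_const x]
  exact Z.free.solution.continuous_deriv

lemma speed_add_le (Z : FreeNear S v Fl w ζ) (x : E n) (t : ℝ) :
    ‖deriv (fun τ => ζ τ + x) t‖ ≤ S.c := by
  rw [deriv_add_const]; exact (Z.free.solution.speed_lt t).le

lemma integrable_add (Z : FreeNear S v Fl w ζ) (Fo : Forces S Fl Fs) (A : Admissible S v x r) :
    Integrable (along Fl fun τ => ζ τ + x) :=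
  integrable_of_le_rho A.one_sub_pos A.kap_pos S.α_pos (Z.continuous_along_add Fo x)
    fun t => Fo.long_le A (Z.add_mem_tube A t) (Z.speed_add_le x t)

lemma norm_integral_add_le (Z : FreeNear S v Fl w ζ) (Fo : Forces S Fl Fs)
    (A : Admissible S v x r) (t : ℝ) :
    ‖∫ τ in Ioi t, along Fl (fun τ => ζ τ + x) τ‖ ≤ impulse S v r :=
  Fo.norm_integral_long_le A (Z.add_mem_tube A) (Z.speed_add_le x) _

lemma continuous_velOut {H : E n → E n → E n} (hc : Continuous (along H f))
    (hi : Integrable (along H f)) : Continuous (velOut S.c w H f) :=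
  contDiff_g (k := 0) |>.continuous.comp (continuous_const.sub (continuous_iff_continuousAt.2
    fun t => (hasDerivAt_integral_Ioi hc hi.integrableOn t).continuousAt))

/-- A shift of the free solution changes its velocity by an integrable amount. -/
lemma integrableOn_shift (Z : FreeNear S v Fl w ζ) (Fo : Forces S Fl Fs)
    (A : Admissible S v x r) :
    IntegrableOn (fun σ => velOut S.c w Fl (fun τ => ζ τ + x) σ - velOut S.c w Fl ζ σ)
      (Ioi 0) := by
  have hs := A.s_pos
  set K := 2 * (n * √(n : ℝ)) * S.β2 * ‖x‖ with hK
  refine integrableOn_Ioi_of_le_rho (C := 32 / 15 * S.s v * (K / ((S.α + 1) * kap v r)))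
    A.one_sub_pos A.kap_pos S.α_pos
    ((continuous_velOut (Z.continuous_along_add Fo x) (Z.integrable_add Fo A)).sub
      (continuous_velOut (Z.continuous_along Fo) (Z.integrable Fo A))) fun t ht => ?_
  refine (Z.norm_velOut_sub_le Fo A (Z.integrable_add Fo A).integrableOn).trans ?_
  have := norm_integral_Ioi_le_rho' A.one_sub_pos A.kap_pos
    (by linarith [S.α_pos] : 0 < S.α + 1) (le_of_lt ht) (C := K)
    (h := fun τ => along Fl (fun τ => ζ τ + x) τ - along Fl ζ τ) (fun τ _ => ?_)
  · calc _ ≤ 32 / 15 * S.s v * (K * (rho (1 - r) (kap v r) t ^ (-(S.α + 1))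
          / ((S.α + 1) * kap v r))) := by gcongr
      _ = _ := by ring
  · have h := Fo.long_sub_le A (Z.add_mem_tube A τ) (Z.mem_tube A τ) (Z.speed_add_le x τ)
      (Z.free.solution.speed_lt τ).le
    rw [deriv_add_const, sub_self, norm_zero, mul_zero, add_zero, add_sub_cancel_left] at h
    simp only [along, deriv_add_const]
    refine h.trans (le_of_eq ?_)
    rw [hK]; ring

end FreeNear

/-- A curve `f`, a free solution `ζ` with the same outgoing velocity `w`, and the line `tv + x`,
with bounds for their mutual distances at positive times. -/
structure OutgoingData (S : Setting n) (v x : E n) (r : ℝ) (Fl Fs : E n → E n → E n) (w : E n)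
    (ζ f : ℝ → E n) (Y D δ : ℝ) : Prop where
  adm : Admissible S v x r
  forces : Forces S Fl Fs
  free : FreeNear S v Fl w ζ
  smooth : ContDiff ℝ 1 f
  mem_tube : ∀ t, f t ∈ tube v x r t
  speed_le : ∀ t, ‖deriv f t‖ ≤ S.c
  pos_free : ∀ t ≥ 0, ‖f t - ζ t - x‖ ≤ Y
  vel_free : ∀ t ≥ 0, ‖deriv f t - deriv ζ t‖ ≤ D * rho (1 - r) (kap v r) t ^ (-(S.α + 1))
  pos_line : ∀ t ≥ 0, ‖f t - (t • v + x)‖ ≤ Y + |t| * δ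
  vel_line : ∀ t ≥ 0, ‖deriv f t - v‖ ≤ δ
  vel_out : ‖w - v‖ ≤ δ

/-- The coefficient of the long range force difference between a trajectory and the shifted free
solution. -/
noncomputable def longDiff (S : Setting n) (r Y D : ℝ) : ℝ :=
  2 * (n * √(n : ℝ)) * S.β2 * Y + n * S.βl1 / S.c * (D * (1 - r) ^ (-S.α))

/-- The coefficient of the error of the first order expansion of the velocity difference. -/
noncomputable def velErr (S : Setting n) (v : E n) (r Y D δ : ℝ) : ℝ :=
  (8 * S.s v ^ 2 / S.c * impulse S v r * (longDiff S r Y D + 2 * n * S.β2)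
    + 2 * S.s v * (longDiff S r Y D + shortDiff S v r Y δ)
    + 2 * S.s v * (δ / S.c) * (2 * n * S.β2)) / ((S.α + 1) * kap v r)

namespace OutgoingData

variable {w : E n} {ζ f : ℝ → E n} {Y D δ : ℝ}

lemma integrable (O : OutgoingData S v x r Fl Fs w ζ f Y D δ) :
    Integrable (along (total Fl Fs) f) :=
  O.forces.integrable_total O.adm O.smooth.continuous (O.smooth.continuous_deriv (by norm_num))
    O.mem_tube O.speed_le

lemma continuous_along (O : OutgoingData S v x r Fl Fs w ζ f Y D δ) :
    Continuous (along (total Fl Fs) f) :=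
  O.forces.continuous_along O.smooth.continuous (O.smooth.continuous_deriv (by norm_num))

lemma Y_nonneg (O : OutgoingData S v x r Fl Fs w ζ f Y D δ) : 0 ≤ Y :=
  (norm_nonneg _).trans (O.pos_free 0 le_rfl)

lemma δ_nonneg (O : OutgoingData S v x r Fl Fs w ζ f Y D δ) : 0 ≤ δ :=
  (norm_nonneg _).trans O.vel_out

lemma D_nonneg (O : OutgoingData S v x r Fl Fs w ζ f Y D δ) : 0 ≤ D := by
  have h := (norm_nonneg _).trans (O.vel_free 0 le_rfl)
  exact nonneg_of_mul_nonneg_left h (Real.rpow_pos_of_pos (O.adm.rho_pos 0) _)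

lemma longDiff_nonneg (O : OutgoingData S v x r Fl Fs w ζ f Y D δ) : 0 ≤ longDiff S r Y D := by
  have := O.Y_nonneg
  have := O.D_nonneg
  have := S.β2_pos
  have := S.βl1_pos
  have := S.c_pos
  have := O.adm.one_sub_pos
  unfold longDiff; positivity

lemma long_sub_le (O : OutgoingData S v x r Fl Fs w ζ f Y D δ) {t : ℝ} (ht : 0 ≤ t) :
    ‖Fl (f t) (deriv f t) - Fl (ζ t + x) (deriv ζ t)‖ ≤
      longDiff S r Y D * rho (1 - r) (kap v r) t ^ (-(S.α + 1 + 1)) := by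
  have A := O.adm
  have h := O.forces.long_sub_le A (O.mem_tube t) (O.free.add_mem_tube A t) (O.speed_le t)
    (O.free.free.solution.speed_lt t).le
  have hρ := A.rho_pos t
  have hY := O.pos_free t ht
  rw [sub_sub] at hY
  have hD := O.vel_free t ht
  have e2 : rho (1 - r) (kap v r) t ^ (-(S.α + 1)) * rho (1 - r) (kap v r) t ^ (-(S.α + 1))
      ≤ (1 - r) ^ (-S.α) * rho (1 - r) (kap v r) t ^ (-(S.α + 1 + 1)) := by
    rw [← Real.rpow_add hρ, show -(S.α + 1) + -(S.α + 1) = -S.α + -(S.α + 1 + 1) by ring,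
      Real.rpow_add hρ]
    exact mul_le_mul_of_nonneg_right
      (rpow_neg_anti A.one_sub_pos (le_rho A.kap_pos t) S.α_pos.le) (by positivity)
  have := S.β2_pos
  have := S.βl1_pos
  have := S.c_pos
  have := O.D_nonneg
  refine h.trans ?_
  set R2 := rho (1 - r) (kap v r) t ^ (-(S.α + 1 + 1))
  set R1 := rho (1 - r) (kap v r) t ^ (-(S.α + 1))
  have hR1 : 0 ≤ R1 := by positivity
  calc _ ≤ 2 * (n * √(n : ℝ)) * S.β2 * R2 * Y + n * S.βl1 / S.c * R1 * (D * R1) := by gcongr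
    _ = 2 * (n * √(n : ℝ)) * S.β2 * R2 * Y + n * S.βl1 / S.c * D * (R1 * R1) := by ring
    _ ≤ 2 * (n * √(n : ℝ)) * S.β2 * R2 * Y
        + n * S.βl1 / S.c * D * ((1 - r) ^ (-S.α) * R2) := by gcongr
    _ = _ := by rw [longDiff]; ring

/-- The velocity difference between the trajectory and the shifted free solution, to first
order: the short range momentum transfer along the line, with its component along `v` expressed by
the potential. -/
theorem norm_velOut_sub_add_le (O : OutgoingData S v x r Fl Fs w ζ f Y D δ) {σ : ℝ}
    (hσ : 0 ≤ σ) :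
    ‖velOut S.c w (total Fl Fs) f σ - velOut S.c w Fl (fun τ => ζ τ + x) σ
      + S.s v • ((∫ τ in Ioi σ, Fs (τ • v + x) v) - (S.Vs (σ • v + x) / S.c ^ 2) • v)‖ ≤
      velErr S v r Y D δ * rho (1 - r) (kap v r) σ ^ (-(S.α + 1)) := by
  have A := O.adm
  have Fo := O.forces
  have hc := S.c_pos
  have hs := A.s_pos
  have hα1 : 0 < S.α + 1 := by linarith [S.α_pos]
  have hwc : ‖w‖ < S.c := O.free.speed_lt A
  have hg : gam S.c (gInv S.c w) = 1 / S.s v := by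
    rw [gam_gInv hc hwc, ← O.free.s_eq]; rfl
  have hi1 := O.integrable.integrableOn (s := Ioi σ)
  have hi2 := (O.free.integrable_add Fo A).integrableOn (s := Ioi σ)
  have hi3 := (Fo.integrable_line_short A).integrableOn (s := Ioi σ)
  set P₁ := ∫ τ in Ioi σ, along (total Fl Fs) f τ with hP₁
  set P₂ := ∫ τ in Ioi σ, along Fl (fun τ => ζ τ + x) τ with hP₂
  set I := ∫ τ in Ioi σ, Fs (τ • v + x) v with hI
  have hQ1 : ‖gInv S.c w - P₁ - gInv S.c w‖ ≤ impulse S v r := by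
    rw [sub_sub_cancel_left, norm_neg]
    exact Fo.norm_integral_total_le A O.mem_tube O.speed_le _
  have hQ2 : ‖gInv S.c w - P₂ - gInv S.c w‖ ≤ impulse S v r := by
    rw [sub_sub_cancel_left, norm_neg]
    exact O.free.norm_integral_add_le Fo A σ
  have hγ : 1 / gam S.c (gInv S.c w - P₁) ≤ 2 / gam S.c (gInv S.c w) := by
    have h0 := inv_gam_le (p := gInv S.c w) (q := gInv S.c w - P₁) hc (by
      rw [hg, mul_one_div]; exact hQ1.trans A.impulse_le)
    have := gam_pos (c := S.c) (gInv S.c w)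
    refine h0.trans ?_
    rw [mul_one_div]
    gcongr
    norm_num
  have main := norm_g_sub_g_sub_le hc _ _ _ _ hQ1 hQ2 hγ
  rw [hg, g_gInv hc hwc, one_div_one_div, sub_sub_sub_cancel_left, ← neg_sub P₁ P₂, norm_neg]
    at main
  set J := P₁ - P₂ with hJ
  have hJ' : J = ∫ τ in Ioi σ, (along (total Fl Fs) f τ - along Fl (fun τ => ζ τ + x) τ) := by
    rw [hJ, hP₁, hP₂, integral_sub hi1 hi2]
  have hIJ : J - I = ∫ τ in Ioi σ, (along (total Fl Fs) f τ - along Fl (fun τ => ζ τ + x) τ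
      - Fs (τ • v + x) v) := by
    have hi12 : IntegrableOn (fun τ => along (total Fl Fs) f τ
        - along Fl (fun τ => ζ τ + x) τ) (Ioi σ) := hi1.sub hi2
    rw [hJ', hI, ← integral_sub hi12 hi3]
  set R := rho (1 - r) (kap v r) σ ^ (-(S.α + 1)) / ((S.α + 1) * kap v r) with hR
  have bJ : ‖J‖ ≤ (longDiff S r Y D + 2 * n * S.β2) * R := by
    rw [hJ']
    refine norm_integral_Ioi_le_rho' A.one_sub_pos A.kap_pos hα1 hσ fun t ht => ?_
    have ht0 : 0 ≤ t := hσ.trans (le_of_lt ht)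
    have h1 := O.long_sub_le ht0
    have h2 := Fo.short_le A (O.mem_tube t) (O.speed_le t)
    simp only [along, deriv_add_const, total]
    rw [add_sub_right_comm, add_mul]
    exact (norm_add_le _ _).trans (add_le_add h1 h2)
  have bIJ : ‖J - I‖ ≤ (longDiff S r Y D + shortDiff S v r Y δ) * R := by
    rw [hIJ]
    refine norm_integral_Ioi_le_rho' A.one_sub_pos A.kap_pos hα1 hσ fun t ht => ?_
    have ht0 : 0 ≤ t := hσ.trans (le_of_lt ht)
    have h1 := O.long_sub_le ht0
    have h2 := Fo.short_sub_line_le A (O.mem_tube t) (O.speed_le t) O.Y_nonneg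
      (O.pos_line t ht0) (O.vel_line t ht0)
    simp only [along, deriv_add_const, total]
    rw [add_sub_right_comm, add_sub_assoc, add_mul]
    exact (norm_add_le _ _).trans (add_le_add h1 h2)
  have bI : ‖I‖ ≤ 2 * n * S.β2 * R := Fo.norm_integral_line_le A hσ
  have hV : S.Vs (σ • v + x) = inner ℝ v I := (Fo.inner_integral_line A σ).symm
  have key : velOut S.c w (total Fl Fs) f σ - velOut S.c w Fl (fun τ => ζ τ + x) σ
      + S.s v • (I - (S.Vs (σ • v + x) / S.c ^ 2) • v)
      = (g S.c (gInv S.c w - P₁) - g S.c (gInv S.c w - P₂)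
          - S.s v • (-J - (inner ℝ w (-J) / S.c ^ 2) • w))
        - S.s v • ((J - I) - (inner ℝ w (J - I) / S.c ^ 2) • w)
        + (S.s v / S.c ^ 2) • ((inner ℝ (w - v) I : ℝ) • w + (inner ℝ v I : ℝ) • (w - v)) := by
    rw [hV, inner_sub_right, inner_sub_left, inner_neg_right]
    simp only [velOut]
    module
  rw [key]
  have t2 : ‖S.s v • ((J - I) - (inner ℝ w (J - I) / S.c ^ 2) • w)‖ ≤ S.s v * (2 * ‖J - I‖) := by
    rw [norm_smul, Real.norm_of_nonneg hs.le]
    exact mul_le_mul_of_nonneg_left (norm_sub_smul_le hc _ _ _ hwc.le hwc.le) hs.le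
  have t3 : ‖(inner ℝ (w - v) I : ℝ) • w + (inner ℝ v I : ℝ) • (w - v)‖ ≤ 2 * S.c * δ * ‖I‖ := by
    refine (norm_add_le _ _).trans ?_
    rw [norm_smul, norm_smul, Real.norm_eq_abs, Real.norm_eq_abs]
    have i1 : |inner ℝ (w - v) I| ≤ δ * ‖I‖ :=
      (abs_real_inner_le_norm _ _).trans (by gcongr; exact O.vel_out)
    have i2 : |inner ℝ v I| ≤ S.c * ‖I‖ :=
      (abs_real_inner_le_norm _ _).trans (by gcongr; exact A.speed_lt.le)
    have hδ := O.δ_nonneg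
    calc _ ≤ (δ * ‖I‖) * S.c + (S.c * ‖I‖) * δ := by
          gcongr
          exact O.vel_out
      _ = _ := by ring
  refine (norm_add_le _ _).trans ((add_le_add (_root_.norm_sub_le _ _) le_rfl).trans ?_)
  rw [norm_smul (S.s v / S.c ^ 2), Real.norm_of_nonneg (by positivity)]
  have hδ := O.δ_nonneg
  have hL := O.longDiff_nonneg
  have hβ := S.β2_pos
  have hP := A.impulse_pos
  calc _ ≤ 8 * S.s v ^ 2 / S.c * impulse S v r * ((longDiff S r Y D + 2 * n * S.β2) * R)
        + S.s v * (2 * ((longDiff S r Y D + shortDiff S v r Y δ) * R))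
        + S.s v / S.c ^ 2 * (2 * S.c * δ * (2 * n * S.β2 * R)) := by
        gcongr
        · exact main.trans (by gcongr)
        · exact t2.trans (by gcongr)
        · exact t3.trans (by gcongr)
    _ = _ := by
        rw [velErr, hR]
        field_simp

lemma integrableOn_first_order (O : OutgoingData S v x r Fl Fs w ζ f Y D δ) :
    IntegrableOn (fun σ : ℝ => S.s v • ((∫ τ in Ioi σ, Fs (τ • v + x) v)
      - (S.Vs (σ • v + x) / S.c ^ 2) • v)) (Ioi 0) :=
  (((O.forces.integrableOn_integral_line O.adm)).sub
    ((O.adm.integrable_potential.integrableOn.div_const _).smul_const v)).smul (S.s v)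

lemma integrableOn_diff (O : OutgoingData S v x r Fl Fs w ζ f Y D δ) :
    IntegrableOn (fun σ => velOut S.c w (total Fl Fs) f σ
      - velOut S.c w Fl (fun τ => ζ τ + x) σ) (Ioi 0) := by
  have A := O.adm
  have Fo := O.forces
  have hV : Continuous fun σ : ℝ => S.Vs (σ • v + x) :=
    S.Vs_smooth.continuous.comp (by fun_prop)
  have hI : Continuous fun σ : ℝ => ∫ τ in Ioi σ, Fs (τ • v + x) v :=
    continuous_iff_continuousAt.2 fun t => (hasDerivAt_integral_Ioi
      (Fo.short.continuous_line v x) (Fo.integrable_line_short A).integrableOn t).continuousAt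
  have hT : Continuous fun σ => velOut S.c w (total Fl Fs) f σ
      - velOut S.c w Fl (fun τ => ζ τ + x) σ :=
    (FreeNear.continuous_velOut O.continuous_along O.integrable).sub
      (FreeNear.continuous_velOut (O.free.continuous_along_add Fo x) (O.free.integrable_add Fo A))
  have h := integrableOn_Ioi_of_le_rho A.one_sub_pos A.kap_pos S.α_pos
    (hT.add ((hI.sub ((hV.div_const (S.c ^ 2)).smul continuous_const)).const_smul (S.s v)))
    fun t ht => O.norm_velOut_sub_add_le (le_of_lt ht)
  refine (h.sub O.integrableOn_first_order).congr_fun (fun σ _ => ?_) measurableSet_Ioi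
  exact add_sub_cancel_right _ _

/-- The position transfer on a half-line. -/
theorem norm_integral_le (O : OutgoingData S v x r Fl Fs w ζ f Y D δ) :
    ‖(∫ σ in Ioi 0, (velOut S.c w (total Fl Fs) f σ - velOut S.c w Fl (fun τ => ζ τ + x) σ))
      + S.s v • ((∫ σ in Ioi (0 : ℝ), ∫ τ in Ioi σ, Fs (τ • v + x) v)
        - (∫ σ in Ioi (0 : ℝ), S.Vs (σ • v + x)) • ((1 / S.c ^ 2) • v))‖ ≤
      velErr S v r Y D δ * ((1 - r) ^ (-S.α) / (S.α * kap v r)) := by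
  have A := O.adm
  have h := norm_integral_Ioi_le_rho' A.one_sub_pos A.kap_pos S.α_pos (le_refl (0 : ℝ))
    fun t ht => O.norm_velOut_sub_add_le (le_of_lt ht)
  rw [rho_zero, integral_add O.integrableOn_diff O.integrableOn_first_order,
    integral_smul, integral_sub (O.forces.integrableOn_integral_line A)
      ((A.integrable_potential.integrableOn.div_const _).smul_const v),
    integral_smul_const, integral_div] at h
  rw [smul_smul (∫ σ in Ioi (0 : ℝ), S.Vs (σ • v + x)), mul_one_div]
  exact h

end OutgoingData

end RelScat

namespace RelScat

variable {n : ℕ} {S : Setting n} {v x : E n} {r : ℝ} {y : ℝ → E n}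

/-! ### The position transfer of a trajectory -/

lemma velErr_neg {Y D δ : ℝ} : velErr S (-v) r Y D δ = velErr S v r Y D δ := by
  simp [velErr, shortDiff, impulse, smallness, Setting.s, kap_neg]

lemma Admissible.integrableOn_WIn (A : Admissible S v x r) :
    IntegrableOn (S.WInIntegrand v x) (Iic 0) := by
  have h := integrableOn_comp_neg_Iic.2
    (A.freeNear_in.integrableOn_shift (S.forces A.dim).rev A.neg).neg
  rw [neg_zero] at h
  refine h.congr_fun (fun σ _ => ?_) measurableSet_Iic
  simp only [Pi.neg_apply, Setting.WInIntegrand]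
  rw [velIn_eq_neg_velOut, velIn_eq_neg_velOut]
  abel

namespace FixedPoint

lemma outgoingData (Y : FixedPoint S v x r y) :
    OutgoingData S v x r S.Fl S.Fs (S.a v x y) (S.zPlus (S.a v x y)) (S.traj v x y)
      (2 * deflBound S v x r) (deflVel S v x r) (velBound S v r) where
  adm := Y.adm
  forces := S.forces Y.adm.dim
  free := Y.freeNear_out
  smooth := Y.contDiff_traj
  mem_tube := Y.mem_tube
  speed_le := Y.speed_le
  pos_free t ht := by
    have h1 := norm_sub_le_of_deriv_le_rho (u := S.yPlus v x y) (θ := 0) (C := deflVel S v x r)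
      Y.adm.one_sub_pos Y.adm.kap_pos S.α_pos ?_
      (fun t => (Y.hasDerivAt_yPlus t).differentiableAt) ?_ ?_ ht
    · have e : S.traj v x y t - S.zPlus (S.a v x y) t - x
          = (S.yPlus v x y t - S.yPlus v x y 0) + y 0 := by
        rw [Y.traj_eq_out, Setting.b, Y.fixed 0]; abel
      rw [e, two_mul]
      refine (norm_add_le _ _).trans (add_le_add (h1.trans (le_of_eq ?_)) (Y.norm_y_le le_rfl))
      rw [zero_mul, zero_add]; rfl
    · exact Y.adm.deflVel_pos.le
    · rw [show deriv (S.yPlus v x y) = S.yPlusIntegrand v x y from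
        funext fun t => (Y.hasDerivAt_yPlus t).deriv]
      exact Y.continuous_yPlusIntegrand
    · intro t ht
      rw [(Y.hasDerivAt_yPlus t).deriv, zero_add]
      exact Y.norm_yPlusIntegrand_le ht
  vel_free t ht := by
    rw [← Y.yPlusIntegrand_eq]
    exact Y.norm_yPlusIntegrand_le ht
  pos_line t _ := by
    have := Y.adm.deflBound_pos
    linarith [Y.norm_traj_sub_line_le t]
  vel_line t _ := Y.norm_deriv_traj_sub_le t
  vel_out := by
    have h := Y.norm_asc_le_impulse
    have := mul_pos Y.adm.s_pos Y.adm.impulse_pos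
    rw [velBound]
    rw [Setting.asc] at h
    linarith

/-- The incoming half of the trajectory, run backwards. -/
lemma incomingData (Y : FixedPoint S v x r y) :
    OutgoingData S (-v) x r (revForce S.Fl) (revForce S.Fs) (-v) (fun t => S.zMinus v (-t))
      (fun t => S.traj v x y (-t))
      (2 * deflBound S v x r) (deflVel S v x r) (velBound S v r) where
  adm := Y.adm.neg
  forces := (S.forces Y.adm.dim).rev
  free := Y.adm.freeNear_in
  smooth := Y.contDiff_traj.comp contDiff_neg
  mem_tube := Y.mem_tube_rev
  speed_le t := by rw [deriv_comp_neg', norm_neg]; exact Y.speed_le _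
  pos_free t ht := by
    have := Y.adm.deflBound_pos
    have h := Y.norm_y_le (show -t ≤ 0 by linarith)
    rw [show S.traj v x y (-t) - S.zMinus v (-t) - x = y (-t) by
      simp only [Setting.traj]; abel]
    linarith
  vel_free t ht := by
    rw [deriv_comp_neg', deriv_comp_neg', Y.deriv_traj, neg_sub_neg, kap_neg,
      show deriv (S.zMinus v) (-t) - (deriv (S.zMinus v) (-t) + deriv y (-t)) = -deriv y (-t) by
        abel, norm_neg, ← rho_neg t]
    exact Y.norm_deriv_y_le (by linarith)
  pos_line t _ := by
    have := Y.adm.deflBound_pos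
    have h := Y.norm_traj_sub_line_le (-t)
    rw [neg_smul, ← smul_neg, abs_neg] at h
    linarith
  vel_line t _ := by
    rw [deriv_comp_neg', neg_sub_neg, norm_sub_rev]; exact Y.norm_deriv_traj_sub_le (-t)
  vel_out := by
    rw [sub_self, norm_zero]; exact Y.adm.velBound_pos.le

lemma integrableOn_WOut (Y : FixedPoint S v x r y) :
    IntegrableOn (S.WOutIntegrand (S.a v x y) x) (Ioi 0) :=
  Y.freeNear_out.integrableOn_shift (S.forces Y.adm.dim) Y.adm

/-- The short range part of the position transfer is that of the straight line up to second
order. -/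
theorem norm_bsc_sub_le_velErr (Y : FixedPoint S v x r y) :
    ‖S.bsc v x y - S.W v x y
        - S.s v • ((∫ σ in Iic (0 : ℝ), ∫ τ in Iic σ, S.Fs (τ • v + x) v)
          - (∫ σ in Ioi (0 : ℝ), ∫ τ in Ioi σ, S.Fs (τ • v + x) v)
          + (∫ σ : ℝ, S.Vs (σ • v + x)) • ((1 / S.c ^ 2) • v))‖ ≤
      2 * (velErr S v r (2 * deflBound S v x r) (deflVel S v x r) (velBound S v r)
        * ((1 - r) ^ (-S.α) / (S.α * kap v r))) := by
  have A := Y.adm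
  have ho := Y.outgoingData.norm_integral_le
  have hi := Y.incomingData.norm_integral_le
  rw [velErr_neg, kap_neg, Setting.s, norm_neg] at hi
  set Tin := ∫ σ in Iic (0 : ℝ), (velIn S.c v S.F (S.traj v x y) σ
    - velIn S.c v S.Fl (fun τ => S.zMinus v τ + x) σ) with hTin
  set Tout := ∫ σ in Ioi (0 : ℝ), (velOut S.c (S.a v x y) (total S.Fl S.Fs) (S.traj v x y) σ
    - velOut S.c (S.a v x y) S.Fl (fun τ => S.zPlus (S.a v x y) τ + x) σ) with hTout
  set I1 := ∫ σ in Iic (0 : ℝ), ∫ τ in Iic σ, S.Fs (τ • v + x) v with hI1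
  set I2 := ∫ σ in Ioi (0 : ℝ), ∫ τ in Ioi σ, S.Fs (τ • v + x) v with hI2
  have e1 : ∫ σ in Ioi (0 : ℝ), (velOut S.c (-v) (total (revForce S.Fl) (revForce S.Fs))
      (fun t => S.traj v x y (-t)) σ
      - velOut S.c (-v) (revForce S.Fl) (fun τ => S.zMinus v (-τ) + x) σ) = -Tin := by
    rw [hTin, integral_Iic_eq_Ioi_neg, neg_zero, ← integral_neg]
    refine integral_congr_ae (Eventually.of_forall fun σ => ?_)
    simp only [velIn_eq_neg_velOut, neg_neg, F_eq_total, revForce_total]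
    abel
  have e2 : ∫ σ in Ioi (0 : ℝ), ∫ τ in Ioi σ, revForce S.Fs (τ • -v + x) (-v) = I1 := by
    rw [hI1, integral_Iic_eq_Ioi_neg, neg_zero]
    refine integral_congr_ae (Eventually.of_forall fun σ => ?_)
    simp only [integral_Iic_eq_Ioi_neg _ (-σ), neg_neg, revForce, smul_neg, neg_smul]
  have e3 : ∫ σ in Ioi (0 : ℝ), S.Vs (σ • -v + x) = ∫ σ in Iic (0 : ℝ), S.Vs (σ • v + x) := by
    rw [integral_Iic_eq_Ioi_neg, neg_zero]
    simp only [smul_neg, neg_smul]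
  rw [e1, e2, e3] at hi
  have eV : ∫ σ : ℝ, S.Vs (σ • v + x)
      = (∫ σ in Iic (0 : ℝ), S.Vs (σ • v + x)) + ∫ σ in Ioi (0 : ℝ), S.Vs (σ • v + x) :=
    (intervalIntegral.integral_Iic_add_Ioi A.integrable_potential.integrableOn
      A.integrable_potential.integrableOn).symm
  have eb : S.bsc v x y - S.W v x y = Tin + Tout := by
    have t1 : (∫ σ in Iic (0 : ℝ), S.Adot v x y σ) - ∫ σ in Iic (0 : ℝ), S.WInIntegrand v x σ
        = Tin := by
      rw [← integral_sub Y.integrableOn_Adot A.integrableOn_WIn]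
      refine integral_congr_ae (Eventually.of_forall fun σ => ?_)
      simp only [Setting.Adot, Setting.WInIntegrand, sub_sub_sub_cancel_right]
    have t2 : (∫ σ in Ioi (0 : ℝ), S.yPlusIntegrand v x y σ)
        - ∫ σ in Ioi (0 : ℝ), S.WOutIntegrand (S.a v x y) x σ = Tout := by
      rw [← integral_sub Y.integrableOn_yPlusIntegrand Y.integrableOn_WOut]
      refine integral_congr_ae (Eventually.of_forall fun σ => ?_)
      simp only [Setting.yPlusIntegrand, Setting.WOutIntegrand, sub_sub_sub_cancel_right]
      rfl
    rw [← t1, ← t2, Setting.bsc, Setting.b, Setting.W, Setting.yPlus, Setting.A]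
    abel
  rw [eb, eV]
  have hs : S.s v = √(1 - ‖v‖ ^ 2 / S.c ^ 2) := rfl
  rw [← hs] at hi
  set V1 := ∫ σ in Iic (0 : ℝ), S.Vs (σ • v + x)
  set V2 := ∫ σ in Ioi (0 : ℝ), S.Vs (σ • v + x)
  rw [show Tin + Tout - S.s v • (I1 - I2 + (V1 + V2) • ((1 / S.c ^ 2) • v))
    = (Tout + S.s v • (I2 - V2 • ((1 / S.c ^ 2) • v)))
      - (-Tin + S.s v • (I1 - V1 • ((1 / S.c ^ 2) • -v))) by module, two_mul]
  exact (_root_.norm_sub_le _ _).trans (add_le_add ho hi)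

end FixedPoint

end RelScat

namespace RelScat

variable {n : ℕ} {S : Setting n} {v x : E n} {r : ℝ} {y : ℝ → E n}

/-! ### The constants -/

/-- The size `s β (1 - r)^{-α} / (α κ)` of the velocity changes. -/
noncomputable def velUnit (S : Setting n) (v : E n) (r : ℝ) : ℝ :=
  S.s v * S.β * ((1 - r) ^ (-S.α) / (S.α * kap v r))

/-- The size of the second order errors. -/
noncomputable def errUnit (S : Setting n) (v x : E n) (r : ℝ) : ℝ :=
  (n : ℝ) ^ 4 * S.β * velUnit S v r * (1 - r)⁻¹ * (r / S.c + ‖x‖ + 1)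
    * ((1 / S.c + 1) * (1 + 1 / kap v r))

namespace Admissible

lemma sqrt_n_ge (A : Admissible S v x r) :
    7 / 5 ≤ √(n : ℝ) := (Setting.one_le_sqrt_two_le A.dim).2.1

lemma sqrt_n_mul_self (A : Admissible S v x r) : √(n : ℝ) * √(n : ℝ) = n :=
  (Setting.one_le_sqrt_two_le A.dim).2.2

lemma two_le_n (A : Admissible S v x r) : (2 : ℝ) ≤ n := by exact_mod_cast A.dim

lemma n_cube_le (A : Admissible S v x r) : (n : ℝ) ^ 3 ≤ n ^ 4 / 2 := by
  have := A.two_le_n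
  have : 0 < (n : ℝ) ^ 3 := by positivity
  nlinarith

lemma n_sq_le (A : Admissible S v x r) : (n : ℝ) ^ 2 ≤ n ^ 4 / 4 := by
  have := A.two_le_n
  have : (2 : ℝ) ^ 2 ≤ n ^ 2 := by gcongr
  have : 0 < (n : ℝ) ^ 2 := by positivity
  nlinarith

lemma one_le_inv (A : Admissible S v x r) : 1 ≤ (1 - r)⁻¹ :=
  (one_le_inv₀ A.one_sub_pos).2 (by linarith [A.r_pos])

lemma rpow_div_pos (A : Admissible S v x r) : 0 < (1 - r) ^ (-S.α) / (S.α * kap v r) := by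
  have := A.one_sub_pos
  have := A.kap_pos
  have := S.α_pos
  positivity

/-- The factor `16/3 = 2 · 8/3` of `defl` is absorbed by `4 √n`, since `√n ≥ 7/5 > 4/3`. -/
lemma defl_le_sub (A : Admissible S v x r) :
    defl S x r ≤ 2 * (n * √(n : ℝ)) * (2 * S.β2 * (√(n : ℝ) * (‖x‖ + r) + 1)) := by
  have h1 := A.sqrt_n_ge
  have h2 := A.n_pos
  have h3 := S.β2_pos
  have h4 := A.r_pos
  rw [defl]
  set N := √(n : ℝ)
  have hx : 0 ≤ ‖x‖ + r := by positivity
  have e1 : 16 / 3 * (‖x‖ + r) ≤ 4 * N * (‖x‖ + r) := by gcongr; linarith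
  have e2 : 16 / 3 * (N * (‖x‖ + r) + 1) ≤ 4 * N * (N * (‖x‖ + r) + 1) := by
    gcongr; linarith
  have h5 : (0 : ℝ) ≤ n * S.β2 := by positivity
  calc _ = n * S.β2 * (16 / 3 * (N * (‖x‖ + r) + 1)) := by ring
    _ ≤ n * S.β2 * (4 * N * (N * (‖x‖ + r) + 1)) := by gcongr
    _ = _ := by ring

/-- The constant of the decay of `y_-`; the term `r β₁^l / c` is not needed. -/
lemma deflVel_in_le (A : Admissible S v x r) :
    deflVel S v x r ≤ 2 * (n : ℝ) ^ (3 / 2 : ℝ) * S.s v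
      * (r * S.βl1 / S.c + 2 * S.β2 * (√(n : ℝ) * (‖x‖ + r) + 1)) / ((S.α + 1) * kap v r) := by
  have h0 := A.kap_pos
  have h1 := A.s_pos
  have h2 := A.n_pos
  have h3 := S.βl1_pos
  have h4 := A.r_pos
  have h5 := S.c_pos
  have h6 := S.α_pos
  rw [deflVel, rpow_three_halves h2.le]
  have h := A.defl_le_sub
  have h7 : 0 ≤ r * S.βl1 / S.c := by positivity
  have h8 := mul_nonneg (by positivity : 0 ≤ 2 * (n * √(n : ℝ))) h7
  refine div_le_div_of_nonneg_right ?_ (by positivity)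
  calc _ ≤ S.s v * (2 * (n * √(n : ℝ)) * (r * S.βl1 / S.c
        + 2 * S.β2 * (√(n : ℝ) * (‖x‖ + r) + 1))) := by
        refine mul_le_mul_of_nonneg_left ?_ h1.le
        linarith
    _ = _ := by ring

/-- The constant of the decay of `y_+`. -/
lemma deflVel_out_le (A : Admissible S v x r) :
    deflVel S v x r ≤ 2 * (n : ℝ) ^ (3 / 2 : ℝ)
      * (r * S.βl1 / S.c + 2 * S.β2 * (√(n : ℝ) * (3 * ‖x‖ + r) + 3)) * S.s v
        / ((S.α + 1) * kap v r) := by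
  have h0 := A.kap_pos
  have h1 := A.s_pos
  have h3 := S.β2_pos
  have h6 := S.α_pos
  refine A.deflVel_in_le.trans ?_
  rw [mul_right_comm (2 * (n : ℝ) ^ (3 / 2 : ℝ))]
  gcongr
  · linarith [norm_nonneg x]
  · norm_num

/-- The bound of `b_sc = y_-(0) - y_+(0)`. -/
lemma two_mul_deflBound_le (A : Admissible S v x r) :
    2 * deflBound S v x r ≤ 4 * (n : ℝ) ^ (3 / 2 : ℝ) * S.s v
          * (r * S.βl1 / S.c + S.β2 * (√(n : ℝ) * (4 * ‖x‖ + r) + 4))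
        / (S.α * (S.α + 1) * kap v r ^ 2 * (1 - r) ^ S.α) := by
  have h0 := A.kap_pos
  have h1 := A.s_pos
  have h2 := A.n_pos
  have h3 := S.βl1_pos
  have h4 := A.r_pos
  have h4' := A.r_lt_one
  have h5 := S.c_pos
  have h6 := S.α_pos
  have h7 := A.sqrt_n_ge
  have h8 := S.β2_pos
  have hL := A.one_sub_pos
  set N := √(n : ℝ) with hN
  have key : defl S x r ≤ 2 * (n * N)
      * (r * S.βl1 / S.c + S.β2 * (N * (4 * ‖x‖ + r) + 4)) := by
    have h9 : 0 ≤ 2 * (n * N) * (r * S.βl1 / S.c) := by positivity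
    have e1 : 16 / 3 * (N * (‖x‖ + r) + 1) ≤ 2 * N * (N * (4 * ‖x‖ + r) + 4) := by
      have e2 : 7 / 5 * (N * ‖x‖) ≤ N * (N * ‖x‖) := by gcongr
      have e3 : 7 / 5 * (N * r) ≤ N * (N * r) := by gcongr
      have e4 : N * r ≤ N * 1 := by gcongr
      have e5 : 0 ≤ N * ‖x‖ := by positivity
      linarith
    have h10 : (0 : ℝ) ≤ n * S.β2 := by positivity
    have := mul_le_mul_of_nonneg_left e1 h10
    rw [defl]
    linarith
  rw [deflBound, deflVel, rpow_three_halves h2.le, Real.rpow_neg hL.le]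
  calc _ = 2 * S.s v * defl S x r
        / (S.α * (S.α + 1) * kap v r ^ 2 * (1 - r) ^ S.α) := by field_simp
    _ ≤ 2 * S.s v * (2 * (n * N) * (r * S.βl1 / S.c + S.β2 * (N * (4 * ‖x‖ + r) + 4)))
        / (S.α * (S.α + 1) * kap v r ^ 2 * (1 - r) ^ S.α) := by gcongr
    _ = _ := by ring

lemma defl_le (A : Admissible S v x r) :
    defl S x r ≤ 10 * (n * √(n : ℝ)) * S.β2 * (r / S.c + ‖x‖ + 1) := by
  have h1 := A.sqrt_n_ge
  have h2 := A.n_pos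
  have h3 := S.β2_pos
  have h4 := A.r_pos
  have h4' := A.r_lt_one
  have hc := S.c_pos
  have h5 : 0 ≤ r / S.c := by positivity
  set q := r / S.c + ‖x‖ + 1 with hq
  have hq1 : ‖x‖ + r ≤ q := by linarith
  have hq2 : 1 ≤ q := by linarith [norm_nonneg x]
  rw [defl]
  set N := √(n : ℝ)
  have e1 : 16 / 3 * (N * (‖x‖ + r) + 1) ≤ 10 * N * q := by
    have e2 : N * (‖x‖ + r) ≤ N * q := by gcongr
    have e3 : 7 / 5 * q ≤ N * q := by gcongr
    linarith
  have h6 : (0 : ℝ) ≤ n * S.β2 := by positivity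
  have := mul_le_mul_of_nonneg_left e1 h6
  linarith

lemma velUnit_pos (A : Admissible S v x r) : 0 < velUnit S v r :=
  mul_pos (mul_pos A.s_pos S.β_pos) A.rpow_div_pos

lemma deflBound_le (A : Admissible S v x r) :
    deflBound S v x r ≤ 10 * (n * √(n : ℝ)) * (r / S.c + ‖x‖ + 1) * velUnit S v r / kap v r := by
  have h0 := A.kap_pos
  have h1 := A.s_pos
  have hα := S.α_pos
  have hQ := A.rpow_div_pos
  have hβ := S.β2_le
  have hβ2 := S.β2_pos
  have hd := A.defl_le
  have hr := A.r_pos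
  have hc := S.c_pos
  rw [deflBound, deflVel, velUnit]
  set Q := (1 - r) ^ (-S.α) / (S.α * kap v r)
  have hd' : defl S x r ≤ 10 * (n * √(n : ℝ)) * S.β * (r / S.c + ‖x‖ + 1) :=
    hd.trans (by gcongr)
  calc _ ≤ S.s v * (10 * (n * √(n : ℝ)) * S.β * (r / S.c + ‖x‖ + 1)) / (1 * kap v r) * Q := by
        have : 0 ≤ r / S.c + ‖x‖ + 1 := by positivity
        have := S.β_pos
        gcongr
        linarith
    _ = _ := by ring

lemma smallness_eq (A : Admissible S v x r) : smallness S v r = (n : ℝ) ^ 2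
    * (S.s v * max S.βl1 S.β2 * ((1 - r) ^ (-S.α) / (S.α * kap v r))) * (1 - r)⁻¹ := by
  rw [smallness, show -(S.α + 1) = -S.α + -1 by ring, Real.rpow_add A.one_sub_pos,
    Real.rpow_neg_one]
  ring

lemma velBound_le (A : Admissible S v x r) :
    velBound S v r ≤ 16 * n * velUnit S v r * (1 - r)⁻¹ := by
  have h1 := A.s_pos
  have h2 := A.n_pos
  have hQ := A.rpow_div_pos
  have hm := S.max_le
  have hL := A.one_sub_pos
  rw [velBound, impulse, A.smallness_eq, velUnit]
  set Q := (1 - r) ^ (-S.α) / (S.α * kap v r)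
  calc _ = 16 * n * (S.s v * max S.βl1 S.β2 * Q) * (1 - r)⁻¹ := by field_simp; ring
    _ ≤ _ := by gcongr

lemma q_ge (A : Admissible S v x r) : 1 ≤ r / S.c + ‖x‖ + 1 := by
  have := A.r_pos
  have := S.c_pos
  have : 0 ≤ r / S.c := by positivity
  linarith [norm_nonneg x]

lemma inv_c_le (A : Admissible S v x r) : 1 / S.c ≤ (1 / S.c + 1) * (1 + 1 / kap v r) := by
  have := S.c_pos
  have := A.kap_pos
  have h1 : 0 < 1 / S.c := by positivity
  have h2 : 0 < 1 / kap v r := by positivity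
  nlinarith

lemma inv_add_inv_le (A : Admissible S v x r) :
    1 / S.c + 1 / kap v r ≤ (1 / S.c + 1) * (1 + 1 / kap v r) := by
  have := S.c_pos
  have := A.kap_pos
  have h1 : 0 < 1 / S.c := by positivity
  have h2 : 0 < 1 / kap v r := by positivity
  nlinarith

/-- With a position error of at most `j` times `deflBound`, the position contributes `10 j` and the
velocity `12`, after the powers of `n` are raised to `n⁴` with `n ≥ 2`. -/
lemma shortDiff_le (A : Admissible S v x r) {j Y : ℝ} (hj : 0 ≤ j)
    (hY : Y ≤ j * deflBound S v x r) :
    shortDiff S v r Y (velBound S v r) ≤ (10 * j + 12) * errUnit S v x r := by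
  have h0 := A.kap_pos
  have hα := S.α_pos
  have hβ := S.β_pos
  have hc := S.c_pos
  have hL := A.one_sub_pos
  have hq := A.q_ge
  have hP := A.velUnit_pos
  have hN := A.sqrt_n_ge
  have hNN := A.sqrt_n_mul_self
  have hn := A.two_le_n
  have hn0 := A.n_pos
  have hY' := hY.trans (mul_le_mul_of_nonneg_left A.deflBound_le hj)
  have hV := A.velBound_le
  have hK := A.inv_add_inv_le
  rw [shortDiff, errUnit]
  set K := (1 / S.c + 1) * (1 + 1 / kap v r)
  set q := r / S.c + ‖x‖ + 1
  set N := √(n : ℝ)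
  set P := velUnit S v r
  set L := (1 - r)⁻¹
  have hL0 : 0 < L := by positivity
  have i1 := A.n_cube_le
  have i3 := A.n_sq_le
  have i2 : 32 * ((n : ℝ) ^ 2 * N) ≤ 12 * n ^ 4 := by
    have e1 : 14 / 5 ≤ n * N := by nlinarith
    have e2 : (14 / 5) * N ≤ n ^ 2 := by
      calc (14 / 5) * N ≤ n * N * N := by gcongr
        _ = n ^ 2 := by rw [mul_assoc, hNN]; ring
    have e3 : 0 < (n : ℝ) ^ 2 := by positivity
    nlinarith
  calc _ ≤ 2 * (n * N) * S.β * (j * (10 * (n * N) * q * P / kap v r) * L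
          + 16 * n * P * L / kap v r) + n * S.β / S.c * (16 * n * P * L) := by gcongr
    _ = S.β * P * L * ((20 * j * (n ^ 3 * q) + 32 * (n ^ 2 * N)) * (1 / kap v r)
          + 16 * n ^ 2 * (1 / S.c)) := by
        have : (n : ℝ) ^ 3 = n * N * (n * N) := by
          rw [show (n : ℝ) * N * (n * N) = n ^ 2 * (N * N) by ring, hNN]; ring
        rw [this]; ring
    _ ≤ S.β * P * L * ((20 * j * (n ^ 4 / 2 * q) + 12 * n ^ 4 * q) * (1 / kap v r)
          + 16 * (n ^ 4 / 4 * q) * (1 / S.c)) := by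
        have i2' : 32 * ((n : ℝ) ^ 2 * N) ≤ 12 * n ^ 4 * q :=
          i2.trans (le_mul_of_one_le_right (by positivity) hq)
        have i3' : (n : ℝ) ^ 2 ≤ n ^ 4 / 4 * q :=
          i3.trans (le_mul_of_one_le_right (by positivity) hq)
        gcongr
    _ = n ^ 4 * S.β * P * L * q * ((10 * j + 12) * (1 / kap v r) + 4 * (1 / S.c)) := by ring
    _ ≤ n ^ 4 * S.β * P * L * q * ((10 * j + 12) * (1 / kap v r) + (10 * j + 12) * (1 / S.c)) := by
        gcongr
        linarith
    _ = n ^ 4 * S.β * P * L * q * ((10 * j + 12) * (1 / S.c + 1 / kap v r)) := by ring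
    _ ≤ n ^ 4 * S.β * P * L * q * ((10 * j + 12) * K) := by gcongr
    _ = _ := by ring

lemma longDiff_eq (A : Admissible S v x r) :
    longDiff S r (2 * deflBound S v x r) (deflVel S v x r)
      = S.s v * defl S x r * ((1 - r) ^ (-S.α) / (S.α * kap v r))
        * (4 * (n * √(n : ℝ)) * S.β2 * (1 / (S.α + 1)) / kap v r
          + n * S.βl1 / S.c * (S.α / (S.α + 1))) := by
  have h0 := A.kap_pos
  have hα := S.α_pos
  have hc := S.c_pos
  have hL := A.one_sub_pos
  rw [longDiff, deflBound, deflVel]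
  field_simp
  ring

/-- The long range force difference along the trajectory and along the shifted free solution,
in units of `β`. -/
lemma longDiff_le_mul (A : Admissible S v x r) :
    longDiff S r (2 * deflBound S v x r) (deflVel S v x r)
      ≤ 10 * (n * √(n : ℝ)) * S.β2 * (r / S.c + ‖x‖ + 1)
        * (S.s v * max S.βl1 S.β2 * ((1 - r) ^ (-S.α) / (S.α * kap v r)))
        * (4 * (n * √(n : ℝ)) * (1 / kap v r) + n / 2 * (1 / S.c)) := by
  have h0 := A.kap_pos
  have hα := S.α_pos
  have hα1 := S.α_le_one
  have hc := S.c_pos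
  have hL := A.one_sub_pos
  have hd := A.defl_le
  have hs := A.s_pos
  have hQ := A.rpow_div_pos
  have hq := A.q_ge
  have hβ2 := S.β2_pos
  have hβ1 := S.βl1_pos
  have hm := A.max_pos
  have m1 : S.βl1 ≤ max S.βl1 S.β2 := le_max_left _ _
  have m2 : S.β2 ≤ max S.βl1 S.β2 := le_max_right _ _
  have i2 : 1 / (S.α + 1) ≤ 1 := by rw [div_le_one (by linarith)]; linarith
  have i3 : S.α / (S.α + 1) ≤ 1 / 2 := by rw [div_le_iff₀ (by linarith)]; linarith
  rw [A.longDiff_eq]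
  set m := max S.βl1 S.β2
  set Q := (1 - r) ^ (-S.α) / (S.α * kap v r)
  set q := r / S.c + ‖x‖ + 1
  set N := √(n : ℝ)
  calc _ ≤ S.s v * (10 * (n * N) * S.β2 * q) * Q
        * (4 * (n * N) * m * 1 / kap v r + n * m / S.c * (1 / 2)) := by gcongr
    _ = _ := by ring

/-- The long range force difference is of second order: it is proportional to the deflection. -/
lemma longDiff_le_errUnit (A : Admissible S v x r) :
    longDiff S r (2 * deflBound S v x r) (deflVel S v x r) ≤ 20 * errUnit S v x r := by
  have h0 := A.kap_pos
  have hc := S.c_pos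
  have hL := A.one_le_inv
  have hq := A.q_ge
  have hβ := S.β_pos
  have hN := A.sqrt_n_ge
  have hNN := A.sqrt_n_mul_self
  have hn := A.two_le_n
  have hn0 := A.n_pos
  have hP := A.velUnit_pos
  have hK := A.inv_add_inv_le
  have hQ := A.rpow_div_pos
  have hs := A.s_pos
  have e : S.s v * max S.βl1 S.β2 * ((1 - r) ^ (-S.α) / (S.α * kap v r)) ≤ velUnit S v r := by
    rw [velUnit]; gcongr; exact S.max_le
  refine A.longDiff_le_mul.trans ?_
  rw [errUnit]
  set K := (1 / S.c + 1) * (1 + 1 / kap v r)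
  set q := r / S.c + ‖x‖ + 1
  set N := √(n : ℝ)
  set P := velUnit S v r
  set L := (1 - r)⁻¹
  have hm := A.max_pos
  have i1 := A.n_cube_le
  have i2 : (n : ℝ) ^ 2 * N ≤ n ^ 4 := by
    have e1 : N ≤ n ^ 2 := by nlinarith
    have e3 : 0 < (n : ℝ) ^ 2 := by positivity
    nlinarith
  calc _ ≤ 10 * (n * N) * S.β * q * P * (4 * (n * N) * (1 / kap v r) + n / 2 * (1 / S.c)) := by
        gcongr; exact S.β2_le
    _ = S.β * P * q * (40 * n ^ 3 * (1 / kap v r) + 5 * (n ^ 2 * N) * (1 / S.c)) := by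
        have : (n : ℝ) ^ 3 = n * N * (n * N) := by
          rw [show (n : ℝ) * N * (n * N) = n ^ 2 * (N * N) by ring, hNN]; ring
        rw [this]; ring
    _ ≤ S.β * P * q * (40 * (n ^ 4 / 2) * (1 / kap v r) + 20 * n ^ 4 * (1 / S.c)) := by
        gcongr
        norm_num
    _ = 20 * (n ^ 4 * S.β * P * q * (1 / S.c + 1 / kap v r)) := by ring
    _ ≤ 20 * (n ^ 4 * S.β * P * q * K) := by gcongr
    _ ≤ 20 * (n ^ 4 * S.β * P * q * K * L) := by
        refine mul_le_mul_of_nonneg_left ?_ (by norm_num)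
        exact le_mul_of_one_le_right (by positivity) hL
    _ = _ := by ring

/-- The smallness hypothesis makes the long range force difference of first order only. -/
lemma longDiff_le_beta (A : Admissible S v x r) :
    longDiff S r (2 * deflBound S v x r) (deflVel S v x r)
      ≤ 2 * n * S.β * (r / S.c + ‖x‖ + 1) := by
  have h0 := A.kap_pos
  have hc := S.c_pos
  have hq := A.q_ge
  have hβ := S.β_pos
  have hβ2 := S.β2_pos
  have hN := A.sqrt_n_ge
  have hNN := A.sqrt_n_mul_self
  have hn := A.two_le_n
  have hn0 := A.n_pos
  have hsm := A.smallness_ge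
  have hs1 := A.smallness_le_kap
  have hs2 := A.smallness_le_c
  refine A.longDiff_le_mul.trans ?_
  set m := max S.βl1 S.β2
  set Q := (1 - r) ^ (-S.α) / (S.α * kap v r)
  set q := r / S.c + ‖x‖ + 1
  set N := √(n : ℝ)
  set T := S.s v * m * Q
  have t1 : (n : ℝ) ^ 2 * T * (1 / kap v r) ≤ 1 / 24 := by
    rw [mul_one_div, div_le_iff₀ h0]
    calc (n : ℝ) ^ 2 * T = n ^ 2 * S.s v * m * Q := by ring
      _ ≤ _ := by linarith
  have t2 : (n : ℝ) ^ 2 * T * (1 / S.c) ≤ 1 / 24 := by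
    rw [mul_one_div, div_le_iff₀ hc]
    calc (n : ℝ) ^ 2 * T = n ^ 2 * S.s v * m * Q := by ring
      _ ≤ _ := by linarith
  have hNn : N ≤ n := by nlinarith
  have hT : 0 < T := mul_pos (mul_pos A.s_pos A.max_pos) A.rpow_div_pos
  calc _ = S.β2 * q * (40 * (N * N) * (n ^ 2 * T * (1 / kap v r))
          + 5 * N * (n ^ 2 * T * (1 / S.c))) := by ring
    _ ≤ S.β * q * (40 * n * (1 / 24) + 5 * n * (1 / 24)) := by
        rw [hNN]
        have hβ' := S.β2_le
        gcongr
    _ ≤ 2 * n * S.β * q := by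
        have : 0 < n * S.β * q := by positivity
        nlinarith

/-- The three terms of `velErr` contribute `64`, `104` and `16`: the second order term of the
expansion of `g`, the change of the momentum transfer, and the change of the direction of motion. -/
lemma velErr_le (A : Admissible S v x r) :
    velErr S v r (2 * deflBound S v x r) (deflVel S v x r) (velBound S v r)
      ≤ 184 * (S.s v * errUnit S v x r) / ((S.α + 1) * kap v r) := by
  have h0 := A.kap_pos
  have hα := S.α_pos
  have hβ := S.β_pos
  have hβ2 := S.β2_pos
  have hβ2' := S.β2_le
  have hc := S.c_pos
  have hL := A.one_sub_pos
  have hq := A.q_ge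
  have hP := A.velUnit_pos
  have hn := A.two_le_n
  have hn0 := A.n_pos
  have hs := A.s_pos
  have hV0 := A.velBound_pos
  have hI := A.impulse_pos
  have hM1 := A.longDiff_le_errUnit
  have hM2 := A.longDiff_le_beta
  have hSD := A.shortDiff_le (j := 2) (Y := 2 * deflBound S v x r) (by norm_num) le_rfl
  rw [velErr]
  refine div_le_div_of_nonneg_right ?_ (by positivity)
  set M := longDiff S r (2 * deflBound S v x r) (deflVel S v x r)
  set B := shortDiff S v r (2 * deflBound S v x r) (velBound S v r)
  have i3 := A.n_sq_le
  -- the terms with a factor `1 / c` are of second order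
  have hU : (n : ℝ) ^ 2 * S.β * velUnit S v r * (1 - r)⁻¹ * (r / S.c + ‖x‖ + 1) * (1 / S.c)
      ≤ errUnit S v x r / 4 := by
    have := A.inv_c_le
    rw [errUnit]
    calc _ ≤ n ^ 4 / 4 * S.β * velUnit S v r * (1 - r)⁻¹ * (r / S.c + ‖x‖ + 1)
          * ((1 / S.c + 1) * (1 + 1 / kap v r)) := by gcongr
      _ = _ := by ring
  set q := r / S.c + ‖x‖ + 1
  have hV := A.velBound_le
  have hβq : S.β2 ≤ S.β * q := hβ2'.trans (le_mul_of_one_le_right hβ.le hq)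
  have hM0 : 0 ≤ M + 2 * n * S.β2 := by
    have := A.deflBound_pos
    have := A.deflVel_pos
    have := S.βl1_pos
    have : 0 ≤ M := by unfold M longDiff; positivity
    positivity
  have t1 : 8 * S.s v ^ 2 / S.c * impulse S v r * (M + 2 * n * S.β2)
      ≤ S.s v * (64 * errUnit S v x r) := by
    calc _ = 4 * S.s v * (1 / S.c) * velBound S v r * (M + 2 * n * S.β2) := by
          rw [velBound]; ring
      _ ≤ 4 * S.s v * (1 / S.c) * (16 * n * velUnit S v r * (1 - r)⁻¹)
          * (2 * n * S.β * q + 2 * n * (S.β * q)) := by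
          gcongr
      _ = S.s v * (256 * (n ^ 2 * S.β * velUnit S v r * (1 - r)⁻¹ * q * (1 / S.c))) := by ring
      _ ≤ S.s v * (256 * (errUnit S v x r / 4)) := by gcongr
      _ = _ := by ring
  have t2 : 2 * S.s v * (M + B) ≤ S.s v * (104 * errUnit S v x r) := by
    calc _ ≤ 2 * S.s v * (20 * errUnit S v x r + (10 * 2 + 12) * errUnit S v x r) := by gcongr
      _ = _ := by ring
  have t3 : 2 * S.s v * (velBound S v r / S.c) * (2 * n * S.β2)
      ≤ S.s v * (16 * errUnit S v x r) := by
    calc _ = 2 * S.s v * (1 / S.c) * velBound S v r * (2 * n * S.β2) := by ring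
      _ ≤ 2 * S.s v * (1 / S.c) * (16 * n * velUnit S v r * (1 - r)⁻¹) * (2 * n * (S.β * q)) := by
          gcongr
      _ = S.s v * (64 * (n ^ 2 * S.β * velUnit S v r * (1 - r)⁻¹ * q * (1 / S.c))) := by ring
      _ ≤ S.s v * (64 * (errUnit S v x r / 4)) := by gcongr
      _ = _ := by ring
  linarith

lemma rpow_two_mul (A : Admissible S v x r) (p : ℕ) :
    (1 - r) ^ (2 * S.α + p) = (1 - r) ^ S.α * (1 - r) ^ S.α * (1 - r) ^ p := by
  rw [Real.rpow_add A.one_sub_pos, two_mul, Real.rpow_add A.one_sub_pos, Real.rpow_natCast]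

lemma s_sq (A : Admissible S v x r) : 1 - ‖v‖ ^ 2 / S.c ^ 2 = S.s v ^ 2 := by
  have := one_sub_sq_pos S.c_pos A.speed_lt
  rw [Setting.s, Real.sq_sqrt this.le]

end Admissible

/-- A line in the direction `v`, with impact parameter `x`, in terms of `|t||v| + |x|`. -/
lemma norm_smul_add_ge (h : inner ℝ v x = 0) (t : ℝ) :
    (|t| * ‖v‖ + ‖x‖) / √2 ≤ ‖t • v + x‖ := by
  have h1 : ‖t • v + x‖ ^ 2 = (|t| * ‖v‖) ^ 2 + ‖x‖ ^ 2 := by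
    rw [norm_add_sq_real, inner_smul_left, h, norm_smul, Real.norm_eq_abs]; simp
  refine le_of_sq_le_sq ?_ (norm_nonneg _)
  rw [h1, div_pow, Real.sq_sqrt (by norm_num)]
  linarith [sq_nonneg (|t| * ‖v‖ - ‖x‖)]

namespace FixedPoint

/-- Unlike the free solutions, the trajectory keeps away from the origin by a multiple of the
impact parameter. -/
lemma rho_le_traj (Y : FixedPoint S v x r y) (t : ℝ) :
    rho (1 + ‖x‖ / √2 - r) (kap v r) t ≤ 1 + ‖S.traj v x y t‖ := by
  have h1 := norm_smul_add_ge Y.adm.orth t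
  have h2 := Y.norm_traj_sub_le t
  have h3 := _root_.norm_sub_le (S.traj v x y t) (S.traj v x y t - t • v - x)
  rw [show S.traj v x y t - (S.traj v x y t - t • v - x) = t • v + x by abel] at h3
  have h4 : √(2 : ℝ) ≤ 2 := Real.sqrt_le_iff.2 ⟨by norm_num, by norm_num⟩
  have h5 : (0 : ℝ) < √2 := by positivity
  have h6 : ‖v‖ / 8 ≤ ‖v‖ / (2 * √2) := by gcongr; linarith
  have h7 : (|t| * ‖v‖ + ‖x‖) / √2 = 2 * (|t| * (‖v‖ / (2 * √2))) + ‖x‖ / √2 := by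
    field_simp
  have h8 := mul_le_mul_of_nonneg_left h6 (abs_nonneg t)
  unfold rho kap
  rw [h7] at h1
  linarith

/-- The exact formula `a_sc = s ∫ F(x)`, with the force bounded along the trajectory itself. -/
theorem norm_asc_le (Y : FixedPoint S v x r y) :
    ‖S.asc v x y‖ ≤ 8 * (n : ℝ) ^ (3 / 2 : ℝ) * S.s v
        / (kap v r * (1 + ‖x‖ / √2 - r) ^ S.α)
      * (S.βl1 / S.α + S.β2 / ((S.α + 1) * (1 + ‖x‖ / √2 - r))) := by
  have A := Y.adm
  have Fo := S.forces A.dim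
  have h0 := A.kap_pos
  have hα := S.α_pos
  have hs := A.s_pos
  have hn := A.n_pos
  have hN := A.sqrt_n_ge
  have hβ1 := S.βl1_pos
  have hβ2 := S.β2_pos
  have hβs := S.βs2_pos
  have hβ : S.βs2 ≤ S.β2 := le_max_right _ _
  set a := 1 + ‖x‖ / √2 - r with ha
  have ha0 : 0 < a := by
    have : 0 ≤ ‖x‖ / √2 := by positivity
    linarith [A.one_sub_pos]
  have hl : ∀ t, ‖along S.Fl (S.traj v x y) t‖
      ≤ 2 * n * S.βl1 * rho a (kap v r) t ^ (-(S.α + 1)) := fun t =>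
    (Fo.long.bound _ _ (Y.speed_le t)).trans (mul_le_mul_of_nonneg_left
      (rpow_neg_anti (rho_pos ha0 h0 t) (Y.rho_le_traj t) (by linarith)) (by positivity))
  have hsh : ∀ t, ‖along S.Fs (S.traj v x y) t‖
      ≤ 2 * n * S.β2 * rho a (kap v r) t ^ (-(S.α + 1 + 1)) := fun t =>
    (Fo.short.bound _ _ (Y.speed_le t)).trans (mul_le_mul (by gcongr)
      (rpow_neg_anti (rho_pos ha0 h0 t) (Y.rho_le_traj t) (by linarith)) (by
        have : 0 ≤ ‖S.traj v x y t‖ := norm_nonneg _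
        positivity) (by positivity))
  have il : Integrable (along S.Fl (S.traj v x y)) :=
    integrable_of_le_rho ha0 h0 hα
      (Fo.long.continuous_along Y.contDiff_traj.continuous Y.continuous_deriv_traj) hl
  have is : Integrable (along S.Fs (S.traj v x y)) :=
    integrable_of_le_rho ha0 h0 (by linarith : 0 < S.α + 1)
      (Fo.short.continuous_along Y.contDiff_traj.continuous Y.continuous_deriv_traj) hsh
  have e : ∫ t, along S.F (S.traj v x y) t
      = (∫ t, along S.Fl (S.traj v x y) t) + ∫ t, along S.Fs (S.traj v x y) t :=
    integral_add il is
  have b1 := norm_integral_le_rho ha0 h0 hα hl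
  have b2 := norm_integral_le_rho ha0 h0 (by linarith : 0 < S.α + 1) hsh
  rw [Y.asc_eq, e, norm_smul, Real.norm_of_nonneg hs.le, rpow_three_halves hn.le]
  calc _ ≤ S.s v * (2 * n * S.βl1 * (2 * (a ^ (-S.α) / (S.α * kap v r)))
        + 2 * n * S.β2 * (2 * (a ^ (-(S.α + 1)) / ((S.α + 1) * kap v r)))) :=
        mul_le_mul_of_nonneg_left ((norm_add_le _ _).trans (add_le_add b1 b2)) hs.le
    _ = 4 * (n * 1) * S.s v / (kap v r * a ^ S.α)
        * (S.βl1 / S.α + S.β2 / ((S.α + 1) * a)) := by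
        rw [show -(S.α + 1) = -S.α + -1 by ring, Real.rpow_add ha0, Real.rpow_neg_one,
          Real.rpow_neg ha0.le]
        field_simp
        norm_num
    _ ≤ _ := by
        gcongr
        · norm_num
        · linarith

theorem norm_asc_sub_le (Y : FixedPoint S v x r y) :
    ‖S.asc v x y - S.s v • ∫ τ : ℝ, S.F (τ • v + x) v‖ ≤
      520 * (n : ℝ) ^ 4 * S.β ^ 2 * (1 - ‖v‖ ^ 2 / S.c ^ 2) * (r / S.c + ‖x‖ + 1)
          * (1 / S.c + 1) * (1 + 1 / kap v r) ^ 2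
        / (S.α ^ 2 * kap v r ^ 2 * (1 - r) ^ (2 * S.α + 3)) := by
  have A := Y.adm
  have h0 := A.kap_pos
  have hα := S.α_pos
  have hβ := S.β_pos
  have hc := S.c_pos
  have hL := A.one_sub_pos
  have hL1 := A.one_le_inv
  have hs := A.s_pos
  have hQ := A.rpow_div_pos
  have hP := A.velUnit_pos
  have hq := A.q_ge
  have hn := A.n_pos
  refine Y.norm_asc_sub_le_shortDiff.trans ?_
  have h1 := A.shortDiff_le (j := 1) (Y := deflBound S v x r) (by norm_num) (by rw [one_mul])
  have h2 : 1 ≤ 1 + 1 / kap v r := by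
    have : 0 < 1 / kap v r := by positivity
    linarith
  have hU : 0 ≤ errUnit S v x r := by unfold errUnit; positivity
  have hD := A.shortDiff_nonneg
  set Q := (1 - r) ^ (-S.α) / (S.α * kap v r) with hQdef
  calc _ ≤ S.s v * (((1 - r)⁻¹ + (1 - r)⁻¹) * ((10 * 1 + 12) * errUnit S v x r) * (2 * Q)) := by
        gcongr
    _ = 88 * (S.s v * (1 - r)⁻¹ * errUnit S v x r * Q) := by ring
    _ ≤ 520 * (S.s v * (1 - r)⁻¹ * (errUnit S v x r * ((1 - r)⁻¹ * (1 + 1 / kap v r))) * Q) := by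
        gcongr
        · norm_num
        · exact le_mul_of_one_le_right hU (one_le_mul_of_one_le_of_one_le hL1 h2)
    _ = _ := by
        rw [errUnit, velUnit, hQdef, A.s_sq, Real.rpow_neg hL.le]
        have := A.rpow_two_mul 3
        rw [Nat.cast_ofNat] at this
        rw [this]
        field_simp

theorem norm_bsc_sub_le (Y : FixedPoint S v x r y) :
    ‖S.bsc v x y - S.W v x y
        - S.s v • ((∫ σ in Iic (0 : ℝ), ∫ τ in Iic σ, S.Fs (τ • v + x) v)
          - (∫ σ in Ioi (0 : ℝ), ∫ τ in Ioi σ, S.Fs (τ • v + x) v)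
          + (∫ σ : ℝ, S.Vs (σ • v + x)) • ((1 / S.c ^ 2) • v))‖ ≤
      468 * (n : ℝ) ^ 4 * S.β ^ 2 * (1 - ‖v‖ ^ 2 / S.c ^ 2) * (r / S.c + ‖x‖ + 1)
          * (1 / S.c + 1) * (1 + 1 / kap v r) ^ 2
        / (S.α ^ 2 * (S.α + 1) * kap v r ^ 3 * (1 - r) ^ (2 * S.α + 2)) := by
  have A := Y.adm
  have h0 := A.kap_pos
  have hα := S.α_pos
  have hβ := S.β_pos
  have hc := S.c_pos
  have hL := A.one_sub_pos
  have hL1 := A.one_le_inv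
  have hs := A.s_pos
  have hQ := A.rpow_div_pos
  have hP := A.velUnit_pos
  have hq := A.q_ge
  have hn := A.n_pos
  refine Y.norm_bsc_sub_le_velErr.trans ?_
  have h1 := A.velErr_le
  have h2 : 1 ≤ 1 + 1 / kap v r := by
    have : 0 < 1 / kap v r := by positivity
    linarith
  have hU : 0 ≤ errUnit S v x r := by unfold errUnit; positivity
  set Q := (1 - r) ^ (-S.α) / (S.α * kap v r) with hQdef
  calc _ ≤ 2 * (184 * (S.s v * errUnit S v x r) / ((S.α + 1) * kap v r) * Q) := by
        gcongr
    _ = 368 * (S.s v * errUnit S v x r) * Q / ((S.α + 1) * kap v r) := by ring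
    _ ≤ 468 * (S.s v * (errUnit S v x r * ((1 - r)⁻¹ * (1 + 1 / kap v r)))) * Q
        / ((S.α + 1) * kap v r) := by
        gcongr
        · norm_num
        · exact le_mul_of_one_le_right hU (one_le_mul_of_one_le_of_one_le hL1 h2)
    _ = _ := by
        rw [errUnit, velUnit, hQdef, A.s_sq, Real.rpow_neg hL.le]
        have := A.rpow_two_mul 2
        rw [Nat.cast_ofNat] at this
        rw [this]
        field_simp

end FixedPoint

end RelScat

namespace RelScat

variable {n : ℕ} {S : Setting n} {v x : E n} {r : ℝ} {y : ℝ → E n}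

/-! ### Scattering data -/

lemma Admissible.tendsto_rho (A : Admissible S v x r) {l : Filter ℝ}
    (hl : Tendsto (fun t : ℝ => |t|) l atTop) (C : ℝ) :
    Tendsto (fun t => C * rho (1 - r) (kap v r) t ^ (-(S.α + 1))) l (𝓝 0) := by
  have h1 : Tendsto (fun t => rho (1 - r) (kap v r) t) l atTop :=
    tendsto_atTop_add_const_left _ _ (hl.const_mul_atTop A.kap_pos)
  have := ((tendsto_rpow_neg_atTop (by linarith [S.α_pos] : 0 < S.α + 1)).comp h1).const_mul C
  rwa [mul_zero] at this

namespace FixedPoint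

theorem isScatteringSolution (Y : FixedPoint S v x r y) :
    S.IsScatteringSolution v x (S.a v x y) (S.b v x y) (S.traj v x y) where
  solution := Y.isSolution
  speed_in := ⟨Y.adm.le_speed, Y.adm.speed_lt⟩
  speed_out := ⟨Y.le_speed_a, Y.speed_a_lt⟩
  incoming := by
    refine (tendsto_integral_Iic Y.integrableOn_Adot).congr fun t => ?_
    rw [show S.traj v x y t - (S.zMinus v t + x) = y t by simp only [Setting.traj]; abel]
    exact Y.fixed t
  incoming_vel := by
    refine squeeze_zero_norm' ?_ (Y.adm.tendsto_rho tendsto_abs_atBot_atTop (deflVel S v x r))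
    filter_upwards [eventually_le_atBot 0] with t ht
    rw [Y.deriv_traj, add_sub_cancel_left]
    exact Y.norm_deriv_y_le ht
  outgoing := by
    have h := (tendsto_integral_Ioi Y.integrableOn_yPlusIntegrand).neg
    rw [neg_zero] at h
    refine h.congr fun t => ?_
    rw [Y.traj_eq_out, add_sub_cancel_left, Setting.yPlus]
  outgoing_vel := by
    refine squeeze_zero_norm' ?_ (Y.adm.tendsto_rho tendsto_abs_atTop_atTop (deflVel S v x r))
    filter_upwards [eventually_ge_atTop 0] with t ht
    rw [← Y.yPlusIntegrand_eq]
    exact Y.norm_yPlusIntegrand_le ht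

theorem integralsConverge (Y : FixedPoint S v x r y) : S.IntegralsConverge v x y := by
  have A := Y.adm
  have Fo := S.forces A.dim
  refine ⟨Y.integrable, ?_, ?_, (Y.freeNear_out.integrable Fo A).integrableOn,
    (Y.freeNear_out.integrable_add Fo A).integrableOn, Y.integrableOn_Adot,
    Y.integrableOn_yPlusIntegrand, A.integrableOn_WIn, Y.integrableOn_WOut,
    Fo.integrable_line_total A, Fo.integrable_line_short A, ?_, Fo.integrableOn_integral_line A,
    A.integrable_potential⟩
  · have h := (A.freeNear_in.integrable Fo.rev A.neg).comp_neg
    simpa only [along_rev, neg_neg] using h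
  · have h := (A.freeNear_in.integrable_add Fo.rev A.neg).comp_neg
    simpa only [along_rev (fun t => S.zMinus v t + x), neg_neg] using h
  · have h := integrableOn_comp_neg_Iic.2 (Fo.rev.integrableOn_integral_line A.neg)
    rw [neg_zero] at h
    refine h.congr_fun (fun σ _ => ?_) measurableSet_Iic
    simp only [integral_Iic_eq_Ioi_neg _ σ, revForce, neg_neg, smul_neg, neg_smul]

end FixedPoint

end RelScat

theorem mainTheorem2 {n : ℕ} (hn : 2 ≤ n) (S : RelScat.Setting n)
    (v x : RelScat.E n) (hvc : ‖v‖ < S.c) (hvμ : S.muL ≤ ‖v‖) (hvx : inner ℝ v x = 0)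
    (r : ℝ) (hr0 : 0 < r) (hrv : r < ‖v‖ / (2 * √2)) (hr1 : r < 1)
    (y : ℝ → RelScat.E n) (hyM : S.MemM r v y) (hyA : ∀ t, S.A v x y t = y t)
    (hsmall :
      24 * (n : ℝ) ^ 2 * S.s v * max S.βl1 S.β2 * (1 + 1 / S.c)
          * (1 + 1 / (‖v‖ / (2 * √2) - r))
        / (S.α * (‖v‖ / (2 * √2) - r) * (1 - r) ^ (S.α + 1)) ≤ 1) :
    -- the objects are well defined
    (∃! z, S.IsFree atBot v z) ∧
    (∃! z, S.IsFree atTop (S.a v x y) z) ∧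
    S.IntegralsConverge v x y ∧
    -- `a` and `b` are the scattering data of the trajectory `z_- + x_- + y_-`
    S.IsScatteringSolution v x (S.a v x y) (S.b v x y) (S.traj v x y) ∧
    (∀ t, 0 ≤ t →
      S.traj v x y t = S.zPlus (S.a v x y) t + S.b v x y + S.yPlus v x y t) ∧
    -- decay of the derivative of `y_-`
    (∀ t, t ≤ 0 → ‖deriv y t‖ ≤
      2 * (n : ℝ) ^ (3 / 2 : ℝ) * S.s v
          * (r * S.βl1 / S.c + 2 * S.β2 * (√(n : ℝ) * (‖x‖ + r) + 1))
        / ((S.α + 1) * (‖v‖ / (2 * √2) - r)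
          * (1 - r - (‖v‖ / (2 * √2) - r) * t) ^ (S.α + 1))) ∧
    -- bound on `a_sc`
    ‖S.asc v x y‖ ≤
      8 * (n : ℝ) ^ (3 / 2 : ℝ) * S.s v
          / ((‖v‖ / (2 * √2) - r) * (1 + ‖x‖ / √2 - r) ^ S.α)
        * (S.βl1 / S.α + S.β2 / ((S.α + 1) * (1 + ‖x‖ / √2 - r))) ∧
    -- bound on `b_sc`
    ‖S.bsc v x y‖ ≤
      4 * (n : ℝ) ^ (3 / 2 : ℝ) * S.s v
          * (r * S.βl1 / S.c + S.β2 * (√(n : ℝ) * (4 * ‖x‖ + r) + 4))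
        / (S.α * (S.α + 1) * (‖v‖ / (2 * √2) - r) ^ 2 * (1 - r) ^ S.α) ∧
    -- decay of the derivative of `y_+`
    (∀ t, 0 ≤ t → DifferentiableAt ℝ (S.yPlus v x y) t ∧
      ‖deriv (S.yPlus v x y) t‖ ≤
        2 * (n : ℝ) ^ (3 / 2 : ℝ)
            * (r * S.βl1 / S.c + 2 * S.β2 * (√(n : ℝ) * (3 * ‖x‖ + r) + 3)) * S.s v
          / ((S.α + 1) * (‖v‖ / (2 * √2) - r)
            * (1 - r + t * (‖v‖ / (2 * √2) - r)) ^ (S.α + 1))) ∧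
    -- error estimate for `a_sc`
    ‖S.asc v x y - S.s v • ∫ τ : ℝ, S.F (τ • v + x) v‖ ≤
      520 * (n : ℝ) ^ 4 * S.β ^ 2 * (1 - ‖v‖ ^ 2 / S.c ^ 2) * (r / S.c + ‖x‖ + 1)
          * (1 / S.c + 1) * (1 + 1 / (‖v‖ / (2 * √2) - r)) ^ 2
        / (S.α ^ 2 * (‖v‖ / (2 * √2) - r) ^ 2 * (1 - r) ^ (2 * S.α + 3)) ∧
    -- error estimate for `b_sc`
    ‖S.bsc v x y - S.W v x y
        - S.s v • ((∫ σ in Iic (0 : ℝ), ∫ τ in Iic σ, S.Fs (τ • v + x) v)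
          - (∫ σ in Ioi (0 : ℝ), ∫ τ in Ioi σ, S.Fs (τ • v + x) v)
          + (∫ σ : ℝ, S.Vs (σ • v + x)) • ((1 / S.c ^ 2) • v))‖ ≤
      468 * (n : ℝ) ^ 4 * S.β ^ 2 * (1 - ‖v‖ ^ 2 / S.c ^ 2) * (r / S.c + ‖x‖ + 1)
          * (1 / S.c + 1) * (1 + 1 / (‖v‖ / (2 * √2) - r)) ^ 2
        / (S.α ^ 2 * (S.α + 1) * (‖v‖ / (2 * √2) - r) ^ 3
          * (1 - r) ^ (2 * S.α + 2)) := by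
  have A : RelScat.Admissible S v x r :=
    ⟨hn, hvc, hvμ, hvx, hr0, hrv, hr1, hsmall⟩
  have Y : RelScat.FixedPoint S v x r y := ⟨A, hyM, hyA⟩
  have hk := A.kap_pos
  have hα := S.α_pos
  have hL := A.one_sub_pos
  refine ⟨RelScat.Setting.existsUnique_isFree_atBot hn hvμ hvc,
    RelScat.Setting.existsUnique_isFree_atTop hn Y.le_speed_a Y.speed_a_lt, Y.integralsConverge,
    Y.isScatteringSolution, fun t _ => Y.traj_eq_out t, fun t ht => ?_, Y.norm_asc_le, ?_,
    fun t ht => ⟨(Y.hasDerivAt_yPlus t).differentiableAt, ?_⟩, Y.norm_asc_sub_le,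
    Y.norm_bsc_sub_le⟩
  · have e : 1 - r - RelScat.kap v r * t = RelScat.rho (1 - r) (RelScat.kap v r) t := by
      rw [RelScat.rho, abs_of_nonpos ht]; ring
    have hρ := A.rho_pos t
    change _ ≤ _ / ((S.α + 1) * RelScat.kap v r * (1 - r - RelScat.kap v r * t) ^ (S.α + 1))
    rw [e, ← div_div, div_eq_mul_inv _ (RelScat.rho (1 - r) (RelScat.kap v r) t ^ (S.α + 1)),
      ← Real.rpow_neg hρ.le]
    exact (Y.norm_deriv_y_le ht).trans (mul_le_mul_of_nonneg_right A.deflVel_in_le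
      (Real.rpow_pos_of_pos hρ _).le)
  · have h : S.bsc v x y = y 0 - S.yPlus v x y 0 := by
      rw [RelScat.Setting.bsc, RelScat.Setting.b, hyA 0]; abel
    rw [h]
    refine le_trans ?_ A.two_mul_deflBound_le
    rw [two_mul]
    exact (norm_sub_le _ _).trans (add_le_add (Y.norm_y_le le_rfl) (Y.norm_yPlus_le le_rfl))
  · have e : 1 - r + t * RelScat.kap v r = RelScat.rho (1 - r) (RelScat.kap v r) t := by
      rw [RelScat.rho, abs_of_nonneg ht]; ring
    have hρ := A.rho_pos t
    change _ ≤ _ / ((S.α + 1) * RelScat.kap v r * (1 - r + t * RelScat.kap v r) ^ (S.α + 1))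
    rw [(Y.hasDerivAt_yPlus t).deriv, e, ← div_div,
      div_eq_mul_inv _ (RelScat.rho (1 - r) (RelScat.kap v r) t ^ (S.α + 1)),
      ← Real.rpow_neg hρ.le]
    exact (Y.norm_yPlusIntegrand_le ht).trans (mul_le_mul_of_nonneg_right A.deflVel_out_le
      (Real.rpow_pos_of_pos hρ _).le)
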